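/- Fix $\alpha>1/2$ and $\nu>0$. For $n\ge 1$ let $R_n=2\log(n/\nu)$, and for $n>\nu$ let $\mu_n$ be the probability measure on the Poincaré disc (the hyperbolic plane of curvature $-1$, with hyperbolic distance $d$ and centre $0$) under which, in polar coordinates $(r,\theta)$ where $r$ is the hyperbolic distance to the centre, $r$ and $\theta$ are independent, $\theta$ is uniform on $(-\pi,\pi]$, and $r$ has density $$\rho_n(r)=\frac{\alpha\sinh(\alpha r)}{\cosh(\alpha R_n)-1}\,\mathbf 1_{\{0\le r<R_n\}}.$$ Let $X_1,\dots,X_n$ be independent points of law $\mu_n$, and consider the random hyperbolic graph with these points as nodes, in which two distinct nodes are joined by an edge if and only if their hyperbolic distance is at most $R_n$. Write $r(x)=d(x,0)$, let $\deg(X_i)$ be the degree of $X_i$ in this graph, and let $X_{(1)},\dots,X_{(n)}$ be a reordering of the nodes by increasing radius: $r(X_{(1)})\le\dots\le r(X_{(n)})$. **Theorem.** Let $(v_n)$ be any real sequence with $v_n\to\infty$, and set $$\beta=\frac1{1+8\alpha},\qquad k_n=n^{\beta}\log(n)^{-2\alpha}.$$ Then, with probability tending to $1$ as $n\to\infty$,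 both of the following hold (where in (1) the rank $k_n$ is read as its integer part): 1. $\deg(X_{(1)})>\deg(X_{(2)})>\dots>\deg(X_{(k_n)})>\deg(X_{(i)})$ for all $i>k_n$, $i\le n$; 2. there is an integer $i\in[n^{\beta},n^{\beta}v_n]$ with $i+1\le n$ and $\deg(X_{(i)})<\deg(X_{(i+1)})$. -/

import Mathlib

noncomputable section

namespace RHG

open MeasureTheory

/-- The Poincaré disc, i.e. the open unit disc of `ℂ`, carries its Borel σ-algebra. -/
instance : MeasurableSpace Complex.UnitDisc := borel _

instance : BorelSpace Complex.UnitDisc := ⟨rfl⟩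

/-- The hyperbolic distance (curvature `-1`) on the Poincaré disc, i.e. the distance induced by
the Riemannian metric `4 g_ℂ / (1 - |w|²)²`:
`sinh (d(z, w) / 2) = |z - w| / √((1 - |z|²) (1 - |w|²))`. -/
def hypDist (z w : Complex.UnitDisc) : ℝ :=
  2 * Real.arsinh (‖(z : ℂ) - (w : ℂ)‖ / √((1 - ‖(z : ℂ)‖ ^ 2) * (1 - ‖(w : ℂ)‖ ^ 2)))

/-- The radius `r(z)` of a point: its hyperbolic distance to the centre of the disc. -/
def radius (z : Complex.UnitDisc) : ℝ := hypDist z 0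

theorem norm_tanh_mul_exp_lt_one (r θ : ℝ) :
    ‖(Real.tanh (r / 2) : ℂ) * Complex.exp (θ * Complex.I)‖ < 1 := by
  rw [norm_mul, Complex.norm_exp_ofReal_mul_I, mul_one, Complex.norm_real, Real.norm_eq_abs]
  exact Real.abs_tanh_lt_one _

/-- The point of the Poincaré disc with polar coordinates `p = (r, θ)`: for `r ≥ 0` its hyperbolic
distance to the origin is `r` and its angle in the complex plane is `θ`. -/
def ofPolar (p : ℝ × ℝ) : Complex.UnitDisc :=
  Complex.UnitDisc.mk ((Real.tanh (p.1 / 2) : ℂ) * Complex.exp (p.2 * Complex.I))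
    (norm_tanh_mul_exp_lt_one p.1 p.2)

/-- The polar coordinate map is measurable, so that push-forwards along it are genuine. -/
theorem measurable_ofPolar : Measurable ofPolar := by
  refine Continuous.measurable ?_
  rw [Complex.UnitDisc.isEmbedding_coe.continuous_iff]
  change Continuous fun p : ℝ × ℝ =>
    ((Real.tanh (p.1 / 2) : ℝ) : ℂ) * Complex.exp (p.2 * Complex.I)
  have h : Continuous Real.tanh := by
    simp_rw [funext Real.tanh_eq_sinh_div_cosh]
    exact Real.continuous_sinh.div Real.continuous_cosh fun x => (Real.cosh_pos x).ne'
  fun_prop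

/-- The hyperbolic law of cosines: the distance above is the usual one in polar coordinates. -/
theorem cosh_hypDist_ofPolar (r θ s φ : ℝ) :
    Real.cosh (hypDist (ofPolar (r, θ)) (ofPolar (s, φ))) =
      Real.cosh r * Real.cosh s - Real.sinh r * Real.sinh s * Real.cos (θ - φ) := by
  have hn : ∀ a b : ℝ, ‖(ofPolar (a, b) : ℂ)‖ ^ 2 = Real.tanh (a / 2) ^ 2 := by
    intro a b
    simp only [ofPolar, Complex.UnitDisc.coe_mk]
    rw [norm_mul, Complex.norm_exp_ofReal_mul_I, mul_one, Complex.norm_real, Real.norm_eq_abs,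
      sq_abs]
  have hd : ‖(ofPolar (r, θ) : ℂ) - (ofPolar (s, φ) : ℂ)‖ ^ 2 =
      Real.tanh (r / 2) ^ 2 + Real.tanh (s / 2) ^ 2
        - 2 * Real.tanh (r / 2) * Real.tanh (s / 2) * Real.cos (θ - φ) := by
    simp only [ofPolar, Complex.UnitDisc.coe_mk]
    rw [← Complex.normSq_eq_norm_sq, Complex.normSq_apply, Real.cos_sub]
    simp only [Complex.sub_re, Complex.sub_im, Complex.re_ofReal_mul, Complex.im_ofReal_mul,
      Complex.exp_ofReal_mul_I_re, Complex.exp_ofReal_mul_I_im]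
    linear_combination Real.tanh (r / 2) ^ 2 * Real.sin_sq_add_cos_sq θ
      + Real.tanh (s / 2) ^ 2 * Real.sin_sq_add_cos_sq φ
  have ht : ∀ a : ℝ, 0 < 1 - Real.tanh (a / 2) ^ 2 := fun a => by
    have := Real.tanh_sq_lt_one (a / 2)
    linarith
  rw [hypDist, Real.cosh_two_mul, Real.cosh_sq, Real.sinh_arsinh, div_pow, hd, hn, hn,
    Real.sq_sqrt (mul_pos (ht r) (ht s)).le]
  have hr : r = 2 * (r / 2) := by ring
  have hs : s = 2 * (s / 2) := by ring
  conv_rhs => rw [hr, hs]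
  simp only [Real.cosh_two_mul, Real.sinh_two_mul]
  rw [Real.tanh_eq_sinh_div_cosh (r / 2), Real.tanh_eq_sinh_div_cosh (s / 2)]
  have c1 := Real.cosh_pos (r / 2)
  have c2 := Real.cosh_pos (s / 2)
  have q1 := Real.cosh_sq (r / 2)
  have q2 := Real.cosh_sq (s / 2)
  have f1 : 1 - (Real.sinh (r / 2) / Real.cosh (r / 2)) ^ 2 = 1 / Real.cosh (r / 2) ^ 2 := by
    field_simp
    linarith
  have f2 : 1 - (Real.sinh (s / 2) / Real.cosh (s / 2)) ^ 2 = 1 / Real.cosh (s / 2) ^ 2 := by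
    field_simp
    linarith
  rw [f1, f2]
  field_simp
  rw [q1, q2]
  ring

/-- The radius `R_n = 2 log (n / ν)` of the disc containing the nodes. -/
def discRadius (ν : ℝ) (n : ℕ) : ℝ := 2 * Real.log (n / ν)

/-- The density `ρ_n(r) = α sinh (α r) / (cosh (α R_n) - 1) 1_{0 ≤ r < R_n}` of the radius of a
node. It has total mass one as soon as `R_n > 0`, i.e. `n > ν`. -/
def radialDensity (α ν : ℝ) (n : ℕ) (r : ℝ) : ℝ :=
  (Set.Ico 0 (discRadius ν n)).indicator
    (fun r => α * Real.sinh (α * r) / (Real.cosh (α * discRadius ν n) - 1)) r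

/-- The law of the radius of a node. -/
def radialLaw (α ν : ℝ) (n : ℕ) : Measure ℝ :=
  volume.withDensity fun r => ENNReal.ofReal (radialDensity α ν n r)

/-- The uniform law on `(-π, π]`, the law of the angle of a node. -/
def angularLaw : Measure ℝ :=
  (ENNReal.ofReal (2 * Real.pi))⁻¹ • volume.restrict (Set.Ioc (-Real.pi) Real.pi)

/-- The law `μ_n` of a node: the radius and the angle are independent with the laws above. -/
def nodeLaw (α ν : ℝ) (n : ℕ) : Measure Complex.UnitDisc :=
  ((radialLaw α ν n).prod angularLaw).map ofPolar

/-- The law of the `n` independent nodes `X_1, …, X_n`, each of law `μ_n`. -/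
def nodesLaw (α ν : ℝ) (n : ℕ) : Measure (Fin n → Complex.UnitDisc) :=
  Measure.pi fun _ => nodeLaw α ν n

/-- The random hyperbolic graph on the nodes `x`: two distinct nodes are joined by an edge if and
only if their hyperbolic distance is at most `R_n`. -/
def graph (ν : ℝ) {n : ℕ} (x : Fin n → Complex.UnitDisc) : SimpleGraph (Fin n) where
  Adj i j := i ≠ j ∧ hypDist (x i) (x j) ≤ discRadius ν n
  symm := ⟨by
    intro i j h
    refine ⟨h.1.symm, ?_⟩
    have h2 := h.2
    rwa [hypDist, norm_sub_rev, mul_comm (1 - _) (1 - _)] at h2⟩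
  loopless := ⟨fun _ h => h.1 rfl⟩

open Classical in
/-- The degree of the node `x i`: the number of its neighbours in the graph. -/
def deg (ν : ℝ) {n : ℕ} (x : Fin n → Complex.UnitDisc) (i : Fin n) : ℕ :=
  (graph ν x).degree i

/-- `σ` lists the nodes by increasing radius: with `X_(k) = x (σ (k - 1))` for `k = 1, …, n`
(the elements of `Fin n` start at `0`), `r(X_(1)) ≤ r(X_(2)) ≤ … ≤ r(X_(n))`. -/
def IsRadialOrder {n : ℕ} (x : Fin n → Complex.UnitDisc) (σ : Equiv.Perm (Fin n)) : Prop :=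
  Monotone fun i => radius (x (σ i))

/-- The exponent `β = 1 / (1 + 8 α)`. -/
def beta (α : ℝ) : ℝ := 1 / (1 + 8 * α)

/-- The rank `k_n = n ^ β (log n) ^ (-2 α)` (a real number). -/
def rankBound (α : ℝ) (n : ℕ) : ℝ := (n : ℝ) ^ beta α * Real.log n ^ (-2 * α)

/-- `deg X_(1) > deg X_(2) > … > deg X_(k) > deg X_(i)` for all `i > k`, where `X_(1), …, X_(n)`
is the ordering `σ` of the nodes and `k` is the integer part of the given real number: a node
whose rank is at most `k` has a larger degree than every node of larger rank. The node with index
`i : Fin n` in the ordering has rank `i + 1`. -/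
def DegreesOrderedUpTo (ν : ℝ) {n : ℕ} (x : Fin n → Complex.UnitDisc) (σ : Equiv.Perm (Fin n))
    (k : ℝ) : Prop :=
  ∀ i j : Fin n, ((i : ℕ) + 1 : ℝ) ≤ k → i < j → deg ν x (σ j) < deg ν x (σ i)

/-- There is a rank `i ∈ [a, b]`, with `i + 1 ≤ n`, such that `deg X_(i) < deg X_(i+1)`, where
`X_(1), …, X_(n)` is the ordering `σ` of the nodes. -/
def HasInversionIn (ν : ℝ) {n : ℕ} (x : Fin n → Complex.UnitDisc) (σ : Equiv.Perm (Fin n))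
    (a b : ℝ) : Prop :=
  ∃ i j : Fin n, (j : ℕ) = i + 1 ∧ ((i : ℕ) + 1 : ℝ) ∈ Set.Icc a b ∧
    deg ν x (σ i) < deg ν x (σ j)

end RHG

end

/-!
Write `N = n ^ β`, so that `n = N ^ (1 + 8 α)`. The number of nodes of radius less than `s` is
about `n exp (-α (R - s))`, so the node of rank `N a` has a radius `s` with
`exp (-α (R - s)) ≈ N a / n`, and its degree has a mean of order `n exp (-s / 2) = ν N ^ 4 a ^ (-1 / (2 α))`
(`exp_radiusOfRank_div_two`). Around rank `N` the degrees hence fluctuate by about `N ^ 2`, and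
the mean degrees of nodes whose radii differ by `η` differ by about `η N ^ 4`. Since the closest
radii among `N` nodes differ by about `N ^ (-2)`, rank `N` is exactly where the fluctuations start
to invert the order of the degrees. The logarithm in `k_n` and the factor `v_n` leave some room on
both sides.

The radii are drawn first. They are `GoodRadii` with high probability
(`measureReal_not_goodRadii_le`); given good radii, only the independent uniform angles are
random. Two points of radii `r` and `s` are adjacent if and only if the cosine of the difference
of their angles is at least `cosArc R r s`, which has probability `arc R r s`. This probability
decreases in `r`, at a rate bounded from below by `sub_arc_ge` when `s` is close to the boundary.

*No inversion at small ranks.* The radii of the nodes up to rank `N / log n` differ from all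
larger radii by at least some `η` much larger than `log n / N ^ 2`. The resulting differences of
mean degrees exceed the fluctuations by so much that a Chernoff bound (`measureReal_polarDeg_le`)
and a union bound over all pairs of nodes suffice.

*An inversion in the window.* By the birthday problem (`measureReal_no_coincidence_le`) the nodes
of rank slightly above `N` contain `K` disjoint pairs with radii so close that the mean degrees
within a pair differ by much less than the fluctuations (`measureReal_wide_pair_le`). The degrees
within a pair do differ by much more than that, by a Fourier estimate (`measureReal_abs_sum_le`),
so exchanging the angles of the two nodes exchanges the order of their degrees. As this exchange
preserves the law of the angles, all `K` pairs are in order with probability at most about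
`2 ^ (-K)` (`RHG.measureReal_no_inversion_le`). An inversion between two nodes of the window forces one
between nodes of consecutive ranks (`exists_consecutive_inversion`). Finally `n → ∞`, and then
`K → ∞`.
-/

namespace RHG

open MeasureTheory

/-! ### Events on product spaces -/

/-- Fubini's theorem for the probability of an event. -/
theorem measureReal_prod_eq_integral {X Y : Type*} [MeasurableSpace X] [MeasurableSpace Y]
    (μ : Measure X) (κ : Measure Y) [IsProbabilityMeasure μ] [IsProbabilityMeasure κ]
    {E : Set (X × Y)} (hE : MeasurableSet E) :
    (μ.prod κ).real E = ∫ x, κ.real (Prod.mk x ⁻¹' E) ∂μ := by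
  simp only [measureReal_def]
  rw [integral_toReal (measurable_measure_prodMk_left hE).aemeasurable
    (ae_of_all _ fun _ => measure_lt_top _ _), Measure.prod_apply hE]

section Product

variable {ι Ω : Type*} [MeasurableSpace Ω]

theorem measurable_piecewise (T : Finset ι) [∀ i, Decidable (i ∈ T)] :
    Measurable fun p : (ι → Ω) × (ι → Ω) => T.piecewise p.1 p.2 := by
  refine measurable_pi_lambda _ fun i => ?_
  by_cases hi : i ∈ T
  · simp only [Finset.piecewise, hi, if_true]
    fun_prop
  · simp only [Finset.piecewise, hi, if_false]
    fun_prop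

variable [Fintype ι]

/-- Redrawing the coordinates outside `T` independently does not change a product law. -/
theorem measurePreserving_piecewise (μ : Measure Ω) [IsProbabilityMeasure μ] (T : Finset ι)
    [∀ i, Decidable (i ∈ T)] :
    MeasurePreserving (fun p : (ι → Ω) × (ι → Ω) => T.piecewise p.1 p.2)
      ((Measure.pi fun _ => μ).prod (Measure.pi fun _ => μ)) (Measure.pi fun _ => μ) := by
  refine ⟨measurable_piecewise T, (Measure.pi_eq fun s hs => ?_).symm⟩
  rw [Measure.map_apply (measurable_piecewise T) (MeasurableSet.univ_pi hs)]
  have : (fun p : (ι → Ω) × (ι → Ω) => T.piecewise p.1 p.2) ⁻¹' Set.univ.pi s =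
      (Set.univ.pi fun i => if i ∈ T then s i else Set.univ) ×ˢ
        (Set.univ.pi fun i => if i ∈ T then Set.univ else s i) := by
    ext p
    simp only [Set.mem_preimage, Set.mem_pi, Set.mem_univ, forall_const, Set.mem_prod,
      Finset.piecewise]
    constructor
    · intro h
      refine ⟨fun i => ?_, fun i => ?_⟩ <;> have := h i <;> split_ifs at this ⊢ <;> simp_all
    · rintro ⟨h1, h2⟩ i
      have h1 := h1 i
      have h2 := h2 i
      split_ifs at h1 h2 ⊢ <;> assumption
  rw [this, Measure.prod_prod, Measure.pi_pi, Measure.pi_pi, ← Finset.prod_mul_distrib]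
  refine Finset.prod_congr rfl fun i _ => ?_
  split_ifs <;> simp

/-- The probability of an event is the mean of its conditional probability given the coordinates
in `T`. -/
theorem measureReal_eq_integral_piecewise (μ : Measure Ω) [IsProbabilityMeasure μ] (T : Finset ι)
    [∀ i, Decidable (i ∈ T)] {E : Set (ι → Ω)} (hE : MeasurableSet E) :
    (Measure.pi fun _ => μ).real E =
      ∫ x, (Measure.pi fun _ => μ).real {ω | T.piecewise x ω ∈ E} ∂(Measure.pi fun _ => μ) := by
  have h := (measurePreserving_piecewise (ι := ι) μ T).measureReal_preimage hE.nullMeasurableSet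
  rw [← h, measureReal_prod_eq_integral _ _ (measurable_piecewise T hE)]
  rfl

/-- A bound for the conditional probability given the coordinates in `T`, uniform in these
coordinates, bounds the probability. This is how some nodes are frozen below. -/
theorem measureReal_le_of_piecewise (μ : Measure Ω) [IsProbabilityMeasure μ] (T : Finset ι)
    [∀ i, Decidable (i ∈ T)] {E : Set (ι → Ω)} (hE : MeasurableSet E) {c : ℝ}
    (h : ∀ x, (Measure.pi fun _ => μ).real {ω | T.piecewise x ω ∈ E} ≤ c) :
    (Measure.pi fun _ => μ).real E ≤ c := by
  rw [measureReal_eq_integral_piecewise μ T hE]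
  have hc : 0 ≤ c := by
    obtain ⟨x⟩ : Nonempty (ι → Ω) := (Measure.pi fun _ : ι => μ).nonempty_of_neZero
    exact measureReal_nonneg.trans (h x)
  calc _ ≤ ∫ _, c ∂(Measure.pi fun _ : ι => μ) := by
        refine integral_mono_of_nonneg (ae_of_all _ fun _ => measureReal_nonneg)
          (integrable_const _) (ae_of_all _ h)
    _ = c := by simp

theorem measureReal_eq_of_piecewise (μ : Measure Ω) [IsProbabilityMeasure μ] (T : Finset ι)
    [∀ i, Decidable (i ∈ T)] {E : Set (ι → Ω)} (hE : MeasurableSet E) {c : ℝ}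
    (h : ∀ x, (Measure.pi fun _ => μ).real {ω | T.piecewise x ω ∈ E} = c) :
    (Measure.pi fun _ => μ).real E = c := by
  rw [measureReal_eq_integral_piecewise μ T hE]
  simp [h]

theorem measureReal_pi_eval (μ : Measure Ω) [IsProbabilityMeasure μ] (i : ι) {B : Set Ω}
    (hB : MeasurableSet B) :
    (Measure.pi fun _ : ι => μ).real {ω | ω i ∈ B} = μ.real B :=
  (measurePreserving_eval (fun _ : ι => μ) i).measureReal_preimage hB.nullMeasurableSet

/-- Independence of two coordinates, with the first one frozen. -/
theorem measureReal_pi_pair_le (μ : Measure Ω) [IsProbabilityMeasure μ] {i j : ι} (hij : i ≠ j)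
    {B : Set Ω} (hB : MeasurableSet B) {E : Set (Ω × Ω)} (hE : MeasurableSet E) {c : ℝ}
    (h : ∀ x ∈ B, μ.real {y | (x, y) ∈ E} ≤ c) :
    (Measure.pi fun _ : ι => μ).real {ω | ω i ∈ B ∧ (ω i, ω j) ∈ E} ≤ μ.real B * c := by
  classical
  have hm : MeasurableSet {ω : ι → Ω | ω i ∈ B ∧ (ω i, ω j) ∈ E} := by
    refine MeasurableSet.inter ?_ ?_
    · exact measurable_pi_apply i hB
    · exact ((measurable_pi_apply i).prodMk (measurable_pi_apply j)) hE
  rw [measureReal_eq_integral_piecewise μ {i} hm]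
  calc _ ≤ ∫ x, {ω : ι → Ω | ω i ∈ B}.indicator (fun _ => c) x
        ∂(Measure.pi fun _ : ι => μ) := by
        refine integral_mono_of_nonneg (ae_of_all _ fun _ => measureReal_nonneg)
          ((integrable_const _).indicator (measurable_pi_apply i hB)) (ae_of_all _ fun x => ?_)
        by_cases hx : x i ∈ B
        · have e1 : {ω : ι → Ω | (({i} : Finset ι).piecewise x ω) ∈
              {ω : ι → Ω | ω i ∈ B ∧ (ω i, ω j) ∈ E}} = {ω | ω j ∈ {y | (x i, y) ∈ E}} := by
            ext ω
            simp [Finset.piecewise, hx, hij.symm]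
          simp only [e1]
          rw [measureReal_pi_eval μ j (B := {y | (x i, y) ∈ E}) (measurable_prodMk_left hE),
            Set.indicator_of_mem (show x ∈ {ω : ι → Ω | ω i ∈ B} from hx)]
          exact h _ hx
        · have e1 : {ω : ι → Ω | (({i} : Finset ι).piecewise x ω) ∈
              {ω : ι → Ω | ω i ∈ B ∧ (ω i, ω j) ∈ E}} = ∅ := by
            ext ω
            simp [Finset.piecewise, hx]
          simp only [e1]
          rw [Set.indicator_of_notMem (show x ∉ {ω : ι → Ω | ω i ∈ B} from hx)]
          simp
    _ = μ.real B * c := by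
        rw [integral_indicator_const c (s := {ω : ι → Ω | ω i ∈ B}) (measurable_pi_apply i hB),
          smul_eq_mul]
        congr 1
        exact measureReal_pi_eval μ i hB

/-- Markov's inequality for a product of independent nonnegative variables. -/
theorem measureReal_le_prod_integral (μ : Measure Ω) [IsProbabilityMeasure μ] {f : ι → Ω → ℝ}
    (hf : ∀ i x, 0 ≤ f i x) (hi : ∀ i, Integrable (f i) μ) {c : ℝ} (hc : 0 < c) :
    (Measure.pi fun _ : ι => μ).real {ω | c ≤ ∏ i, f i (ω i)} ≤ (∏ i, ∫ x, f i x ∂μ) / c := by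
  have hint : Integrable (fun ω : ι → Ω => ∏ i, f i (ω i)) (Measure.pi fun _ => μ) :=
    Integrable.fintype_prod hi
  have := mul_meas_ge_le_integral_of_nonneg
    (ae_of_all _ fun ω => Finset.prod_nonneg fun i _ => hf i (ω i)) hint c
  rw [integral_fintype_prod_eq_prod] at this
  rw [le_div_iff₀ hc, mul_comm]
  exact this

/-- A lower tail bound of Chernoff type for the number of coordinates that fall in `B`. -/
theorem measureReal_card_le (μ : Measure Ω) [IsProbabilityMeasure μ] (J : Finset ι) {B : Set Ω}
    [∀ x, Decidable (x ∈ B)] (hB : MeasurableSet B) {q : ℝ} (hq : q ≤ μ.real B) :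
    (Measure.pi fun _ : ι => μ).real
      {ω | ((J.filter fun i => ω i ∈ B).card : ℝ) ≤ J.card * q / 4} ≤
        Real.exp (-(J.card * q / 4)) := by
  classical
  set f : ι → Ω → ℝ := fun i x => if i ∈ J ∧ x ∈ B then Real.exp (-1) else 1 with hf
  have hmeas : ∀ i, Measurable (f i) := fun i => by
    refine Measurable.ite ?_ measurable_const measurable_const
    by_cases hi : i ∈ J <;> simp [hi, hB]
  have hint : ∀ i, Integrable (f i) μ := fun i => by
    refine Integrable.of_bound (hmeas i).aestronglyMeasurable 1 (ae_of_all _ fun x => ?_)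
    simp only [hf, Real.norm_eq_abs]
    split_ifs
    · rw [abs_of_pos (Real.exp_pos _)]
      exact Real.exp_le_one_iff.2 (by norm_num)
    · simp
  have hval : ∀ i ∈ J, ∫ x, f i x ∂μ ≤ Real.exp (-(q / 2)) := fun i hi => by
    have e1 : f i = fun x => 1 - B.indicator (fun _ => 1 - Real.exp (-1)) x := by
      funext x
      by_cases hx : x ∈ B <;> simp [hf, hi, hx]
    rw [e1, integral_sub (integrable_const _) ((integrable_const _).indicator hB),
      integral_indicator_const _ hB]
    simp only [integral_const, probReal_univ, smul_eq_mul, mul_one]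
    have h1 : Real.exp (-1) ≤ 1 / 2 := by
      rw [Real.exp_neg, inv_le_comm₀ (Real.exp_pos _) (by norm_num)]
      have := Real.add_one_le_exp (1 : ℝ)
      linarith
    have h2 := Real.add_one_le_exp (-(q / 2))
    nlinarith [measureReal_nonneg (μ := μ) (s := B)]
  have hval' : ∀ i ∉ J, ∫ x, f i x ∂μ = 1 := fun i hi => by simp [hf, hi]
  have hprod : ∏ i, ∫ x, f i x ∂μ ≤ Real.exp (-(J.card * q / 2)) := by
    rw [← Finset.prod_subset (Finset.subset_univ J) fun i _ hi => hval' i hi]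
    calc _ ≤ ∏ _i ∈ J, Real.exp (-(q / 2)) :=
          Finset.prod_le_prod (fun i _ => integral_nonneg fun x => by
            simp only [hf]; split_ifs <;> positivity) hval
      _ = _ := by rw [Finset.prod_const, ← Real.exp_nat_mul]; congr 1; ring
  have hmain := measureReal_le_prod_integral μ (f := f)
    (fun i x => by simp only [hf]; split_ifs <;> positivity) hint
    (Real.exp_pos (-(J.card * q / 4)))
  calc _ ≤ _ := measureReal_mono ?_ (measure_ne_top _ _)
    _ ≤ _ := hmain
    _ ≤ Real.exp (-(J.card * q / 2)) / Real.exp (-(J.card * q / 4)) := by gcongr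
    _ = _ := by rw [← Real.exp_sub]; congr 1; ring
  intro ω hω
  simp only [Set.mem_ofPred_eq] at hω ⊢
  have e2 : ∏ i, f i (ω i) = Real.exp (-((J.filter fun i => ω i ∈ B).card : ℝ)) := by
    rw [Finset.prod_ite, Finset.prod_const_one, mul_one, Finset.prod_const, ← Real.exp_nat_mul]
    congr 1
    rw [mul_neg_one]
    congr 2
    congr 1
    ext i
    simp
  rw [e2]
  exact Real.exp_le_exp.2 (neg_le_neg hω)

/-- Exchanging two coordinates preserves a product law. -/
theorem measurePreserving_comp_swap [DecidableEq ι] (μ : Measure Ω) [IsProbabilityMeasure μ]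
    (i j : ι) :
    MeasurePreserving (fun ω : ι → Ω => ω ∘ Equiv.swap i j)
      (Measure.pi fun _ => μ) (Measure.pi fun _ => μ) := by
  have hm : Measurable fun ω : ι → Ω => ω ∘ Equiv.swap i j :=
    measurable_pi_lambda _ fun k => measurable_pi_apply _
  refine ⟨hm, (Measure.pi_eq fun s hs => ?_).symm⟩
  rw [Measure.map_apply hm (MeasurableSet.univ_pi hs)]
  have : (fun ω : ι → Ω => ω ∘ Equiv.swap i j) ⁻¹' Set.univ.pi s =
      Set.univ.pi (s ∘ Equiv.swap i j) := by
    ext ω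
    simp only [Set.mem_preimage, Set.mem_pi, Set.mem_univ, forall_const, Function.comp]
    constructor
    · intro h k
      simpa using h (Equiv.swap i j k)
    · intro h k
      simpa using h (Equiv.swap i j k)
  rw [this, Measure.pi_pi]
  exact Equiv.prod_comp (Equiv.swap i j) fun k => μ (s k)

end Product

/-- If for each `l < K` a measure-preserving map leaves the events `B m`, `m < l`, alone and takes
`B l` to an event disjoint from it, then all `B l` occur together with probability at most
`2 ^ (-K)`. -/
theorem measureReal_iInter_le_half_pow {Ω : Type*} [MeasurableSpace Ω] (P : Measure Ω)
    [IsProbabilityMeasure P] (B : ℕ → Set Ω) (T : ℕ → Ω → Ω) (K : ℕ)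
    (hT : ∀ l < K, MeasurePreserving (T l) P P) (hB : ∀ l < K, MeasurableSet (B l))
    (hne : ∀ l < K, ∀ m < l, T l ⁻¹' B m = B m) (hdisj : ∀ l < K, Disjoint (T l ⁻¹' B l) (B l)) :
    P.real {ω | ∀ l < K, ω ∈ B l} ≤ (1 / 2) ^ K := by
  induction K with
  | zero => simp
  | succ K ih =>
    have ih := ih (fun l hl => hT l (by omega)) (fun l hl => hB l (by omega))
      (fun l hl => hne l (by omega)) (fun l hl => hdisj l (by omega))
    set A := {ω | ∀ l < K, ω ∈ B l} with hA
    have hAm : MeasurableSet A := by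
      have : A = ⋂ l, ⋂ (_ : l < K), B l := by ext; simp [hA]
      rw [this]
      exact MeasurableSet.iInter fun l => MeasurableSet.iInter fun hl => hB l (by omega)
    have e1 : {ω | ∀ l < K + 1, ω ∈ B l} = A ∩ B K := by
      ext ω
      simp only [hA, Set.mem_ofPred_eq, Set.mem_inter_iff]
      constructor
      · exact fun h => ⟨fun l hl => h l (by omega), h K (by omega)⟩
      · rintro ⟨h1, h2⟩ l hl
        rcases Nat.lt_succ_iff_lt_or_eq.1 hl with h | rfl
        · exact h1 l h
        · exact h2
    have hTA : T K ⁻¹' A = A := by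
      ext ω
      simp only [hA, Set.mem_preimage, Set.mem_ofPred_eq]
      refine forall₂_congr fun l hl => ?_
      exact Set.ext_iff.1 (hne K (by omega) l hl) ω
    have hBm := hB K (by omega)
    have hpre := (hT K (by omega)).measureReal_preimage (hAm.inter hBm).nullMeasurableSet
    -- The disjoint events `A ∩ B K` and `T K ⁻¹' (A ∩ B K)` have equal probabilities and both lie
    -- in `A`.
    have hsum : P.real (T K ⁻¹' (A ∩ B K)) + P.real (A ∩ B K) ≤ P.real A := by
      rw [← measureReal_union]
      · refine measureReal_mono (Set.union_subset ?_ Set.inter_subset_left) (measure_ne_top _ _)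
        rw [Set.preimage_inter, hTA]
        exact Set.inter_subset_left
      · rw [Set.preimage_inter]
        exact (hdisj K (by omega)).mono Set.inter_subset_right Set.inter_subset_right
      · exact hAm.inter hBm
    rw [e1, pow_succ]
    linarith

/-! ### Fourier anticoncentration -/

theorem integral_exp_int_mul_I (m : ℤ) :
    ∫ t in (-Real.pi)..Real.pi, Complex.exp ((m : ℂ) * Complex.I * (t : ℂ)) =
      if m = 0 then 2 * (Real.pi : ℂ) else 0 := by
  split_ifs with h
  · subst h
    simp
    ring
  · have hm : (m : ℂ) * Complex.I ≠ 0 := mul_ne_zero (by exact_mod_cast h) Complex.I_ne_zero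
    rw [integral_exp_mul_complex hm]
    have : Complex.exp ((m : ℂ) * Complex.I * ((Real.pi : ℝ) : ℂ)) =
        Complex.exp ((m : ℂ) * Complex.I * ((-Real.pi : ℝ) : ℂ)) := by
      rw [Complex.exp_eq_exp_iff_exists_int]
      exact ⟨m, by push_cast; ring⟩
    rw [this, sub_self, zero_div]

section Anticoncentration

variable {ι Ω : Type*} [Fintype ι] [MeasurableSpace Ω]

/-- Fourier inversion for a sum of independent integer-valued variables. -/
theorem measureReal_sum_eq_le_integral (μ : Measure Ω) [IsProbabilityMeasure μ] {ξ : ι → Ω → ℤ}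
    (hξ : ∀ i, Measurable (ξ i)) (k : ℤ) :
    (Measure.pi fun _ : ι => μ).real {ω | ∑ i, ξ i (ω i) = k} ≤
      1 / (2 * Real.pi) * ∫ t in (-Real.pi)..Real.pi,
        ∏ i, ‖∫ x, Complex.exp ((ξ i x : ℂ) * Complex.I * (t : ℂ)) ∂μ‖ := by
  set P := Measure.pi fun _ : ι => μ with hP
  have hSm : Measurable fun ω : ι → Ω => ∑ i, ξ i (ω i) :=
    Finset.measurable_sum _ fun i _ => (hξ i).comp (measurable_pi_apply i)
  have hEm : MeasurableSet {ω : ι → Ω | ∑ i, ξ i (ω i) = k} := hSm (measurableSet_singleton k)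
  have hcast : Measurable fun m : ℤ => (m : ℂ) := measurable_from_top
  set F : ℝ → (ι → Ω) → ℂ := fun t ω =>
    Complex.exp (((∑ i, ξ i (ω i) - k : ℤ) : ℂ) * Complex.I * (t : ℂ)) with hF
  have hnorm : ∀ (m : ℤ) (t : ℝ), ‖Complex.exp ((m : ℂ) * Complex.I * (t : ℂ))‖ = 1 := by
    intro m t
    have : (m : ℂ) * Complex.I * (t : ℂ) = ((m * t : ℝ) : ℂ) * Complex.I := by push_cast; ring
    rw [this, Complex.norm_exp_ofReal_mul_I]
  have hFm : Measurable (Function.uncurry F) := by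
    refine Complex.measurable_exp.comp (Measurable.mul (Measurable.mul ?_ measurable_const) ?_)
    · exact hcast.comp ((hSm.comp measurable_snd).sub measurable_const)
    · exact Complex.measurable_ofReal.comp measurable_fst
  have hFi : Integrable (Function.uncurry F)
      ((volume.restrict (Set.uIoc (-Real.pi) Real.pi)).prod P) := by
    have : IsFiniteMeasure (volume.restrict (Set.uIoc (-Real.pi) Real.pi)) :=
      ⟨by rw [Measure.restrict_apply_univ, Set.uIoc]; exact measure_Ioc_lt_top⟩
    refine Integrable.of_bound hFm.aestronglyMeasurable 1 (ae_of_all _ fun p => ?_)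
    exact (hnorm _ _).le
  have h1 : ∫ ω, (∫ t in (-Real.pi)..Real.pi, F t ω) ∂P =
      2 * Real.pi * (P.real {ω | ∑ i, ξ i (ω i) = k} : ℂ) := by
    have e : (fun ω => ∫ t in (-Real.pi)..Real.pi, F t ω) =
        {ω : ι → Ω | ∑ i, ξ i (ω i) = k}.indicator fun _ => 2 * (Real.pi : ℂ) := by
      funext ω
      simp only [hF]
      rw [integral_exp_int_mul_I]
      by_cases h : ∑ i, ξ i (ω i) = k
      · simp [h]
      · simp [h, sub_eq_zero]
    rw [e, integral_indicator_const _ hEm, Complex.real_smul, mul_comm]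
  rw [← intervalIntegral_integral_swap hFi] at h1
  have h2 : ∀ t : ℝ, ‖∫ ω, F t ω ∂P‖ =
      ∏ i, ‖∫ x, Complex.exp ((ξ i x : ℂ) * Complex.I * (t : ℂ)) ∂μ‖ := by
    intro t
    have e : F t = fun ω => Complex.exp (((-k : ℤ) : ℂ) * Complex.I * (t : ℂ)) *
        ∏ i, Complex.exp ((ξ i (ω i) : ℂ) * Complex.I * (t : ℂ)) := by
      funext ω
      simp only [hF]
      rw [← Complex.exp_sum, ← Complex.exp_add]
      congr 1
      push_cast
      rw [← Finset.sum_mul, ← Finset.sum_mul]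
      ring
    rw [e, integral_const_mul, norm_mul, hnorm, one_mul, hP,
      integral_fintype_prod_eq_prod (𝕜 := ℂ)
        (fun i x => Complex.exp ((ξ i x : ℂ) * Complex.I * (t : ℂ))), norm_prod]
  have h3 := intervalIntegral.norm_integral_le_integral_norm (μ := volume)
    (f := fun t => ∫ ω, F t ω ∂P) (show -Real.pi ≤ Real.pi by linarith [Real.pi_pos])
  simp only [h2] at h3
  rw [h1, norm_mul, Complex.norm_real, Real.norm_of_nonneg measureReal_nonneg] at h3
  have h4 : ‖2 * (Real.pi : ℂ)‖ = 2 * Real.pi := by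
    rw [norm_mul, Complex.norm_real, Real.norm_of_nonneg Real.pi_pos.le]
    simp
  rw [h4] at h3
  rw [one_div, ← div_eq_inv_mul, le_div_iff₀ (by positivity), mul_comm]
  exact h3

/-- The characteristic function of a symmetric variable with values `-1`, `0`, `1`. -/
theorem integral_exp_symmetric (μ : Measure Ω) [IsProbabilityMeasure μ] {ξ : Ω → ℤ}
    (hξ : Measurable ξ) {p : ℝ} (h3 : ∀ x, ξ x = -1 ∨ ξ x = 0 ∨ ξ x = 1)
    (hp : μ.real {x | ξ x = 1} = p) (hn : μ.real {x | ξ x = -1} = p) (t : ℝ) :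
    ∫ x, Complex.exp ((ξ x : ℂ) * Complex.I * (t : ℂ)) ∂μ =
      ((1 - 2 * p * (1 - Real.cos t) : ℝ) : ℂ) := by
  have m1 : MeasurableSet {x | ξ x = 1} := hξ (measurableSet_singleton 1)
  have m2 : MeasurableSet {x | ξ x = -1} := hξ (measurableSet_singleton (-1))
  have e : (fun x => Complex.exp ((ξ x : ℂ) * Complex.I * (t : ℂ))) = fun x =>
      1 + (({x | ξ x = 1}.indicator (fun _ => Complex.exp (Complex.I * (t : ℂ)) - 1) x) +
        ({x | ξ x = -1}.indicator (fun _ => Complex.exp (-(Complex.I * (t : ℂ))) - 1) x)) := by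
    funext x
    rcases h3 x with h | h | h <;> simp [h]
  rw [e, integral_add (integrable_const _), integral_add, integral_indicator_const _ m1,
    integral_indicator_const _ m2, hp, hn]
  · simp only [integral_const, probReal_univ, one_smul, Complex.real_smul]
    have c : (Real.cos t : ℂ) =
        (Complex.exp (Complex.I * t) + Complex.exp (-(Complex.I * t))) / 2 := by
      rw [Complex.ofReal_cos, Complex.cos]
      ring_nf
    push_cast at c ⊢
    rw [c]
    ring
  · exact (integrable_const _).indicator m1
  · exact (integrable_const _).indicator m2
  · exact ((integrable_const _).indicator m1).add ((integrable_const _).indicator m2)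

/-- A sum of independent integer-valued variables hits a given value with probability at most
`V ^ (-1/2)`, where `V` bounds from below half the variance of those summands that are symmetric
with values `-1`, `0`, `1`. -/
theorem measureReal_sum_eq_le (μ : Measure Ω) [IsProbabilityMeasure μ] {ξ : ι → Ω → ℤ}
    (hξ : ∀ i, Measurable (ξ i)) (J : Finset ι) {p : ι → ℝ}
    (h3 : ∀ i ∈ J, ∀ x, ξ i x = -1 ∨ ξ i x = 0 ∨ ξ i x = 1)
    (hp : ∀ i ∈ J, μ.real {x | ξ i x = 1} = p i) (hn : ∀ i ∈ J, μ.real {x | ξ i x = -1} = p i)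
    (hp4 : ∀ i ∈ J, p i ≤ 1 / 4) {V : ℝ} (hV : 0 < V) (hVp : V ≤ ∑ i ∈ J, p i) (k : ℤ) :
    (Measure.pi fun _ : ι => μ).real {ω | ∑ i, ξ i (ω i) = k} ≤ 1 / √V := by
  have hp0 : ∀ i ∈ J, 0 ≤ p i := fun i hi => by rw [← hp i hi]; exact measureReal_nonneg
  have hpi := Real.pi_pos
  set b : ℝ := 4 * V / Real.pi ^ 2 with hb
  have hb0 : 0 < b := by positivity
  -- The summands outside `J` contribute factors of modulus at most one; the others are dominated
  -- by a Gaussian, since `1 - cos t ≥ 2 t ^ 2 / π ^ 2` on `[-π, π]`.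
  have hbound : ∀ t ∈ Set.Icc (-Real.pi) Real.pi,
      ∏ i, ‖∫ x, Complex.exp ((ξ i x : ℂ) * Complex.I * (t : ℂ)) ∂μ‖ ≤
        Real.exp (-b * t ^ 2) := by
    intro t ht
    have hc : 2 / Real.pi ^ 2 * t ^ 2 ≤ 1 - Real.cos t := by
      have := Real.cos_le_one_sub_mul_cos_sq (abs_le.2 ht)
      linarith
    have hone : ∀ i, ‖∫ x, Complex.exp ((ξ i x : ℂ) * Complex.I * (t : ℂ)) ∂μ‖ ≤ 1 := by
      intro i
      refine (norm_integral_le_of_norm_le_const (C := 1) (ae_of_all _ fun x => ?_)).trans (by simp)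
      have : (ξ i x : ℂ) * Complex.I * (t : ℂ) = ((ξ i x * t : ℝ) : ℂ) * Complex.I := by
        push_cast; ring
      rw [this, Complex.norm_exp_ofReal_mul_I]
    calc _ ≤ ∏ i ∈ J, ‖∫ x, Complex.exp ((ξ i x : ℂ) * Complex.I * (t : ℂ)) ∂μ‖ := by
          classical
          rw [← Finset.prod_sdiff (Finset.subset_univ J)]
          exact mul_le_of_le_one_left (Finset.prod_nonneg fun i _ => norm_nonneg _)
            (Finset.prod_le_one (fun i _ => norm_nonneg _) fun i _ => hone i)
      _ ≤ ∏ i ∈ J, Real.exp (-(2 * p i * (1 - Real.cos t))) := by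
          refine Finset.prod_le_prod (fun i _ => norm_nonneg _) fun i hi => ?_
          rw [integral_exp_symmetric μ (hξ i) (h3 i hi) (hp i hi) (hn i hi) t, Complex.norm_real,
            Real.norm_eq_abs, abs_of_nonneg]
          · have := Real.add_one_le_exp (-(2 * p i * (1 - Real.cos t)))
            linarith
          · nlinarith [Real.neg_one_le_cos t, Real.cos_le_one t, hp0 i hi, hp4 i hi]
      _ = Real.exp (-(2 * (∑ i ∈ J, p i) * (1 - Real.cos t))) := by
          rw [← Real.exp_sum, Finset.sum_neg_distrib, ← Finset.sum_mul, ← Finset.mul_sum]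
      _ ≤ _ := by
          refine Real.exp_le_exp.2 ?_
          have h1 : b * t ^ 2 = 2 * V * (2 / Real.pi ^ 2 * t ^ 2) := by rw [hb]; ring
          have h2 : 0 ≤ 2 / Real.pi ^ 2 * t ^ 2 := by positivity
          have h3 : 2 * V * (2 / Real.pi ^ 2 * t ^ 2) ≤
              2 * (∑ i ∈ J, p i) * (1 - Real.cos t) := by
            have := Finset.sum_nonneg hp0
            gcongr
          linarith
  have hgi : Integrable (fun t : ℝ => Real.exp (-b * t ^ 2)) := integrable_exp_neg_mul_sq hb0
  have hle : ∫ t in (-Real.pi)..Real.pi,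
      ∏ i, ‖∫ x, Complex.exp ((ξ i x : ℂ) * Complex.I * (t : ℂ)) ∂μ‖ ≤ √(Real.pi / b) := by
    rw [← integral_gaussian b, intervalIntegral.integral_of_le (by linarith)]
    calc _ ≤ ∫ t in Set.Ioc (-Real.pi) Real.pi, Real.exp (-b * t ^ 2) := by
          refine integral_mono_of_nonneg
            (ae_of_all _ fun t => Finset.prod_nonneg fun i _ => norm_nonneg _) hgi.integrableOn ?_
          filter_upwards [ae_restrict_mem measurableSet_Ioc] with t ht
          exact hbound t ⟨ht.1.le, ht.2⟩
      _ ≤ _ := setIntegral_le_integral hgi (ae_of_all _ fun t => (Real.exp_pos _).le)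
  refine (measureReal_sum_eq_le_integral μ hξ k).trans ?_
  refine (mul_le_mul_of_nonneg_left hle (by positivity)).trans ?_
  have e1 : Real.pi / b = Real.pi * (Real.pi / 2) ^ 2 / V := by
    rw [hb]; field_simp; ring
  rw [e1, Real.sqrt_div (by positivity), Real.sqrt_mul hpi.le, Real.sqrt_sq (by positivity)]
  have h5 : √Real.pi ≤ 4 := by
    rw [Real.sqrt_le_left (by norm_num)]
    linarith [Real.pi_le_four]
  rw [mul_div_assoc', div_le_div_iff_of_pos_right (Real.sqrt_pos.2 hV)]
  have : 1 / (2 * Real.pi) * (√Real.pi * (Real.pi / 2)) = √Real.pi / 4 := by field_simp; ring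
  rw [this]
  linarith

/-- Anticoncentration: such a sum lies in `[-u, u]` with probability at most
`(2 u + 1) V ^ (-1/2)`. -/
theorem measureReal_abs_sum_le (μ : Measure Ω) [IsProbabilityMeasure μ] {ξ : ι → Ω → ℤ}
    (hξ : ∀ i, Measurable (ξ i)) (J : Finset ι) {p : ι → ℝ}
    (h3 : ∀ i ∈ J, ∀ x, ξ i x = -1 ∨ ξ i x = 0 ∨ ξ i x = 1)
    (hp : ∀ i ∈ J, μ.real {x | ξ i x = 1} = p i) (hn : ∀ i ∈ J, μ.real {x | ξ i x = -1} = p i)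
    (hp4 : ∀ i ∈ J, p i ≤ 1 / 4) {V : ℝ} (hV : 0 < V) (hVp : V ≤ ∑ i ∈ J, p i) (u : ℕ) :
    (Measure.pi fun _ : ι => μ).real {ω | |∑ i, ξ i (ω i)| ≤ (u : ℤ)} ≤ (2 * u + 1) / √V := by
  have e : {ω : ι → Ω | |∑ i, ξ i (ω i)| ≤ (u : ℤ)} =
      ⋃ k ∈ Finset.Icc (-(u : ℤ)) u, {ω | ∑ i, ξ i (ω i) = k} := by
    ext ω
    simp [abs_le]
  rw [e]
  refine (measureReal_biUnion_finset_le _ _).trans ?_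
  refine (Finset.sum_le_card_nsmul _ _ _
    fun k _ => measureReal_sum_eq_le μ hξ J h3 hp hn hp4 hV hVp k).trans ?_
  have hcard : (Finset.Icc (-(u : ℤ)) u).card = 2 * u + 1 := by
    rw [Int.card_Icc]; omega
  rw [hcard, nsmul_eq_mul]
  push_cast
  rw [mul_one_div]

end Anticoncentration

/-! ### Angular distance at which two nodes are adjacent -/

/-- Adjacency in polar coordinates: by the hyperbolic law of cosines, the points `(r, θ)` and
`(s, φ)` are at hyperbolic distance at most `R`. -/
def Near (R r θ s φ : ℝ) : Prop :=
  Real.cosh r * Real.cosh s - Real.sinh r * Real.sinh s * Real.cos (θ - φ) ≤ Real.cosh R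

/-- The cosine of the largest angle at which points of radii `r` and `s` are at distance at most
`R`. It exceeds `1` when no angle qualifies, and is less than `-1` when all angles do. -/
noncomputable def cosArc (R r s : ℝ) : ℝ :=
  (Real.cosh r * Real.cosh s - Real.cosh R) / (Real.sinh r * Real.sinh s)

/-- The probability that points of radii `r` and `s` with uniform angles are at distance at most
`R`. The values `0` and `π` of `Real.arccos` outside `[-1, 1]` are the right ones here. -/
noncomputable def arc (R r s : ℝ) : ℝ := Real.arccos (cosArc R r s) / Real.pi

theorem near_comm {R r θ s φ : ℝ} : Near R r θ s φ ↔ Near R s φ r θ := by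
  unfold Near
  rw [← Real.cos_neg (θ - φ), neg_sub, mul_comm (Real.cosh r), mul_comm (Real.sinh r)]

theorem arc_comm (R r s : ℝ) : arc R r s = arc R s r := by
  unfold arc cosArc
  rw [mul_comm (Real.cosh r), mul_comm (Real.sinh r)]

theorem near_iff {R r θ s φ : ℝ} (hr : 0 < r) (hs : 0 < s) :
    Near R r θ s φ ↔ cosArc R r s ≤ Real.cos (θ - φ) := by
  unfold Near cosArc
  rw [div_le_iff₀ (mul_pos (Real.sinh_pos_iff.2 hr) (Real.sinh_pos_iff.2 hs))]
  constructor <;> intro h <;> linarith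

theorem measurable_near {X : Type*} [MeasurableSpace X] {f₁ f₂ f₃ f₄ : X → ℝ} (R : ℝ)
    (h₁ : Measurable f₁) (h₂ : Measurable f₂) (h₃ : Measurable f₃) (h₄ : Measurable f₄) :
    MeasurableSet {x | Near R (f₁ x) (f₂ x) (f₃ x) (f₄ x)} := by
  refine measurableSet_le ?_ measurable_const
  refine Measurable.sub ?_ ?_
  · exact (Real.measurable_cosh.comp h₁).mul (Real.measurable_cosh.comp h₃)
  · exact ((Real.measurable_sinh.comp h₁).mul (Real.measurable_sinh.comp h₃)).mul
      (Real.measurable_cos.comp (h₂.sub h₄))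

theorem angularLaw_real (A : Set ℝ) :
    angularLaw.real A = (volume.restrict (Set.Ioc (-Real.pi) Real.pi)).real A / (2 * Real.pi) := by
  have h : (0 : ℝ) ≤ 2 * Real.pi := by positivity
  unfold angularLaw
  rw [measureReal_ennreal_smul_apply, ENNReal.toReal_inv, ENNReal.toReal_ofReal h, inv_mul_eq_div]

instance : IsProbabilityMeasure angularLaw := by
  refine ⟨?_⟩
  have h : (0 : ℝ) < 2 * Real.pi := by positivity
  unfold angularLaw
  rw [Measure.smul_apply, Measure.restrict_apply_univ, Real.volume_Ioc, smul_eq_mul]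
  rw [show Real.pi - -Real.pi = 2 * Real.pi by ring]
  exact ENNReal.inv_mul_cancel (by simpa using Real.pi_pos) ENNReal.ofReal_ne_top

theorem volume_real_cos_ge (g : ℝ) :
    (volume.restrict (Set.Ioc (-Real.pi) Real.pi)).real {x | g ≤ Real.cos x} =
      2 * Real.arccos g := by
  set A := Real.arccos g with hA
  have hA0 : 0 ≤ A := Real.arccos_nonneg g
  have hAp : A ≤ Real.pi := Real.arccos_le_pi g
  have hm : MeasurableSet {x : ℝ | g ≤ Real.cos x} :=
    measurableSet_le measurable_const Real.measurable_cos
  rw [measureReal_restrict_apply hm]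
  have hsub : Set.Ioo (-A) A ⊆ {x | g ≤ Real.cos x} ∩ Set.Ioc (-Real.pi) Real.pi := by
    intro x hx
    have hx' : |x| < A := abs_lt.2 hx
    refine ⟨?_, by linarith [hx.1], by linarith [hx.2]⟩
    rcases le_or_gt g (-1) with h | h
    · exact h.trans (Real.neg_one_le_cos x)
    · have h1 : g ≤ 1 := by
        by_contra hg
        rw [hA, Real.arccos_of_one_le (by linarith)] at hx'
        exact absurd hx' (not_lt.2 (abs_nonneg x))
      change g ≤ Real.cos x
      rw [← Real.cos_abs x, ← Real.cos_arccos h.le h1]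
      exact Real.cos_le_cos_of_nonneg_of_le_pi (abs_nonneg x) hAp hx'.le
  have hsup : {x | g ≤ Real.cos x} ∩ Set.Ioc (-Real.pi) Real.pi ⊆ Set.Icc (-A) A := by
    rintro x ⟨hx, hx1, hx2⟩
    rw [Set.mem_Icc, ← abs_le]
    have h2 : |x| ≤ Real.pi := abs_le.2 ⟨hx1.le, hx2⟩
    rw [← Real.arccos_cos (abs_nonneg x) h2, Real.cos_abs]
    exact Real.arccos_le_arccos hx
  refine le_antisymm ?_ ?_
  · refine (measureReal_mono hsup (by simp)).trans ?_
    rw [Real.volume_real_Icc_of_le (by linarith)]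
    linarith
  · refine le_trans ?_ (measureReal_mono hsub (measure_ne_top_of_subset hsup (by simp)))
    rw [Real.volume_real_Ioo_of_le (by linarith)]
    linarith

theorem angularLaw_real_cos_ge (g θ : ℝ) :
    angularLaw.real {φ | g ≤ Real.cos (φ - θ)} = Real.arccos g / Real.pi := by
  have hm : MeasurableSet {x : ℝ | g ≤ Real.cos x} :=
    measurableSet_le measurable_const Real.measurable_cos
  have hm' : MeasurableSet {φ : ℝ | g ≤ Real.cos (φ - θ)} :=
    measurableSet_le measurable_const (Real.measurable_cos.comp (measurable_id.sub_const θ))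
  set f : ℝ → ℝ := {x : ℝ | g ≤ Real.cos x}.indicator fun _ => 1 with hf
  have hper : Function.Periodic f (2 * Real.pi) := by
    intro x
    simp [hf, Set.indicator_apply]
  have h1 : (volume.restrict (Set.Ioc (-Real.pi) Real.pi)).real {φ | g ≤ Real.cos (φ - θ)} =
      ∫ x in (-Real.pi)..Real.pi, f (x - θ) := by
    rw [intervalIntegral.integral_of_le (by linarith [Real.pi_pos]),
      ← integral_indicator_one hm']
    rfl
  have h2 : ∫ x in (-Real.pi)..Real.pi, f x =
      (volume.restrict (Set.Ioc (-Real.pi) Real.pi)).real {x | g ≤ Real.cos x} := by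
    rw [intervalIntegral.integral_of_le (by linarith [Real.pi_pos]),
      ← integral_indicator_one hm]
    rfl
  rw [angularLaw_real, h1, intervalIntegral.integral_comp_sub_right,
    show Real.pi - θ = -Real.pi - θ + 2 * Real.pi by ring,
    hper.intervalIntegral_add_eq (-Real.pi - θ) (-Real.pi),
    show -Real.pi + 2 * Real.pi = Real.pi by ring, h2, volume_real_cos_ge]
  have := Real.pi_pos
  field_simp

theorem angularLaw_real_near {R r s : ℝ} (θ : ℝ) (hr : 0 < r) (hs : 0 < s) :
    angularLaw.real {φ | Near R r θ s φ} = arc R r s := by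
  simp only [near_comm (R := R) (r := r), near_iff hs hr]
  rw [angularLaw_real_cos_ge, arc_comm]
  rfl

theorem arc_nonneg (R r s : ℝ) : 0 ≤ arc R r s :=
  div_nonneg (Real.arccos_nonneg _) Real.pi_pos.le

theorem arc_le_one (R r s : ℝ) : arc R r s ≤ 1 :=
  (div_le_one Real.pi_pos).2 (Real.arccos_le_pi _)

theorem measurable_arc (R r : ℝ) : Measurable (arc R r) := by
  unfold arc cosArc
  refine (Real.measurable_arccos.comp (Measurable.div ?_ ?_)).div_const _
  · exact (Real.measurable_cosh.const_mul _).sub_const _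
  · exact Real.measurable_sinh.const_mul _

theorem sinh_le_exp_half (x : ℝ) : Real.sinh x ≤ Real.exp x / 2 := by
  rw [Real.sinh_eq]
  linarith [Real.exp_pos (-x)]

theorem exp_half_le_cosh (x : ℝ) : Real.exp x / 2 ≤ Real.cosh x := by
  rw [Real.cosh_eq]
  linarith [Real.exp_pos (-x)]

theorem cosh_le_exp {x : ℝ} (hx : 0 ≤ x) : Real.cosh x ≤ Real.exp x := by
  rw [Real.cosh_eq]
  have : Real.exp (-x) ≤ Real.exp x := Real.exp_le_exp.2 (by linarith)
  linarith

theorem exp_one_ge : (8 : ℝ) / 3 ≤ Real.exp 1 := by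
  have := Real.exp_one_gt_d9
  linarith

theorem exp_quarter_le_sinh {x : ℝ} (hx : 1 ≤ x) : Real.exp x / 4 ≤ Real.sinh x := by
  rw [Real.sinh_eq]
  have h1 : Real.exp (-x) ≤ Real.exp (x - 2) := Real.exp_le_exp.2 (by linarith)
  have h2 : Real.exp x = Real.exp (x - 2) * (Real.exp 1 * Real.exp 1) := by
    rw [← Real.exp_add, ← Real.exp_add]; congr 1; ring
  have h3 : 4 ≤ Real.exp 1 * Real.exp 1 := by nlinarith [exp_one_ge]
  nlinarith [Real.exp_pos (x - 2)]

theorem exp_eighth_le_cosh_sub_one {x : ℝ} (hx : 1 ≤ x) :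
    Real.exp x / 8 ≤ Real.cosh x - 1 := by
  have h1 := exp_half_le_cosh x
  have h2 : Real.exp 1 ≤ Real.exp x := Real.exp_le_exp.2 hx
  have := exp_one_ge
  linarith

/-- The identity behind the dependence of the adjacency probability on the radius. -/
theorem cosArc_sub_cosArc {R r r' z : ℝ} (hr : 0 < r) (hr' : 0 < r') (hz : 0 < z) :
    cosArc R r' z - cosArc R r z =
      (Real.cosh R * (Real.sinh r' - Real.sinh r) - Real.cosh z * Real.sinh (r' - r)) /
        (Real.sinh r * Real.sinh r' * Real.sinh z) := by
  have h1 := (Real.sinh_pos_iff.2 hr).ne'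
  have h2 := (Real.sinh_pos_iff.2 hr').ne'
  have h3 := (Real.sinh_pos_iff.2 hz).ne'
  unfold cosArc
  rw [Real.sinh_sub]
  field_simp
  ring

theorem mul_cosh_sub_one_le_sinh {r η : ℝ} (hr : 0 ≤ r) (hη : 0 ≤ η) :
    η * (Real.cosh r - 1) ≤ Real.sinh (r + η) - Real.sinh r - Real.sinh η := by
  rw [Real.sinh_add]
  have h1 : η ≤ Real.sinh η := Real.self_le_sinh_iff.2 hη
  have h2 := Real.one_le_cosh r
  have h3 := Real.one_le_cosh η
  have h4 := Real.sinh_nonneg_iff.2 hr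
  nlinarith

/-- Since `z ≤ R`, the numerator in the identity above is at least
`cosh R * (sinh (r + η) - sinh r - sinh η)`. -/
theorem sub_cosArc_ge {R r η z : ℝ} (hr : 0 < r) (hη : 0 ≤ η) (hz : 0 < z) (hzR : z ≤ R) :
    η * Real.cosh R * (Real.cosh r - 1) / (Real.sinh r * Real.sinh (r + η) * Real.sinh z) ≤
      cosArc R (r + η) z - cosArc R r z := by
  have h1 := Real.sinh_pos_iff.2 hr
  have h2 := Real.sinh_pos_iff.2 (show 0 < r + η by linarith)
  have h3 := Real.sinh_pos_iff.2 hz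
  rw [cosArc_sub_cosArc hr (by linarith) hz]
  refine div_le_div_of_nonneg_right ?_ (by positivity)
  have h4 := mul_cosh_sub_one_le_sinh hr.le hη
  have h5 : Real.cosh z ≤ Real.cosh R :=
    Real.cosh_le_cosh.2 (by rw [abs_of_pos hz, abs_of_pos (hz.trans_le hzR)]; exact hzR)
  have h6 := Real.sinh_nonneg_iff.2 hη
  rw [add_sub_cancel_left]
  nlinarith [Real.cosh_pos R]

theorem cosArc_le_cosArc {R r r' z : ℝ} (hr : 0 < r) (hrr : r ≤ r') (hz : 0 < z) (hzR : z ≤ R) :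
    cosArc R r z ≤ cosArc R r' z := by
  have h := sub_cosArc_ge (R := R) (η := r' - r) hr (by linarith) hz hzR
  rw [add_sub_cancel] at h
  have h1 := Real.sinh_pos_iff.2 hr
  have h2 := Real.sinh_pos_iff.2 (show 0 < r' by linarith)
  have h3 := Real.sinh_pos_iff.2 hz
  have h4 : 0 ≤ Real.cosh r - 1 := by linarith [Real.one_le_cosh r]
  have h5 : 0 ≤ r' - r := by linarith
  have : 0 ≤ (r' - r) * Real.cosh R * (Real.cosh r - 1) /
      (Real.sinh r * Real.sinh r' * Real.sinh z) := by
    have := Real.cosh_pos R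
    positivity
  linarith

theorem arc_anti {R r r' z : ℝ} (hr : 0 < r) (hrr : r ≤ r') (hz : 0 < z) (hzR : z ≤ R) :
    arc R r' z ≤ arc R r z := by
  unfold arc
  exact div_le_div_of_nonneg_right (Real.arccos_le_arccos (cosArc_le_cosArc hr hrr hz hzR))
    Real.pi_pos.le

/-- The neighbourhoods of the points of a ray shrink with the radius. -/
theorem Near.anti {R r r' θ z φ : ℝ} (h : Near R r' θ z φ) (hr : 0 < r) (hrr : r ≤ r')
    (hz : 0 < z) (hzR : z ≤ R) : Near R r θ z φ := by
  rw [near_iff (by linarith) hz] at h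
  rw [near_iff hr hz]
  exact (cosArc_le_cosArc hr hrr hz hzR).trans h

theorem one_sub_cosArc_le {R r z : ℝ} (hr : 1 ≤ r) (hz : 1 ≤ z) (hR : 0 ≤ R) :
    1 - cosArc R r z ≤ 16 * Real.exp (R - r - z) := by
  have h1 := exp_quarter_le_sinh hr
  have h2 := exp_quarter_le_sinh hz
  have h1' : 0 < Real.sinh r := Real.sinh_pos_iff.2 (by linarith)
  have h2' : 0 < Real.sinh z := Real.sinh_pos_iff.2 (by linarith)
  have e : 1 - cosArc R r z =
      (Real.cosh R - Real.cosh (r - z)) / (Real.sinh r * Real.sinh z) := by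
    unfold cosArc
    rw [Real.cosh_sub]
    field_simp
    ring
  rw [e, div_le_iff₀ (by positivity)]
  have h3 := cosh_le_exp hR
  have h4 := Real.cosh_pos (r - z)
  have h5 : Real.exp r / 4 * (Real.exp z / 4) ≤ Real.sinh r * Real.sinh z := by gcongr
  have h6 : Real.exp R = 16 * Real.exp (R - r - z) * (Real.exp r / 4 * (Real.exp z / 4)) := by
    have : Real.exp R = Real.exp (R - r - z) * Real.exp r * Real.exp z := by
      rw [← Real.exp_add, ← Real.exp_add]; congr 1; ring
    rw [this]; ring
  have := mul_le_mul_of_nonneg_left h5 (show 0 ≤ 16 * Real.exp (R - r - z) by positivity)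
  linarith

/-- The quadratic bound `1 - cos x ≥ 2 x ^ 2 / π ^ 2`, also where `Real.arccos` is constant. -/
theorem arccos_sq_le (g : ℝ) : Real.arccos g ^ 2 ≤ Real.pi ^ 2 / 2 * |1 - g| := by
  have hp := Real.pi_pos
  rcases le_or_gt g (-1) with h | h
  · rw [Real.arccos_of_le_neg_one h, abs_of_nonneg (by linarith)]
    nlinarith [sq_nonneg Real.pi]
  rcases le_or_gt 1 g with h1 | h1
  · rw [Real.arccos_of_one_le h1, zero_pow two_ne_zero]
    positivity
  have h2 := Real.cos_le_one_sub_mul_cos_sq (x := Real.arccos g)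
    (by rw [abs_of_nonneg (Real.arccos_nonneg g)]; exact Real.arccos_le_pi g)
  rw [Real.cos_arccos h.le h1.le] at h2
  rw [abs_of_nonneg (by linarith)]
  have h3 : Real.arccos g ^ 2 = Real.pi ^ 2 / 2 * (2 / Real.pi ^ 2 * Real.arccos g ^ 2) := by
    field_simp
  rw [h3]
  have : 0 ≤ Real.pi ^ 2 / 2 := by positivity
  nlinarith

/-- The adjacency probability is of order at most `exp ((R - r - z) / 2)`. -/
theorem arc_le {R r z : ℝ} (hr : 1 ≤ r) (hz : 1 ≤ z) (hR : 0 ≤ R) :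
    arc R r z ≤ 3 * Real.exp ((R - r - z) / 2) := by
  have hp := Real.pi_pos
  have h1 : Real.arccos (cosArc R r z) ^ 2 ≤ Real.pi ^ 2 / 2 * (16 * Real.exp (R - r - z)) := by
    rcases le_or_gt (cosArc R r z) 1 with h | h
    · refine (arccos_sq_le _).trans ?_
      rw [abs_of_nonneg (by linarith)]
      exact mul_le_mul_of_nonneg_left (one_sub_cosArc_le hr hz hR) (by positivity)
    · rw [Real.arccos_of_one_le h.le, zero_pow two_ne_zero]
      positivity
  have h2 : Real.exp (R - r - z) = Real.exp ((R - r - z) / 2) ^ 2 := by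
    rw [← Real.exp_nat_mul]; congr 1; push_cast; ring
  unfold arc
  rw [div_le_iff₀ hp]
  refine (pow_le_pow_iff_left₀ (Real.arccos_nonneg _) (by positivity) two_ne_zero).1
    (h1.trans ?_)
  rw [h2]
  nlinarith [sq_nonneg (Real.exp ((R - r - z) / 2) * Real.pi)]

/-- The upper bound for the adjacency probability, also for points close to the centre. -/
theorem arc_le' {R r z : ℝ} (hr : 1 ≤ r) (hrR : r ≤ R - 1) :
    arc R r z ≤ 3 * Real.exp ((R - r - z) / 2) := by
  rcases le_or_gt 1 z with h | h
  · exact arc_le hr h (by linarith)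
  · refine (arc_le_one _ _ _).trans ?_
    have : 1 ≤ Real.exp ((R - r - z) / 2) := Real.one_le_exp (by linarith)
    linarith

/-- The adjacency probability with a point close to the boundary drops by at least a constant
times `η exp (-r / 2)` when the radius grows from `r` to `r + η`. -/
theorem sub_arc_ge {R r η z : ℝ} (hr6 : 6 ≤ r) (hrR : r ≤ R) (hη : 0 ≤ η) (hη1 : η ≤ 1)
    (hzR : z ≤ R) (hzR1 : R - 1 ≤ z) :
    η * Real.exp (-r / 2) / 480 ≤ arc R r z - arc R (r + η) z := by
  have hp := Real.pi_pos
  have hr : 1 ≤ r := by linarith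
  have hz : 1 ≤ z := by linarith
  set g := cosArc R r z with hg
  set g' := cosArc R (r + η) z with hg'
  set A := Real.arccos g with hA
  set B := Real.arccos g' with hB
  have he1 : Real.exp 1 ≤ 3 := by have := Real.exp_one_lt_d9; linarith
  have he1' := Real.exp_pos 1
  have hw : 1 - g ≤ 48 * Real.exp (-r) := by
    refine (one_sub_cosArc_le hr hz (by linarith)).trans ?_
    have : Real.exp (R - r - z) ≤ Real.exp (1 + -r) := Real.exp_le_exp.2 (by linarith)
    rw [Real.exp_add] at this
    nlinarith [Real.exp_pos (-r)]
  have hdiff : η * Real.exp (-r) / 6 ≤ g' - g := by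
    refine le_trans ?_ (sub_cosArc_ge (by linarith) hη (by linarith) hzR)
    have h1 : 0 < Real.sinh r := Real.sinh_pos_iff.2 (by linarith)
    have h2 : 0 < Real.sinh (r + η) := Real.sinh_pos_iff.2 (by linarith)
    have h3 : 0 < Real.sinh z := Real.sinh_pos_iff.2 (by linarith)
    rw [le_div_iff₀ (by positivity)]
    have a1 := sinh_le_exp_half r
    have a2 : Real.sinh (r + η) ≤ 3 * Real.exp r / 2 := by
      refine (sinh_le_exp_half _).trans ?_
      have : Real.exp (r + η) ≤ Real.exp (r + 1) := Real.exp_le_exp.2 (by linarith)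
      rw [Real.exp_add r 1] at this
      nlinarith [Real.exp_pos r]
    have a3 : Real.sinh z ≤ Real.exp R / 2 := by
      refine (sinh_le_exp_half _).trans ?_
      have : Real.exp z ≤ Real.exp R := Real.exp_le_exp.2 hzR
      linarith
    have a4 := exp_half_le_cosh R
    have a5 := exp_eighth_le_cosh_sub_one hr
    have a6 : Real.exp (-r) * Real.exp r = 1 := by rw [← Real.exp_add]; simp
    calc η * Real.exp (-r) / 6 * (Real.sinh r * Real.sinh (r + η) * Real.sinh z)
        ≤ η * Real.exp (-r) / 6 * (Real.exp r / 2 * (3 * Real.exp r / 2) * (Real.exp R / 2)) := by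
          gcongr
      _ = η * (Real.exp R / 2) * (Real.exp r / 8) * (Real.exp (-r) * Real.exp r) := by ring
      _ = η * (Real.exp R / 2) * (Real.exp r / 8) := by rw [a6, mul_one]
      _ ≤ _ := by
          gcongr
  have hgg : g ≤ g' := by
    have : 0 ≤ η * Real.exp (-r) / 6 := by positivity
    linarith
  -- This is where `6 ≤ r` is needed: it keeps `cosArc R r z` above `-1`.
  have hexp : Real.exp (-r) ≤ 1 / 128 := by
    have h1 : Real.exp (-r) ≤ Real.exp (-6) := Real.exp_le_exp.2 (by linarith)
    have h2 : Real.exp (-6) * (Real.exp 1) ^ 6 = 1 := by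
      rw [← Real.exp_nat_mul, ← Real.exp_add]; norm_num
    have h3 : (8 / 3 : ℝ) ^ 6 ≤ Real.exp 1 ^ 6 := by
      have := exp_one_ge
      gcongr
    nlinarith [Real.exp_pos (-6 : ℝ)]
  have hg1 : -1 ≤ g := by linarith
  have hB0 : 0 ≤ B := Real.arccos_nonneg _
  have hA0 : 0 ≤ A := Real.arccos_nonneg _
  have hAB : B ≤ A := Real.arccos_le_arccos hgg
  have hA2 : A ^ 2 ≤ Real.pi ^ 2 * 24 * Real.exp (-r) := by
    rcases le_or_gt g 1 with h | h
    · have := arccos_sq_le g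
      rw [abs_of_nonneg (by linarith)] at this
      nlinarith [sq_nonneg Real.pi]
    · rw [hA, Real.arccos_of_one_le h.le, zero_pow two_ne_zero]
      positivity
  have hAle : A ≤ Real.pi * 5 * Real.exp (-r / 2) := by
    refine (pow_le_pow_iff_left₀ hA0 (by positivity) two_ne_zero).1 (hA2.trans ?_)
    have : Real.exp (-r) = Real.exp (-r / 2) ^ 2 := by
      rw [← Real.exp_nat_mul]; congr 1; push_cast; ring
    rw [this]
    nlinarith [sq_nonneg (Real.exp (-r / 2) * Real.pi)]
  have hg'1 : g' ≤ 1 := by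
    have e : 1 - g' = (Real.cosh R - Real.cosh (r + η - z)) /
        (Real.sinh (r + η) * Real.sinh z) := by
      have h2 := (Real.sinh_pos_iff.2 (show 0 < r + η by linarith)).ne'
      have h3 := (Real.sinh_pos_iff.2 (show 0 < z by linarith)).ne'
      rw [hg', cosArc, Real.cosh_sub]
      field_simp
      ring
    have h4 : Real.cosh (r + η - z) ≤ Real.cosh R :=
      Real.cosh_le_cosh.2 (by
        rw [abs_of_pos (show 0 < R by linarith), abs_le]
        constructor <;> linarith)
    have h2 := Real.sinh_pos_iff.2 (show 0 < r + η by linarith)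
    have h3 := Real.sinh_pos_iff.2 (show 0 < z by linarith)
    have : 0 ≤ 1 - g' := by
      rw [e]
      exact div_nonneg (by linarith) (by positivity)
    linarith
  -- Near zero the cosine is Lipschitz with a small constant: the two angles are at most `A`, which
  -- is of order `exp (-r / 2)`.
  have hcos : g' - g ≤ A * (A - B) := by
    rw [← Real.cos_arccos hg1 (hgg.trans hg'1), ← Real.cos_arccos (hg1.trans hgg) hg'1,
      Real.cos_sub_cos, ← hA, ← hB]
    have h1 : Real.sin ((A + B) / 2) ≤ A :=
      (Real.sin_le (by linarith)).trans (by linarith)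
    have h2 : Real.sin ((A - B) / 2) ≤ (A - B) / 2 := Real.sin_le (by linarith)
    have h3 : Real.sin ((B - A) / 2) = -Real.sin ((A - B) / 2) := by
      rw [← Real.sin_neg]; congr 1; ring
    have h4 : 0 ≤ Real.sin ((A - B) / 2) := by
      refine Real.sin_nonneg_of_nonneg_of_le_pi (by linarith) ?_
      have := Real.arccos_le_pi g
      linarith
    rw [add_comm B A, h3]
    nlinarith
  have hfin : η * Real.exp (-r / 2) / 480 * Real.pi ≤ A - B := by
    have he : Real.exp (-r) = Real.exp (-r / 2) * Real.exp (-r / 2) := by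
      rw [← Real.exp_add]; congr 1; ring
    have h1 : η * Real.exp (-r) / 6 ≤ Real.pi * 5 * Real.exp (-r / 2) * (A - B) :=
      hdiff.trans (hcos.trans (mul_le_mul_of_nonneg_right hAle (by linarith)))
    have hpos := Real.exp_pos (-r / 2)
    have h2 : η * Real.exp (-r / 2) ≤ 30 * Real.pi * (A - B) := by
      refine le_of_mul_le_mul_left ?_ hpos
      rw [he] at h1
      linarith
    have hp4 := Real.pi_le_four
    have h0 : 0 ≤ η * Real.exp (-r / 2) := by positivity
    have h3 : 30 * Real.pi * (A - B) ≤ 120 * (A - B) := by nlinarith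
    nlinarith
  unfold arc
  rw [← hA, ← hB, ← sub_div, le_div_iff₀ hp]
  exact hfin

/-! ### Degrees in polar coordinates and the Chernoff bound -/

open Classical in
/-- The adjacency indicator in polar coordinates, with integer values. -/
noncomputable def adj (R r θ s φ : ℝ) : ℤ := if Near R r θ s φ then 1 else 0

theorem adj_nonneg (R r θ s φ : ℝ) : 0 ≤ adj R r θ s φ := by
  unfold adj; split_ifs <;> norm_num

theorem adj_le_one (R r θ s φ : ℝ) : adj R r θ s φ ≤ 1 := by
  unfold adj; split_ifs <;> norm_num

theorem adj_comm (R r θ s φ : ℝ) : adj R r θ s φ = adj R s φ r θ := by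
  unfold adj
  rw [near_comm (R := R) (r := r)]

theorem measurable_adj {X : Type*} [MeasurableSpace X] {f₁ f₂ f₃ f₄ : X → ℝ} (R : ℝ)
    (h₁ : Measurable f₁) (h₂ : Measurable f₂) (h₃ : Measurable f₃) (h₄ : Measurable f₄) :
    Measurable fun x => adj R (f₁ x) (f₂ x) (f₃ x) (f₄ x) :=
  Measurable.ite (measurable_near R h₁ h₂ h₃ h₄) measurable_const measurable_const

theorem measurable_intCast_real {X : Type*} [MeasurableSpace X] {f : X → ℤ} (hf : Measurable f) :
    Measurable fun x => (f x : ℝ) :=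
  (measurable_from_top : Measurable fun m : ℤ => (m : ℝ)).comp hf

theorem integral_adj {X : Type*} [MeasurableSpace X] {P : Measure X} {f₁ f₂ f₃ f₄ : X → ℝ} (R : ℝ)
    (h₁ : Measurable f₁) (h₂ : Measurable f₂) (h₃ : Measurable f₃) (h₄ : Measurable f₄) :
    ∫ x, (adj R (f₁ x) (f₂ x) (f₃ x) (f₄ x) : ℝ) ∂P =
      P.real {x | Near R (f₁ x) (f₂ x) (f₃ x) (f₄ x)} := by
  rw [← integral_indicator_one (measurable_near R h₁ h₂ h₃ h₄)]
  congr 1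
  funext x
  by_cases h : Near R (f₁ x) (f₂ x) (f₃ x) (f₄ x) <;> simp [adj, h]

theorem integrable_adj {X : Type*} [MeasurableSpace X] {P : Measure X} [IsFiniteMeasure P]
    {f₁ f₂ f₃ f₄ : X → ℝ} (R : ℝ)
    (h₁ : Measurable f₁) (h₂ : Measurable f₂) (h₃ : Measurable f₃) (h₄ : Measurable f₄) :
    Integrable (fun x => (adj R (f₁ x) (f₂ x) (f₃ x) (f₄ x) : ℝ)) P := by
  refine Integrable.of_bound
    (measurable_intCast_real (measurable_adj R h₁ h₂ h₃ h₄)).aestronglyMeasurable 1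
    (ae_of_all _ fun x => ?_)
  rw [Real.norm_eq_abs, abs_of_nonneg (by exact_mod_cast adj_nonneg _ _ _ _ _)]
  exact_mod_cast adj_le_one _ _ _ _ _

/-- The number of points of the index set `Z` adjacent to the point of radius `ρ` that has the
angle of the node `i`. -/
noncomputable def nearCount {ι : Type*} (R : ℝ) (r : ι → ℝ) (Z : Finset ι) (ρ : ℝ) (i : ι)
    (θ : ι → ℝ) : ℤ :=
  ∑ z ∈ Z, adj R ρ (θ i) (r z) (θ z)

/-- The degree of the node `i` in polar coordinates. -/
noncomputable def polarDeg {ι : Type*} [Fintype ι] [DecidableEq ι] (R : ℝ) (r θ : ι → ℝ) (i : ι) :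
    ℤ :=
  nearCount R r (Finset.univ.erase i) (r i) i θ

theorem measurable_nearCount {ι : Type*} (R : ℝ) (r : ι → ℝ) (Z : Finset ι) (ρ : ℝ) (i : ι) :
    Measurable (nearCount R r Z ρ i) :=
  Finset.measurable_sum _ fun z _ => measurable_adj R measurable_const (measurable_pi_apply i)
    measurable_const (measurable_pi_apply z)

section Angles

variable {ι : Type*} [Fintype ι] [DecidableEq ι]

theorem measureReal_near_pair {R ρ s : ℝ} (hρ : 0 < ρ) (hs : 0 < s) {i j : ι} (hij : i ≠ j) :
    (Measure.pi fun _ : ι => angularLaw).real {θ | Near R ρ (θ i) s (θ j)} = arc R ρ s := by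
  refine measureReal_eq_of_piecewise angularLaw {i} (measurable_near R measurable_const
    (measurable_pi_apply i) measurable_const (measurable_pi_apply j)) fun x => ?_
  have e : {ω : ι → ℝ | ({i} : Finset ι).piecewise x ω ∈ {θ : ι → ℝ | Near R ρ (θ i) s (θ j)}} =
      {ω | ω j ∈ {φ | Near R ρ (x i) s φ}} := by
    ext ω
    simp [Finset.piecewise, hij.symm]
  rw [e, measureReal_pi_eval angularLaw j (B := {φ | Near R ρ (x i) s φ})
    (measurable_near R measurable_const measurable_const measurable_const measurable_id),
    angularLaw_real_near _ hρ hs]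

/-- The exponential of a difference of indicators to second order in `t`. -/
theorem exp_mul_sub_le {t : ℝ} (ht0 : 0 ≤ t) (ht1 : t ≤ 1) {a b : ℤ} (ha : a = 0 ∨ a = 1)
    (hb : b = 0 ∨ b = 1) :
    Real.exp (t * ((b : ℝ) - a)) ≤ 1 + t * ((b : ℝ) - a) + t ^ 2 * ((b : ℝ) + a) := by
  have h1 : Real.exp t ≤ 1 + t + t ^ 2 := by
    have := Real.abs_exp_sub_one_sub_id_le (x := t) (by rw [abs_of_nonneg ht0]; exact ht1)
    have := (abs_le.1 this).2
    linarith
  have h2 : Real.exp (-t) ≤ 1 - t + t ^ 2 := by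
    have := Real.abs_exp_sub_one_sub_id_le (x := -t) (by rw [abs_neg, abs_of_nonneg ht0]; exact ht1)
    have := (abs_le.1 this).2
    nlinarith
  rcases ha with rfl | rfl <;> rcases hb with rfl | rfl <;> simp <;> nlinarith

theorem adj_zero_or_one (R r θ s φ : ℝ) : adj R r θ s φ = 0 ∨ adj R r θ s φ = 1 := by
  have h1 := adj_nonneg R r θ s φ
  have h2 := adj_le_one R r θ s φ
  omega

/-- A Chernoff bound: given the radii, a node of larger radius reaches the degree of a node of
smaller radius with exponentially small probability in terms of the sum of the differences of
their adjacency probabilities. -/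
theorem measureReal_polarDeg_le {R : ℝ} {r : ι → ℝ} (hr : ∀ i, 0 < r i) (hrR : ∀ i, r i ≤ R)
    {a b : ι} (hab : a ≠ b) (hle : r a ≤ r b) {t : ℝ} (ht0 : 0 ≤ t) (ht1 : t ≤ 1) :
    (Measure.pi fun _ : ι => angularLaw).real {θ | polarDeg R r θ a ≤ polarDeg R r θ b} ≤
      Real.exp (∑ z ∈ Finset.univ \ {a, b},
        (-t * (arc R (r a) (r z) - arc R (r b) (r z)) + 2 * t ^ 2 * arc R (r a) (r z))) := by
  set Z : Finset ι := Finset.univ \ {a, b} with hZ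
  have hmem : ∀ z, z ∈ Z ↔ z ≠ a ∧ z ≠ b := fun z => by simp [hZ]
  have hm : MeasurableSet {θ : ι → ℝ | polarDeg R r θ a ≤ polarDeg R r θ b} :=
    measurableSet_le (measurable_nearCount R r _ _ a) (measurable_nearCount R r _ _ b)
  refine measureReal_le_of_piecewise angularLaw {a, b} hm fun x => ?_
  -- Given the angles of `a` and `b`, the contributions `ξ z` of the other nodes to the difference
  -- of the degrees are independent; the adjacency of `a` and `b` cancels.
  set ξ : ι → ℝ → ℝ := fun z φ =>
    (adj R (r b) (x b) (r z) φ : ℝ) - adj R (r a) (x a) (r z) φ with hξ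
  set f : ι → ℝ → ℝ := fun z φ => if z ∈ Z then Real.exp (t * ξ z φ) else 1 with hf
  have hξm : ∀ z, Measurable (ξ z) := fun z =>
    (measurable_intCast_real (measurable_adj R measurable_const measurable_const measurable_const
      measurable_id)).sub (measurable_intCast_real (measurable_adj R measurable_const
        measurable_const measurable_const measurable_id))
  have hbd : ∀ z φ, Real.exp (t * ξ z φ) ≤ 1 + t * ξ z φ + t ^ 2 *
      ((adj R (r b) (x b) (r z) φ : ℝ) + adj R (r a) (x a) (r z) φ) := fun z φ =>
    exp_mul_sub_le ht0 ht1 (adj_zero_or_one _ _ _ _ _) (adj_zero_or_one _ _ _ _ _)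
  have ha1 : ∀ i z, Integrable (fun φ => (adj R (r i) (x i) (r z) φ : ℝ)) angularLaw := fun i z =>
    integrable_adj R measurable_const measurable_const measurable_const measurable_id
  have ha2 : ∀ i z, ∫ φ, (adj R (r i) (x i) (r z) φ : ℝ) ∂angularLaw = arc R (r i) (r z) :=
    fun i z => (integral_adj R measurable_const measurable_const measurable_const
      measurable_id).trans (angularLaw_real_near _ (hr i) (hr z))
  have hξi : ∀ z, Integrable (ξ z) angularLaw := fun z => (ha1 b z).sub (ha1 a z)
  have hri : ∀ z, Integrable (fun φ => 1 + t * ξ z φ + t ^ 2 *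
      ((adj R (r b) (x b) (r z) φ : ℝ) + adj R (r a) (x a) (r z) φ)) angularLaw := fun z =>
    (((integrable_const _).add ((hξi z).const_mul t))).add
      (((ha1 b z).add (ha1 a z)).const_mul (t ^ 2))
  have hei : ∀ z, Integrable (fun φ => Real.exp (t * ξ z φ)) angularLaw := fun z => by
    refine (hri z).mono' ((Real.measurable_exp.comp ((hξm z).const_mul t)).aestronglyMeasurable)
      (ae_of_all _ fun φ => ?_)
    rw [Real.norm_eq_abs, abs_of_pos (Real.exp_pos _)]
    exact hbd z φ
  have hfi : ∀ z, Integrable (f z) angularLaw := fun z => by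
    by_cases hz : z ∈ Z
    · simpa only [hf, hz, if_true] using hei z
    · simp only [hf, hz, if_false]
      exact integrable_const _
  have hval : ∀ z ∈ Z, ∫ φ, f z φ ∂angularLaw ≤
      Real.exp (-t * (arc R (r a) (r z) - arc R (r b) (r z)) + 2 * t ^ 2 * arc R (r a) (r z)) := by
    intro z hz
    simp only [hf, hz, if_true]
    refine (integral_mono (hei z) (hri z) (hbd z)).trans ?_
    have e : ∫ φ, (1 + t * ξ z φ + t ^ 2 *
        ((adj R (r b) (x b) (r z) φ : ℝ) + adj R (r a) (x a) (r z) φ)) ∂angularLaw =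
        1 + t * (arc R (r b) (r z) - arc R (r a) (r z)) +
          t ^ 2 * (arc R (r b) (r z) + arc R (r a) (r z)) := by
      have i1 : Integrable (fun φ => 1 + t * ξ z φ) angularLaw :=
        (integrable_const _).add ((hξi z).const_mul t)
      have i2 : Integrable (fun φ => t ^ 2 *
          ((adj R (r b) (x b) (r z) φ : ℝ) + adj R (r a) (x a) (r z) φ)) angularLaw :=
        ((ha1 b z).add (ha1 a z)).const_mul (t ^ 2)
      have e1 : ∫ φ, ξ z φ ∂angularLaw = arc R (r b) (r z) - arc R (r a) (r z) := by
        simp only [hξ]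
        rw [integral_sub (ha1 b z) (ha1 a z), ha2, ha2]
      rw [integral_add i1 i2, integral_add (integrable_const _) ((hξi z).const_mul t),
        integral_const_mul, integral_const_mul, integral_add (ha1 b z) (ha1 a z), ha2, ha2, e1]
      simp
    rw [e]
    have h1 := arc_anti (hr a) hle (hr z) (hrR z)
    have h2 := Real.add_one_le_exp
      (-t * (arc R (r a) (r z) - arc R (r b) (r z)) + 2 * t ^ 2 * arc R (r a) (r z))
    nlinarith [sq_nonneg t]
  have hmain := measureReal_le_prod_integral angularLaw (f := f)
    (fun i x => by simp only [hf]; split_ifs <;> positivity) hfi one_pos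
  rw [div_one] at hmain
  refine (measureReal_mono ?_ (measure_ne_top _ _)).trans (hmain.trans ?_)
  · intro ω hω
    simp only [Set.mem_ofPred_eq] at hω ⊢
    set θ := ({a, b} : Finset ι).piecewise x ω with hθ
    have hθa : θ a = x a := by simp [hθ]
    have hθb : θ b = x b := by simp [hθ]
    have hθz : ∀ z ∈ Z, θ z = ω z := fun z hz => by
      have := (hmem z).1 hz
      simp [hθ, this]
    have e1 : Finset.univ.erase a = insert b Z := by
      ext z
      simp only [Finset.mem_erase, Finset.mem_univ, and_true, Finset.mem_insert, hmem]
      by_cases h : z = b <;> simp [h, hab.symm]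
    have e2 : Finset.univ.erase b = insert a Z := by
      ext z
      simp only [Finset.mem_erase, Finset.mem_univ, and_true, Finset.mem_insert, hmem]
      by_cases h : z = a <;> simp [h, hab]
    have hbZ : b ∉ Z := by simp [hmem]
    have haZ : a ∉ Z := by simp [hmem]
    rw [polarDeg, polarDeg, nearCount, nearCount, e1, e2, Finset.sum_insert hbZ,
      Finset.sum_insert haZ, adj_comm R (r b) (θ b)] at hω
    have h3 : ∑ z ∈ Z, adj R (r a) (θ a) (r z) (θ z) ≤ ∑ z ∈ Z, adj R (r b) (θ b) (r z) (θ z) := by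
      linarith
    have h4 : (0 : ℝ) ≤ ∑ z ∈ Z, ξ z (ω z) := by
      have h5 : ∑ z ∈ Z, ξ z (ω z) =
          ((∑ z ∈ Z, adj R (r b) (θ b) (r z) (θ z) - ∑ z ∈ Z, adj R (r a) (θ a) (r z) (θ z) : ℤ)
            : ℝ) := by
        rw [← Finset.sum_sub_distrib]
        push_cast
        refine Finset.sum_congr rfl fun z hz => ?_
        rw [hθa, hθb, hθz z hz]
      rw [h5]
      exact_mod_cast sub_nonneg.2 h3
    have e3 : ∏ i, f i (ω i) = Real.exp (t * ∑ z ∈ Z, ξ z (ω z)) := by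
      rw [Finset.mul_sum, Real.exp_sum, Finset.prod_ite_mem, Finset.univ_inter]
    rw [e3]
    exact Real.one_le_exp (mul_nonneg ht0 h4)
  · rw [Real.exp_sum, ← Finset.prod_subset (Finset.subset_univ Z) fun i _ hi => by simp [hf, hi]]
    refine Finset.prod_le_prod (fun z _ => integral_nonneg fun φ => ?_) hval
    simp only [hf]; split_ifs; positivity

/-- Markov's inequality for the number of neighbours lost when the radius of a point grows. -/
theorem measureReal_nearCount_sub_gt {R ρ ρ' : ℝ} {r : ι → ℝ} (hr : ∀ i, 0 < r i)
    (hrR : ∀ i, r i ≤ R) (hρ : 0 < ρ) (hρρ : ρ ≤ ρ') {Z : Finset ι} {i : ι} (hi : i ∉ Z)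
    {T c : ℝ} (hc : 0 < c)
    (hT : ∑ z ∈ Z, (arc R ρ (r z) - arc R ρ' (r z)) ≤ T) :
    (Measure.pi fun _ : ι => angularLaw).real
      {θ | c ≤ (nearCount R r Z ρ i θ - nearCount R r Z ρ' i θ : ℤ)} ≤ T / c := by
  have hint : ∀ (s : ℝ) (z : ι), Integrable (fun θ : ι → ℝ => (adj R s (θ i) (r z) (θ z) : ℝ))
      (Measure.pi fun _ : ι => angularLaw) := fun s z =>
    integrable_adj R measurable_const (measurable_pi_apply i) measurable_const
      (measurable_pi_apply z)
  have e : (fun θ : ι → ℝ => ((nearCount R r Z ρ i θ - nearCount R r Z ρ' i θ : ℤ) : ℝ)) =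
      fun θ => ∑ z ∈ Z, ((adj R ρ (θ i) (r z) (θ z) : ℝ) - adj R ρ' (θ i) (r z) (θ z)) := by
    funext θ
    simp [nearCount]
  have hI : ∫ θ, ((nearCount R r Z ρ i θ - nearCount R r Z ρ' i θ : ℤ) : ℝ)
      ∂(Measure.pi fun _ : ι => angularLaw) = ∑ z ∈ Z, (arc R ρ (r z) - arc R ρ' (r z)) := by
    rw [e, integral_finsetSum Z (f := fun z (θ : ι → ℝ) =>
      (adj R ρ (θ i) (r z) (θ z) : ℝ) - adj R ρ' (θ i) (r z) (θ z))
      fun z _ => (hint ρ z).sub (hint ρ' z)]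
    refine Finset.sum_congr rfl fun z hz => ?_
    have hiz : i ≠ z := fun h => hi (h ▸ hz)
    rw [integral_sub (hint ρ z) (hint ρ' z),
      integral_adj R measurable_const (measurable_pi_apply i) measurable_const
        (measurable_pi_apply z),
      integral_adj R measurable_const (measurable_pi_apply i) measurable_const
        (measurable_pi_apply z), measureReal_near_pair hρ (hr z) hiz,
      measureReal_near_pair (hρ.trans_le hρρ) (hr z) hiz]
  have hII : Integrable (fun θ : ι → ℝ =>
      ((nearCount R r Z ρ i θ - nearCount R r Z ρ' i θ : ℤ) : ℝ))
      (Measure.pi fun _ : ι => angularLaw) := by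
    rw [e]
    exact integrable_finsetSum _ fun z _ => (hint ρ z).sub (hint ρ' z)
  have hnn : ∀ θ : ι → ℝ, (0 : ℝ) ≤ ((nearCount R r Z ρ i θ - nearCount R r Z ρ' i θ : ℤ) : ℝ) := by
    intro θ
    have : nearCount R r Z ρ' i θ ≤ nearCount R r Z ρ i θ := by
      refine Finset.sum_le_sum fun z _ => ?_
      unfold adj
      split_ifs with h1 h2
      · exact le_rfl
      · exact absurd (h1.anti hρ hρρ (hr z) (hrR z)) h2
      · norm_num
      · exact le_rfl
    exact_mod_cast sub_nonneg.2 this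
  have := mul_meas_ge_le_integral_of_nonneg (ae_of_all _ hnn) hII c
  rw [hI] at this
  rw [le_div_iff₀ hc, mul_comm]
  exact this.trans hT

end Angles

/-! ### Pairs of nodes and the symmetry of their angles -/

section Pairs

variable {ι : Type*} [Fintype ι] [DecidableEq ι]

/-- The mean number of common neighbours, among the nodes `z ∈ J`, of the points of radius `ρ`
and angles `α` and `β`. -/
noncomputable def overlap {ι : Type*} (R : ℝ) (r : ι → ℝ) (J : Finset ι) (ρ α β : ℝ) : ℝ :=
  ∑ z ∈ J, angularLaw.real {φ | Near R ρ α (r z) φ ∧ Near R ρ β (r z) φ}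

theorem measurable_overlap {ι : Type*} (R : ℝ) (r : ι → ℝ) (J : Finset ι) (ρ : ℝ) :
    Measurable fun p : ℝ × ℝ => overlap R r J ρ p.1 p.2 := by
  refine Finset.measurable_sum _ fun z _ => Measurable.ennreal_toReal ?_
  have hm : MeasurableSet {q : (ℝ × ℝ) × ℝ |
      Near R ρ q.1.1 (r z) q.2 ∧ Near R ρ q.1.2 (r z) q.2} :=
    (measurable_near R measurable_const (by fun_prop) measurable_const (by fun_prop)).inter
      (measurable_near R measurable_const (by fun_prop) measurable_const (by fun_prop))
  exact measurable_measure_prodMk_left hm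

theorem measurable_overlap_apply {ι : Type*} (R : ℝ) (r : ι → ℝ) (J : Finset ι) (ρ : ℝ) (x y : ι) :
    Measurable fun θ : ι → ℝ => overlap R r J ρ (θ x) (θ y) := by
  have h : Measurable fun θ : ι → ℝ => (θ x, θ y) :=
    (measurable_pi_apply x).prodMk (measurable_pi_apply y)
  have h2 := measurable_overlap R r J ρ
  generalize overlap R r J ρ = f at h2 ⊢
  exact h2.comp h

/-- The expected number of common neighbours of two nodes with independent uniform angles. -/
theorem integral_overlap_le {R ρ : ℝ} {r : ι → ℝ} (hr : ∀ i, 0 < r i) (hρ : 0 < ρ) {x y : ι}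
    (hxy : x ≠ y) {J : Finset ι} (hx : x ∉ J) (hy : y ∉ J) :
    ∫ θ, overlap R r J ρ (θ x) (θ y) ∂(Measure.pi fun _ : ι => angularLaw) ≤
      ∑ z ∈ J, arc R ρ (r z) * arc R ρ (r z) := by
  have hmz : ∀ z, Measurable fun θ : ι → ℝ =>
      angularLaw.real {φ | Near R ρ (θ x) (r z) φ ∧ Near R ρ (θ y) (r z) φ} := fun z => by
    simpa [overlap] using measurable_overlap_apply R r {z} ρ x y
  unfold overlap
  rw [integral_finsetSum J (f := fun z (θ : ι → ℝ) =>
    angularLaw.real {φ | Near R ρ (θ x) (r z) φ ∧ Near R ρ (θ y) (r z) φ})]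
  · refine Finset.sum_le_sum fun z hz => ?_
    have hxz : x ≠ z := fun h => hx (h ▸ hz)
    have hyz : y ≠ z := fun h => hy (h ▸ hz)
    set E : Set (ι → ℝ) := {θ | Near R ρ (θ x) (r z) (θ z) ∧ Near R ρ (θ y) (r z) (θ z)} with hE
    have hEm : MeasurableSet E :=
      (measurable_near R measurable_const (measurable_pi_apply x) measurable_const
        (measurable_pi_apply z)).inter (measurable_near R measurable_const (measurable_pi_apply y)
          measurable_const (measurable_pi_apply z))
    have h1 := measureReal_eq_integral_piecewise angularLaw {x, y} hEm
    have h2 : ∀ θ : ι → ℝ, (Measure.pi fun _ : ι => angularLaw).real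
        {ω | ({x, y} : Finset ι).piecewise θ ω ∈ E} =
        angularLaw.real {φ | Near R ρ (θ x) (r z) φ ∧ Near R ρ (θ y) (r z) φ} := by
      intro θ
      have hm : MeasurableSet {φ | Near R ρ (θ x) (r z) φ ∧ Near R ρ (θ y) (r z) φ} :=
        (measurable_near R measurable_const measurable_const measurable_const measurable_id).inter
          (measurable_near R measurable_const measurable_const measurable_const measurable_id)
      rw [← measureReal_pi_eval angularLaw z hm]
      congr 1
      ext ω
      simp [hE, Finset.piecewise, hxz.symm, hyz.symm]
    simp only [h2] at h1
    rw [← h1]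
    -- Given the angle of `z`, the two adjacencies are independent.
    refine measureReal_le_of_piecewise angularLaw {z} hEm fun θ => ?_
    have hB : ∀ s : Set ℝ, s = {φ | Near R ρ φ (r z) (θ z)} → MeasurableSet s ∧
        angularLaw.real s = arc R ρ (r z) := by
      rintro s rfl
      refine ⟨measurable_near R measurable_const measurable_id measurable_const measurable_const,
        ?_⟩
      simp only [near_comm (R := R) (r := ρ)]
      rw [angularLaw_real_near _ (hr z) hρ, arc_comm]
    obtain ⟨hBm, hBv⟩ := hB _ rfl
    have h3 := measureReal_pi_pair_le angularLaw hxy hBm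
      (E := {p : ℝ × ℝ | p.2 ∈ {φ | Near R ρ φ (r z) (θ z)}}) (measurable_snd hBm)
      (c := arc R ρ (r z)) (fun a _ => hBv.le)
    rw [hBv] at h3
    refine le_trans (le_of_eq ?_) h3
    congr 1
    ext ω
    simp [hE, Finset.piecewise, hxz, hyz]
  · intro z _
    exact Integrable.of_bound (hmz z).aestronglyMeasurable 1
      (ae_of_all _ fun θ => by
        rw [Real.norm_eq_abs, abs_of_nonneg measureReal_nonneg]
        exact measureReal_le_one)

/-- Markov's inequality: the mean number of common neighbours is rarely more than half of the mean
number of neighbours. -/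
theorem measureReal_overlap_ge {R ρ : ℝ} {r : ι → ℝ} (hr : ∀ i, 0 < r i) (hρ : 0 < ρ) {x y : ι}
    (hxy : x ≠ y) {J : Finset ι} (hx : x ∉ J) (hy : y ∉ J) {δ : ℝ}
    (hδ : ∀ z ∈ J, arc R ρ (r z) ≤ δ) (hA : 0 < ∑ z ∈ J, arc R ρ (r z)) :
    (Measure.pi fun _ : ι => angularLaw).real
      {θ | (∑ z ∈ J, arc R ρ (r z)) / 2 ≤ overlap R r J ρ (θ x) (θ y)} ≤ 2 * δ := by
  set A := ∑ z ∈ J, arc R ρ (r z) with hAdef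
  have hm : Measurable fun θ : ι → ℝ => overlap R r J ρ (θ x) (θ y) :=
    measurable_overlap_apply R r J ρ x y
  have hnn : ∀ θ : ι → ℝ, 0 ≤ overlap R r J ρ (θ x) (θ y) := fun θ =>
    Finset.sum_nonneg fun z _ => measureReal_nonneg
  have hi : Integrable (fun θ : ι → ℝ => overlap R r J ρ (θ x) (θ y))
      (Measure.pi fun _ : ι => angularLaw) := by
    refine Integrable.of_bound hm.aestronglyMeasurable J.card (ae_of_all _ fun θ => ?_)
    rw [Real.norm_eq_abs, abs_of_nonneg (hnn θ)]
    refine (Finset.sum_le_card_nsmul _ _ 1 fun z _ => measureReal_le_one).trans (by simp)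
  have h1 := mul_meas_ge_le_integral_of_nonneg (ae_of_all _ hnn) hi (A / 2)
  have h2 := integral_overlap_le hr hρ hxy hx hy (R := R)
  have h3 : ∑ z ∈ J, arc R ρ (r z) * arc R ρ (r z) ≤ δ * A := by
    rw [hAdef, Finset.mul_sum]
    exact Finset.sum_le_sum fun z hz => mul_le_mul_of_nonneg_right (hδ z hz) (arc_nonneg _ _ _)
  refine le_of_mul_le_mul_left ?_ (half_pos hA)
  calc _ ≤ δ * A := h1.trans (h2.trans h3)
    _ = _ := by ring

/-- Anticoncentration for the difference of the numbers of neighbours of two points of the same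
radius `ρ` with independent uniform angles. Given these angles, any other node is adjacent to either
point with the same probability, so that its contribution is symmetric; its variance is large unless
the two neighbourhoods overlap too much, which is excluded by `measureReal_overlap_ge`. -/
theorem measureReal_nearCount_close_le {R ρ : ℝ} {r : ι → ℝ} (hr : ∀ i, 0 < r i) (hρ : 0 < ρ)
    {x y : ι} (hxy : x ≠ y) {Z J : Finset ι} (hJZ : J ⊆ Z) (hx : x ∉ Z) (hy : y ∉ Z) {δ : ℝ}
    (hδ : ∀ z ∈ J, arc R ρ (r z) ≤ δ) (hδ4 : δ ≤ 1 / 4) (hA : 0 < ∑ z ∈ J, arc R ρ (r z))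
    (u : ℕ) :
    (Measure.pi fun _ : ι => angularLaw).real
      {θ | |nearCount R r Z ρ x θ - nearCount R r Z ρ y θ| ≤ (u : ℤ)} ≤
        2 * δ + (2 * u + 1) / √((∑ z ∈ J, arc R ρ (r z)) / 2) := by
  set A := ∑ z ∈ J, arc R ρ (r z) with hAdef
  set E : Set (ι → ℝ) := {θ | |nearCount R r Z ρ x θ - nearCount R r Z ρ y θ| ≤ (u : ℤ)} with hE
  set F : Set (ι → ℝ) := {θ | A / 2 ≤ overlap R r J ρ (θ x) (θ y)} with hF
  have hFm : MeasurableSet F := measurableSet_le measurable_const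
    (measurable_overlap_apply R r J ρ x y)
  have hEm : MeasurableSet E := by
    have h1 := (measurable_nearCount R r Z ρ x).sub (measurable_nearCount R r Z ρ y)
    exact h1 (show MeasurableSet {k : ℤ | |k| ≤ (u : ℤ)} from trivial)
  have hFle := measureReal_overlap_ge hr hρ hxy (fun h => hx (hJZ h)) (fun h => hy (hJZ h)) hδ hA
  have hdiff : (Measure.pi fun _ : ι => angularLaw).real (E \ F) ≤ (2 * u + 1) / √(A / 2) := by
    refine measureReal_le_of_piecewise angularLaw {x, y} (hEm.diff hFm) fun θ => ?_
    by_cases hθ : A / 2 ≤ overlap R r J ρ (θ x) (θ y)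
    · have : {ω : ι → ℝ | ({x, y} : Finset ι).piecewise θ ω ∈ E \ F} = ∅ := by
        ext ω
        simp [hF, Finset.piecewise, hθ]
      rw [this, measureReal_empty]
      positivity
    set ξ : ι → ℝ → ℤ := fun z φ =>
      if z ∈ Z then adj R ρ (θ x) (r z) φ - adj R ρ (θ y) (r z) φ else 0 with hξ
    have hξm : ∀ z, Measurable (ξ z) := fun z => by
      by_cases hz : z ∈ Z
      · simp only [hξ, hz, if_true]
        exact (measurable_adj R measurable_const measurable_const measurable_const
          measurable_id).sub (measurable_adj R measurable_const measurable_const measurable_const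
            measurable_id)
      · simp only [hξ, hz, if_false]
        exact measurable_const
    have hnm : ∀ α z, MeasurableSet {φ | Near R ρ α (r z) φ} := fun α z =>
      measurable_near R measurable_const measurable_const measurable_const measurable_id
    set p : ι → ℝ := fun z => arc R ρ (r z) -
      angularLaw.real {φ | Near R ρ (θ x) (r z) φ ∧ Near R ρ (θ y) (r z) φ} with hp
    have hdf : ∀ α β z, angularLaw.real {φ | Near R ρ α (r z) φ ∧ ¬ Near R ρ β (r z) φ} =
        arc R ρ (r z) - angularLaw.real {φ | Near R ρ α (r z) φ ∧ Near R ρ β (r z) φ} := by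
      intro α β z
      have := measureReal_inter_add_sdiff (μ := angularLaw) (s := {φ | Near R ρ α (r z) φ})
        (hnm β z) (measure_ne_top _ _)
      rw [angularLaw_real_near α hρ (hr z)] at this
      rw [eq_sub_iff_add_eq, add_comm]
      exact this
    have key := measureReal_abs_sum_le (ι := ι) angularLaw hξm J (p := p)
      (V := A / 2) ?_ ?_ ?_ ?_ (by linarith) ?_ u
    · refine le_trans (measureReal_mono ?_ (measure_ne_top _ _)) key
      rintro ω ⟨hω, -⟩
      simp only [Set.mem_ofPred_eq]
      have e : ∑ i, ξ i (ω i) = nearCount R r Z ρ x (({x, y} : Finset ι).piecewise θ ω) -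
          nearCount R r Z ρ y (({x, y} : Finset ι).piecewise θ ω) := by
        unfold nearCount
        rw [← Finset.sum_sub_distrib]
        simp only [hξ]
        rw [Finset.sum_ite_mem, Finset.univ_inter]
        refine Finset.sum_congr rfl fun z hz => ?_
        have h1 : z ≠ x := fun h => hx (h ▸ hz)
        have h2 : z ≠ y := fun h => hy (h ▸ hz)
        simp [h1, h2]
      rw [e]
      exact hω
    · intro z hz φ
      simp only [hξ, hJZ hz, if_true]
      rcases adj_zero_or_one R ρ (θ x) (r z) φ with h | h <;>
        rcases adj_zero_or_one R ρ (θ y) (r z) φ with h' | h' <;> rw [h, h'] <;> norm_num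
    · intro z hz
      simp only [hp]
      rw [← hdf]
      congr 1
      ext φ
      by_cases h1 : Near R ρ (θ x) (r z) φ <;> by_cases h2 : Near R ρ (θ y) (r z) φ <;>
        simp [hξ, adj, hJZ hz, h1, h2]
    · intro z hz
      simp only [hp]
      simp only [and_comm (a := Near R ρ (θ x) (r z) _)]
      rw [← hdf]
      congr 1
      ext φ
      by_cases h1 : Near R ρ (θ x) (r z) φ <;> by_cases h2 : Near R ρ (θ y) (r z) φ <;>
        simp [hξ, adj, hJZ hz, h1, h2]
    · intro z hz
      have h1 := hδ z hz
      have h2 : 0 ≤ angularLaw.real {φ | Near R ρ (θ x) (r z) φ ∧ Near R ρ (θ y) (r z) φ} :=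
        measureReal_nonneg
      simp only [hp]
      linarith
    · simp only [hp]
      rw [Finset.sum_sub_distrib]
      change A / 2 ≤ A - overlap R r J ρ (θ x) (θ y)
      linarith
  calc _ ≤ (Measure.pi fun _ : ι => angularLaw).real (F ∪ E \ F) :=
        measureReal_mono (fun ω hω => by
          by_cases h : ω ∈ F
          · exact Or.inl h
          · exact Or.inr ⟨hω, h⟩) (measure_ne_top _ _)
    _ ≤ _ := (measureReal_union_le _ _).trans (add_le_add hFle hdiff)

/-- Let `ρ ≤ ρ'`. With probability close to one, one of the two angles is so favourable that its
point of radius `ρ'` has over `2 K` more neighbours than the point of radius `ρ` at the other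
angle. -/
theorem measureReal_not_separated_le {R ρ ρ' : ℝ} {r : ι → ℝ} (hr : ∀ i, 0 < r i)
    (hrR : ∀ i, r i ≤ R) (hρ : 0 < ρ) (hρρ : ρ ≤ ρ') {x y : ι} (hxy : x ≠ y) {Z J : Finset ι}
    (hJZ : J ⊆ Z) (hx : x ∉ Z) (hy : y ∉ Z) {δ : ℝ} (hδ : ∀ z ∈ J, arc R ρ' (r z) ≤ δ)
    (hδ4 : δ ≤ 1 / 4) {A : ℝ} (hA : 0 < A) (hAJ : A ≤ ∑ z ∈ J, arc R ρ' (r z)) {T : ℝ}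
    (hT : ∑ z ∈ Z, (arc R ρ (r z) - arc R ρ' (r z)) ≤ T) (K : ℕ) {τ : ℕ} (hτ : 0 < τ) :
    (Measure.pi fun _ : ι => angularLaw).real
      {θ | ¬ nearCount R r Z ρ y θ + 2 * K < nearCount R r Z ρ' x θ ∧
        ¬ nearCount R r Z ρ x θ + 2 * K < nearCount R r Z ρ' y θ} ≤
      2 * δ + (2 * (2 * K + τ) + 1) / √(A / 2) + 2 * (T / τ) := by
  have hτ' : (0 : ℝ) < τ := by exact_mod_cast hτ
  have h1 := measureReal_nearCount_close_le hr (hρ.trans_le hρρ) hxy hJZ hx hy hδ hδ4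
    (hA.trans_le hAJ) (2 * K + τ)
  have h2 := measureReal_nearCount_sub_gt hr hrR hρ hρρ hx hτ' hT
  have h3 := measureReal_nearCount_sub_gt hr hrR hρ hρρ hy hτ' hT
  have h4 : ((2 * ((2 * K + τ : ℕ) : ℝ) + 1) / √((∑ z ∈ J, arc R ρ' (r z)) / 2)) ≤
      (2 * (2 * K + τ) + 1) / √(A / 2) := by
    push_cast
    have : 0 < √(A / 2) := Real.sqrt_pos.2 (by linarith)
    gcongr
  have hsub : {θ : ι → ℝ | ¬ nearCount R r Z ρ y θ + 2 * K < nearCount R r Z ρ' x θ ∧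
        ¬ nearCount R r Z ρ x θ + 2 * K < nearCount R r Z ρ' y θ} ⊆
      ({θ | |nearCount R r Z ρ' x θ - nearCount R r Z ρ' y θ| ≤ ((2 * K + τ : ℕ) : ℤ)} ∪
      {θ | (τ : ℝ) ≤ (nearCount R r Z ρ x θ - nearCount R r Z ρ' x θ : ℤ)}) ∪
      {θ | (τ : ℝ) ≤ (nearCount R r Z ρ y θ - nearCount R r Z ρ' y θ : ℤ)} := by
    rintro θ ⟨ha, hb⟩
    by_contra hc
    simp only [Set.mem_union, Set.mem_ofPred_eq, not_or, not_le] at hc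
    obtain ⟨⟨c1, c2⟩, c3⟩ := hc
    have c2 : nearCount R r Z ρ x θ - nearCount R r Z ρ' x θ < τ := by exact_mod_cast c2
    have c3 : nearCount R r Z ρ y θ - nearCount R r Z ρ' y θ < τ := by exact_mod_cast c3
    rw [lt_abs] at c1
    push_cast at c1
    omega
  refine (measureReal_mono hsub (measure_ne_top _ _)).trans ?_
  refine (measureReal_union_le _ _).trans ?_
  refine (add_le_add_left (measureReal_union_le _ _) _).trans ?_
  linarith

/-- Given `K` disjoint pairs `x l`, `y l` of nodes, exchanging the angles within a pair turns a
correctly ordered pair with well separated degrees into an inverted one. So all pairs are in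
order with probability at most `2 ^ (-K)`, up to the probability that some pair is not well
separated. -/
theorem measureReal_no_inversion_le {R : ℝ} {r : ι → ℝ} (hr : ∀ i, 0 < r i)
    (hrR : ∀ i, r i ≤ R) {x y : ℕ → ι} {K : ℕ} (hle : ∀ l < K, r (x l) ≤ r (y l))
    (hxy : ∀ l < K, ∀ m < K, x l ≠ y m)
    (hxx : ∀ l < K, ∀ m < K, l ≠ m → x l ≠ x m) (hyy : ∀ l < K, ∀ m < K, l ≠ m → y l ≠ y m)
    {Z : Finset ι}
    (hZ : Z = Finset.univ \ ((Finset.range K).image x ∪ (Finset.range K).image y)) {c : ℝ}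
    (hc : ∀ l < K, (Measure.pi fun _ : ι => angularLaw).real
      {θ | ¬ nearCount R r Z (r (x l)) (y l) θ + 2 * K < nearCount R r Z (r (y l)) (x l) θ ∧
        ¬ nearCount R r Z (r (x l)) (x l) θ + 2 * K < nearCount R r Z (r (y l)) (y l) θ} ≤ c) :
    (Measure.pi fun _ : ι => angularLaw).real
      {θ | ∀ l < K, polarDeg R r θ (y l) ≤ polarDeg R r θ (x l)} ≤ (1 / 2) ^ K + K * c := by
  set U := (Finset.range K).image x ∪ (Finset.range K).image y with hU
  have hUcard : U.card ≤ 2 * K := by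
    refine (Finset.card_union_le _ _).trans ?_
    have h1 := Finset.card_image_le (s := Finset.range K) (f := x)
    have h2 := Finset.card_image_le (s := Finset.range K) (f := y)
    rw [Finset.card_range] at h1 h2
    omega
  have hxU : ∀ l < K, x l ∈ U := fun l hl =>
    Finset.mem_union_left _ (Finset.mem_image_of_mem _ (Finset.mem_range.2 hl))
  have hyU : ∀ l < K, y l ∈ U := fun l hl =>
    Finset.mem_union_right _ (Finset.mem_image_of_mem _ (Finset.mem_range.2 hl))
  have hnZ : ∀ i ∈ U, i ∉ Z := fun i hi h => by
    rw [hZ, Finset.mem_sdiff] at h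
    exact h.2 hi
  -- The at most `2 K` nodes of the pairs do not matter for well separated degrees.
  have hdeg : ∀ i ∈ U, ∀ θ : ι → ℝ, nearCount R r Z (r i) i θ ≤ polarDeg R r θ i ∧
      polarDeg R r θ i ≤ nearCount R r Z (r i) i θ + 2 * K := by
    intro i hi θ
    have hsub : Z ⊆ Finset.univ.erase i := fun z hz =>
      Finset.mem_erase.2 ⟨fun h => hnZ i hi (h ▸ hz), Finset.mem_univ _⟩
    unfold polarDeg nearCount
    rw [← Finset.sum_sdiff hsub]
    have h1 : 0 ≤ ∑ z ∈ Finset.univ.erase i \ Z, adj R (r i) (θ i) (r z) (θ z) :=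
      Finset.sum_nonneg fun z _ => adj_nonneg _ _ _ _ _
    have h2 : ∑ z ∈ Finset.univ.erase i \ Z, adj R (r i) (θ i) (r z) (θ z) ≤ U.card := by
      refine (Finset.sum_le_card_nsmul _ _ 1 fun z _ => adj_le_one _ _ _ _ _).trans ?_
      rw [nsmul_eq_mul, mul_one]
      refine Nat.cast_le.2 (Finset.card_le_card fun z hz => ?_)
      rw [Finset.mem_sdiff, hZ, Finset.mem_sdiff] at hz
      by_contra h
      exact hz.2 ⟨Finset.mem_univ _, h⟩
    have h3 : (U.card : ℤ) ≤ 2 * K := by exact_mod_cast hUcard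
    constructor <;> linarith
  set B : ℕ → Set (ι → ℝ) := fun l =>
    {θ | nearCount R r Z (r (x l)) (y l) θ + 2 * K < nearCount R r Z (r (y l)) (x l) θ} with hB
  set T : ℕ → (ι → ℝ) → (ι → ℝ) := fun l θ => θ ∘ Equiv.swap (x l) (y l) with hT
  have hBm : ∀ l, MeasurableSet (B l) := fun l =>
    measurableSet_lt ((measurable_nearCount R r Z _ _).add_const _) (measurable_nearCount R r Z _ _)
  -- The counts run over `Z`, which avoids all pairs, so exchanging the angles of a pair just
  -- exchanges its two counts.
  have hswap : ∀ l < K, ∀ ρ i (θ : ι → ℝ), nearCount R r Z ρ i (T l θ) =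
      nearCount R r Z ρ (Equiv.swap (x l) (y l) i) θ := by
    intro l hl ρ i θ
    refine Finset.sum_congr rfl fun z hz => ?_
    have h1 : z ≠ x l := fun h => hnZ _ (hxU l hl) (h ▸ hz)
    have h2 : z ≠ y l := fun h => hnZ _ (hyU l hl) (h ▸ hz)
    simp [hT, Equiv.swap_apply_of_ne_of_ne h1 h2]
  have hmono : ∀ l < K, ∀ i (θ : ι → ℝ), nearCount R r Z (r (y l)) i θ ≤
      nearCount R r Z (r (x l)) i θ := by
    intro l hl i θ
    refine Finset.sum_le_sum fun z _ => ?_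
    unfold adj
    split_ifs with h1 h2
    · exact le_rfl
    · exact absurd (h1.anti (hr _) (hle l hl) (hr z) (hrR z)) h2
    · norm_num
    · exact le_rfl
  have hhalf := measureReal_iInter_le_half_pow (Measure.pi fun _ : ι => angularLaw) B T K
    (fun l _ => measurePreserving_comp_swap angularLaw (x l) (y l)) (fun l _ => hBm l)
    (by
      intro l hl m hm
      have hmK : m < K := hm.trans hl
      ext θ
      simp only [hB, Set.mem_preimage, Set.mem_ofPred_eq, hswap l hl]
      rw [Equiv.swap_apply_of_ne_of_ne (hxx m hmK l hl hm.ne) (hxy m hmK l hl),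
        Equiv.swap_apply_of_ne_of_ne (hxy l hl m hmK).symm (hyy m hmK l hl hm.ne)])
    (by
      intro l hl
      rw [Set.disjoint_left]
      intro θ h1 h2
      simp only [hB, Set.mem_preimage, Set.mem_ofPred_eq, hswap l hl, Equiv.swap_apply_left,
        Equiv.swap_apply_right] at h1 h2
      have h3 := hmono l hl (x l) θ
      have h4 := hmono l hl (y l) θ
      omega)
  set D : ℕ → Set (ι → ℝ) := fun l =>
    {θ | ¬ nearCount R r Z (r (x l)) (y l) θ + 2 * K < nearCount R r Z (r (y l)) (x l) θ ∧
      ¬ nearCount R r Z (r (x l)) (x l) θ + 2 * K < nearCount R r Z (r (y l)) (y l) θ} with hD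
  have hsub : {θ : ι → ℝ | ∀ l < K, polarDeg R r θ (y l) ≤ polarDeg R r θ (x l)} ⊆
      {θ | ∀ l < K, θ ∈ B l} ∪ ⋃ l ∈ Finset.range K, D l := by
    intro θ hθ
    by_cases hbad : ∃ l < K, θ ∈ D l
    · obtain ⟨l, hl, h⟩ := hbad
      exact Or.inr (Set.mem_biUnion (Finset.mem_range.2 hl) h)
    · refine Or.inl fun l hl => ?_
      by_contra hnb
      refine hbad ⟨l, hl, hnb, fun h => ?_⟩
      have h1 := hθ l hl
      have h2 := (hdeg _ (hxU l hl) θ).2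
      have h3 := (hdeg _ (hyU l hl) θ).1
      omega
  refine (measureReal_mono hsub (measure_ne_top _ _)).trans ?_
  refine (measureReal_union_le _ _).trans (add_le_add hhalf ?_)
  refine (measureReal_biUnion_finset_le _ _).trans ?_
  refine (Finset.sum_le_card_nsmul _ _ c fun l hl => hc l (Finset.mem_range.1 hl)).trans ?_
  simp

end Pairs

/-! ### The law of the radius -/

section Radial

variable {α ν : ℝ} {n : ℕ}

theorem measurable_radialDensity (α ν : ℝ) (n : ℕ) : Measurable (radialDensity α ν n) := by
  refine Measurable.indicator ?_ measurableSet_Ico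
  exact ((Real.measurable_sinh.comp (measurable_const_mul α)).const_mul α).div_const _

theorem cosh_sub_one_ge (hα : 1 / 2 < α) (hR : 2 ≤ discRadius ν n) :
    Real.exp (α * discRadius ν n) / 8 ≤ Real.cosh (α * discRadius ν n) - 1 :=
  exp_eighth_le_cosh_sub_one (by nlinarith)

theorem cosh_sub_one_le (hα : 1 / 2 < α) (hR : 2 ≤ discRadius ν n) :
    Real.cosh (α * discRadius ν n) - 1 ≤ Real.exp (α * discRadius ν n) := by
  have : 0 ≤ α * discRadius ν n := by nlinarith
  linarith [cosh_le_exp this]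

theorem cosh_sub_one_pos (hα : 1 / 2 < α) (hR : 2 ≤ discRadius ν n) :
    0 < Real.cosh (α * discRadius ν n) - 1 :=
  (by positivity : 0 < Real.exp (α * discRadius ν n) / 8).trans_le (cosh_sub_one_ge hα hR)

theorem radialDensity_nonneg (hα : 1 / 2 < α) (hR : 2 ≤ discRadius ν n) (r : ℝ) :
    0 ≤ radialDensity α ν n r := by
  refine Set.indicator_nonneg (fun x hx => ?_) r
  have h1 := cosh_sub_one_pos hα hR
  have h2 : 0 ≤ Real.sinh (α * x) := Real.sinh_nonneg_iff.2 (mul_nonneg (by linarith) hx.1)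
  have : 0 < α := by linarith
  positivity

theorem radialDensity_le (hα : 1 / 2 < α) (hR : 2 ≤ discRadius ν n) (r : ℝ) :
    radialDensity α ν n r ≤ 4 * α * Real.exp (-α * (discRadius ν n - r)) := by
  have hα0 : 0 < α := by linarith
  unfold radialDensity
  refine Set.indicator_apply_le' (fun hr => ?_) fun _ => by positivity
  have h1 := cosh_sub_one_ge hα hR
  rw [div_le_iff₀ (cosh_sub_one_pos hα hR)]
  have h2 := sinh_le_exp_half (α * r)
  have h3 : Real.exp (α * r) =
      Real.exp (-α * (discRadius ν n - r)) * Real.exp (α * discRadius ν n) := by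
    rw [← Real.exp_add]; congr 1; ring
  calc α * Real.sinh (α * r) ≤ α * (Real.exp (α * r) / 2) := by gcongr
    _ = 4 * α * Real.exp (-α * (discRadius ν n - r)) * (Real.exp (α * discRadius ν n) / 8) := by
        rw [h3]; ring
    _ ≤ _ := by gcongr

theorem integral_sinh_eq (α a b c : ℝ) :
    ∫ r in a..b, α * Real.sinh (α * r) / c = (Real.cosh (α * b) - Real.cosh (α * a)) / c := by
  rw [sub_div]
  refine intervalIntegral.integral_eq_sub_of_hasDerivAt
    (f := fun r => Real.cosh (α * r) / c) (fun x _ => ?_) ?_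
  · have h1 : HasDerivAt (fun r => α * r) α x := by
      simpa using (hasDerivAt_id x).const_mul α
    have := ((Real.hasDerivAt_cosh (α * x)).comp x h1).div_const c
    simpa [mul_comm, Function.comp_def] using this
  · refine Continuous.intervalIntegrable ?_ _ _
    have := Real.continuous_sinh
    fun_prop

/-- The radial law of an interval, in closed form. -/
theorem radialLaw_Ico (hα : 1 / 2 < α) (hR : 2 ≤ discRadius ν n) {a b : ℝ} (ha : 0 ≤ a)
    (hab : a ≤ b) (hb : b ≤ discRadius ν n) :
    radialLaw α ν n (Set.Ico a b) = ENNReal.ofReal ((Real.cosh (α * b) - Real.cosh (α * a)) /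
      (Real.cosh (α * discRadius ν n) - 1)) := by
  unfold radialLaw
  rw [withDensity_apply _ measurableSet_Ico]
  have e : ∀ r ∈ Set.Ico a b, ENNReal.ofReal (radialDensity α ν n r) =
      ENNReal.ofReal (α * Real.sinh (α * r) / (Real.cosh (α * discRadius ν n) - 1)) := by
    intro r hr
    unfold radialDensity
    rw [Set.indicator_of_mem (show r ∈ Set.Ico 0 (discRadius ν n) from
      ⟨ha.trans hr.1, hr.2.trans_le hb⟩)]
  rw [setLIntegral_congr_fun measurableSet_Ico e, ← ofReal_integral_eq_lintegral_ofReal,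
    integral_Ico_eq_integral_Ioc, ← intervalIntegral.integral_of_le hab, integral_sinh_eq]
  · have hc : Continuous fun r =>
        α * Real.sinh (α * r) / (Real.cosh (α * discRadius ν n) - 1) := by
      have := Real.continuous_sinh
      fun_prop
    exact hc.integrableOn_Icc.mono_set Set.Ico_subset_Icc_self
  · filter_upwards [ae_restrict_mem measurableSet_Ico] with r hr
    have h1 := cosh_sub_one_pos hα hR
    have hα0 : 0 < α := by linarith
    have h2 : 0 ≤ Real.sinh (α * r) :=
      Real.sinh_nonneg_iff.2 (mul_nonneg hα0.le (ha.trans hr.1))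
    change 0 ≤ α * Real.sinh (α * r) / (Real.cosh (α * discRadius ν n) - 1)
    positivity

theorem radialLaw_compl (α ν : ℝ) (n : ℕ) :
    radialLaw α ν n (Set.Ico 0 (discRadius ν n))ᶜ = 0 := by
  unfold radialLaw
  rw [withDensity_apply _ measurableSet_Ico.compl,
    setLIntegral_congr_fun (g := fun _ => 0) measurableSet_Ico.compl]
  · simp
  · intro r hr
    unfold radialDensity
    simp only
    rw [Set.indicator_of_notMem hr, ENNReal.ofReal_zero]

theorem radialLaw_ae (α ν : ℝ) (n : ℕ) :
    ∀ᵐ r ∂(radialLaw α ν n), r ∈ Set.Ico 0 (discRadius ν n) := by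
  rw [ae_iff]
  exact radialLaw_compl α ν n

theorem isProbabilityMeasure_radialLaw (hα : 1 / 2 < α) (hR : 2 ≤ discRadius ν n) :
    IsProbabilityMeasure (radialLaw α ν n) := by
  refine ⟨?_⟩
  rw [← measure_add_measure_compl (measurableSet_Ico (a := (0 : ℝ)) (b := discRadius ν n)),
    radialLaw_compl, add_zero, radialLaw_Ico hα hR le_rfl (by linarith) le_rfl]
  rw [mul_zero, Real.cosh_zero, div_self (cosh_sub_one_pos hα hR).ne', ENNReal.ofReal_one]

theorem radialLaw_real_Ico (hα : 1 / 2 < α) (hR : 2 ≤ discRadius ν n) {a b : ℝ} (ha : 0 ≤ a)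
    (hab : a ≤ b) (hb : b ≤ discRadius ν n) :
    (radialLaw α ν n).real (Set.Ico a b) = (Real.cosh (α * b) - Real.cosh (α * a)) /
      (Real.cosh (α * discRadius ν n) - 1) := by
  rw [measureReal_def, radialLaw_Ico hα hR ha hab hb, ENNReal.toReal_ofReal]
  refine div_nonneg (sub_nonneg.2 (Real.cosh_le_cosh.2 ?_)) (cosh_sub_one_pos hα hR).le
  have : 0 < α := by linarith
  rw [abs_of_nonneg (by positivity), abs_of_nonneg (mul_nonneg this.le (ha.trans hab))]
  gcongr

theorem radialLaw_real_Iio (hα : 1 / 2 < α) (hR : 2 ≤ discRadius ν n) {s : ℝ} (hs : 0 ≤ s)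
    (hsR : s ≤ discRadius ν n) :
    (radialLaw α ν n).real (Set.Iio s) =
      (Real.cosh (α * s) - 1) / (Real.cosh (α * discRadius ν n) - 1) := by
  have h0 := radialLaw_real_Ico hα hR le_rfl hs hsR
  rw [mul_zero, Real.cosh_zero] at h0
  rw [← h0]
  refine measureReal_congr ?_
  filter_upwards [radialLaw_ae α ν n] with r hr
  exact propext ⟨fun h => ⟨hr.1, h⟩, fun h => h.2⟩

theorem radialLaw_real_Iio_ge (hα : 1 / 2 < α) (hR : 2 ≤ discRadius ν n) {s : ℝ} (hs : 2 ≤ s)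
    (hsR : s ≤ discRadius ν n) :
    Real.exp (-α * (discRadius ν n - s)) / 8 ≤ (radialLaw α ν n).real (Set.Iio s) := by
  rw [radialLaw_real_Iio hα hR (by linarith) hsR, le_div_iff₀ (cosh_sub_one_pos hα hR)]
  have h1 := cosh_sub_one_le hα hR
  have h2 : Real.exp (α * s) / 8 ≤ Real.cosh (α * s) - 1 :=
    exp_eighth_le_cosh_sub_one (by nlinarith)
  have h3 : Real.exp (α * s) =
      Real.exp (-α * (discRadius ν n - s)) * Real.exp (α * discRadius ν n) := by
    rw [← Real.exp_add]; congr 1; ring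
  have h4 := mul_le_mul_of_nonneg_left h1 (Real.exp_pos (-α * (discRadius ν n - s))).le
  linarith

theorem radialLaw_real_Iio_le (hα : 1 / 2 < α) (hR : 2 ≤ discRadius ν n) {s : ℝ} (hs : 0 ≤ s)
    (hsR : s ≤ discRadius ν n) :
    (radialLaw α ν n).real (Set.Iio s) ≤ 8 * Real.exp (-α * (discRadius ν n - s)) := by
  rw [radialLaw_real_Iio hα hR hs hsR, div_le_iff₀ (cosh_sub_one_pos hα hR)]
  have h1 := cosh_sub_one_ge hα hR
  have h2 := cosh_le_exp (show 0 ≤ α * s by nlinarith)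
  have h3 : Real.exp (α * s) =
      Real.exp (-α * (discRadius ν n - s)) * Real.exp (α * discRadius ν n) := by
    rw [← Real.exp_add]; congr 1; ring
  have h4 := mul_le_mul_of_nonneg_left h1 (Real.exp_pos (-α * (discRadius ν n - s))).le
  linarith

theorem radialLaw_real_Ico_le (hα : 1 / 2 < α) (hR : 2 ≤ discRadius ν n) {a η b : ℝ}
    (hη : 0 ≤ η) (hb : a + η ≤ b) :
    (radialLaw α ν n).real (Set.Ico a (a + η)) ≤
      4 * α * Real.exp (-α * (discRadius ν n - b)) * η := by
  have hα0 : 0 < α := by linarith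
  set M := 4 * α * Real.exp (-α * (discRadius ν n - b)) with hM
  have hM0 : 0 ≤ M := by positivity
  have h : radialLaw α ν n (Set.Ico a (a + η)) ≤ ENNReal.ofReal (M * η) := by
    unfold radialLaw
    rw [withDensity_apply _ measurableSet_Ico]
    calc _ ≤ ∫⁻ _ in Set.Ico a (a + η), ENNReal.ofReal M := by
          refine setLIntegral_mono measurable_const fun r hr => ENNReal.ofReal_le_ofReal ?_
          refine (radialDensity_le hα hR r).trans ?_
          rw [hM]
          have : -α * (discRadius ν n - r) ≤ -α * (discRadius ν n - b) := by
            have := hr.2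
            nlinarith
          gcongr
      _ = _ := by
          rw [setLIntegral_const, Real.volume_Ico, add_sub_cancel_left, ENNReal.ofReal_mul hM0]
  exact ENNReal.toReal_le_of_le_ofReal (by positivity) h

theorem radialLaw_real_Ico_ge (hα : 1 / 2 < α) (hR : 2 ≤ discRadius ν n) {a η : ℝ}
    (ha : 2 ≤ a) (hη : 0 ≤ η) (hb : a + η ≤ discRadius ν n) :
    α / 4 * Real.exp (-α * (discRadius ν n - a)) * η ≤
      (radialLaw α ν n).real (Set.Ico a (a + η)) := by
  have hα0 : 0 < α := by linarith
  rw [radialLaw_real_Ico hα hR (by linarith) (by linarith) hb,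
    le_div_iff₀ (cosh_sub_one_pos hα hR)]
  have h1 : α * η * Real.sinh (α * a) ≤ Real.cosh (α * (a + η)) - Real.cosh (α * a) := by
    rw [mul_add, Real.cosh_add]
    have h2 : 0 ≤ Real.sinh (α * a) := Real.sinh_nonneg_iff.2 (by positivity)
    have h3 : α * η ≤ Real.sinh (α * η) := Real.self_le_sinh_iff.2 (by positivity)
    nlinarith [Real.one_le_cosh (α * η), Real.cosh_pos (α * a)]
  have h2 : Real.exp (α * a) / 4 ≤ Real.sinh (α * a) := exp_quarter_le_sinh (by nlinarith)
  have h3 : Real.exp (α * a) =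
      Real.exp (-α * (discRadius ν n - a)) * Real.exp (α * discRadius ν n) := by
    rw [← Real.exp_add]; congr 1; ring
  have h4 := cosh_sub_one_le hα hR
  calc _ ≤ α / 4 * Real.exp (-α * (discRadius ν n - a)) * η *
        Real.exp (α * discRadius ν n) := by gcongr
    _ = α * η * (Real.exp (α * a) / 4) := by rw [h3]; ring
    _ ≤ α * η * Real.sinh (α * a) := by gcongr
    _ ≤ _ := h1

/-- A node lies within distance one of the boundary with probability bounded away from zero. -/
theorem radialLaw_real_boundary_ge (hα : 1 / 2 < α) (hR : 2 ≤ discRadius ν n) :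
    1 - 1 / Real.cosh α ≤
      (radialLaw α ν n).real (Set.Ico (discRadius ν n - 1) (discRadius ν n)) := by
  have hα0 : 0 < α := by linarith
  rw [radialLaw_real_Ico hα hR (by linarith) (by linarith) le_rfl,
    le_div_iff₀ (cosh_sub_one_pos hα hR)]
  have h1 : Real.cosh (α * (discRadius ν n - 1)) * Real.cosh α ≤
      Real.cosh (α * discRadius ν n) := by
    have : α * discRadius ν n = α * (discRadius ν n - 1) + α := by ring
    rw [this, Real.cosh_add]
    have h2 : 0 ≤ Real.sinh (α * (discRadius ν n - 1)) :=
      Real.sinh_nonneg_iff.2 (by nlinarith)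
    have h3 : 0 ≤ Real.sinh α := Real.sinh_nonneg_iff.2 hα0.le
    nlinarith
  have hc := Real.one_le_cosh α
  have hc0 := Real.cosh_pos α
  have h4 : Real.cosh (α * (discRadius ν n - 1)) ≤
      Real.cosh (α * discRadius ν n) * (1 / Real.cosh α) := by
    rw [mul_one_div, le_div_iff₀ hc0]
    exact h1
  have h5 : 1 / Real.cosh α ≤ 1 := (div_le_one hc0).2 hc
  nlinarith

theorem integrable_exp_radialLaw (hα : 1 / 2 < α) (hR : 2 ≤ discRadius ν n) :
    Integrable (fun z => Real.exp ((discRadius ν n - z) / 2)) (radialLaw α ν n) := by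
  have := isProbabilityMeasure_radialLaw hα hR
  refine Integrable.of_bound (by fun_prop) (Real.exp (discRadius ν n / 2)) ?_
  filter_upwards [radialLaw_ae α ν n] with z hz
  rw [Real.norm_eq_abs, abs_of_pos (Real.exp_pos _)]
  exact Real.exp_le_exp.2 (by linarith [hz.1])

/-- The moment that controls the expected degrees; it is bounded uniformly in `n` because
`1 / 2 < α`. -/
theorem integral_exp_radialLaw_le (hα : 1 / 2 < α) (hR : 2 ≤ discRadius ν n) :
    ∫ z, Real.exp ((discRadius ν n - z) / 2) ∂(radialLaw α ν n) ≤ 4 * α / (α - 1 / 2) := by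
  have hα0 : 0 < α := by linarith
  set R := discRadius ν n with hRdef
  set γ := α - 1 / 2 with hγ
  have hγ0 : 0 < γ := by rw [hγ]; linarith
  have e : ∫ z, Real.exp ((R - z) / 2) ∂(radialLaw α ν n) =
      ∫ z in Set.Ico 0 R, radialDensity α ν n z * Real.exp ((R - z) / 2) := by
    unfold radialLaw
    rw [integral_withDensity_eq_integral_toReal_smul
      (measurable_radialDensity α ν n).ennreal_ofReal (ae_of_all _ fun _ => ENNReal.ofReal_lt_top),
      ← integral_indicator measurableSet_Ico]
    congr 1
    funext z
    rw [ENNReal.toReal_ofReal (radialDensity_nonneg hα hR z), smul_eq_mul]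
    by_cases hz : z ∈ Set.Ico 0 R
    · rw [Set.indicator_of_mem hz]
    · rw [Set.indicator_of_notMem hz, radialDensity, Set.indicator_of_notMem hz, zero_mul]
  have hcont : Continuous fun z => 4 * α * Real.exp (-γ * R) * Real.exp (γ * z) := by fun_prop
  calc _ = _ := e
    _ ≤ ∫ z in Set.Ico 0 R, 4 * α * Real.exp (-γ * R) * Real.exp (γ * z) := by
        refine integral_mono_of_nonneg (ae_of_all _ fun z =>
          mul_nonneg (radialDensity_nonneg hα hR z) (Real.exp_pos _).le)
          (hcont.integrableOn_Icc.mono_set Set.Ico_subset_Icc_self) (ae_of_all _ fun z => ?_)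
        refine (mul_le_mul_of_nonneg_right (radialDensity_le hα hR z)
          (Real.exp_pos _).le).trans (le_of_eq ?_)
        change _ = 4 * α * Real.exp (-γ * R) * Real.exp (γ * z)
        rw [mul_assoc (4 * α), mul_assoc (4 * α), ← Real.exp_add, ← Real.exp_add]
        congr 2
        rw [hγ, hRdef]
        ring
    _ = 4 * α * Real.exp (-γ * R) * ((Real.exp (γ * R) - 1) / γ) := by
        rw [integral_Ico_eq_integral_Ioc, ← intervalIntegral.integral_of_le (by linarith),
          intervalIntegral.integral_const_mul]
        congr 1
        rw [intervalIntegral.integral_comp_mul_left (fun x => Real.exp x) hγ0.ne', integral_exp]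
        simp [div_eq_inv_mul]
    _ = 4 * α / γ * (1 - Real.exp (-γ * R)) := by
        have : Real.exp (-γ * R) * Real.exp (γ * R) = 1 := by
          rw [← Real.exp_add]; simp
        calc 4 * α * Real.exp (-γ * R) * ((Real.exp (γ * R) - 1) / γ) = 4 * α / γ *
              (Real.exp (-γ * R) * Real.exp (γ * R) - Real.exp (-γ * R)) := by ring
          _ = _ := by rw [this]
    _ ≤ _ := by
        have : 0 ≤ 4 * α / γ := by positivity
        nlinarith [Real.exp_pos (-γ * R)]

theorem radialLaw_real_singleton (α ν : ℝ) (n : ℕ) (x : ℝ) : (radialLaw α ν n).real {x} = 0 := by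
  have : radialLaw α ν n {x} = 0 := by
    unfold radialLaw
    rw [withDensity_apply _ (measurableSet_singleton x)]
    exact setLIntegral_measure_zero _ _ (by simp)
  simp [measureReal_def, this]

/-- The expected share of the nodes adjacent to a point of radius `s`. -/
theorem integral_arc_le (hα : 1 / 2 < α) (hR : 2 ≤ discRadius ν n) {s : ℝ} (hs : 1 ≤ s)
    (hsR : s ≤ discRadius ν n - 1) :
    ∫ z, arc (discRadius ν n) s z ∂(radialLaw α ν n) ≤
      3 * Real.exp (-s / 2) * (4 * α / (α - 1 / 2)) := by
  have := isProbabilityMeasure_radialLaw hα hR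
  have h1 : ∀ z, arc (discRadius ν n) s z ≤
      3 * Real.exp (-s / 2) * Real.exp ((discRadius ν n - z) / 2) := fun z => by
    refine (arc_le' hs hsR).trans (le_of_eq ?_)
    rw [mul_assoc, ← Real.exp_add]
    congr 2
    ring
  refine (integral_mono_of_nonneg (ae_of_all _ fun z => arc_nonneg _ _ _)
    ((integrable_exp_radialLaw hα hR).const_mul _) (ae_of_all _ h1)).trans ?_
  rw [integral_const_mul]
  exact mul_le_mul_of_nonneg_left (integral_exp_radialLaw_le hα hR) (by positivity)

end Radial

/-! ### Coincidences in a random sample and moments -/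

section Coincidences

variable {ι Ω : Type*} [Fintype ι] [MeasurableSpace Ω]

/-- An event contained in an event `A` about the coordinates in `T`, with conditional probability
at most `c` given these coordinates. -/
theorem measureReal_le_mul_of_piecewise (μ : Measure Ω) [IsProbabilityMeasure μ] (T : Finset ι)
    [∀ i, Decidable (i ∈ T)] {E A : Set (ι → Ω)} (hE : MeasurableSet E) (hA : MeasurableSet A)
    {c : ℝ} (h : ∀ x ∈ A, (Measure.pi fun _ => μ).real {ω | T.piecewise x ω ∈ E} ≤ c)
    (h0 : ∀ x ∉ A, ∀ ω, T.piecewise x ω ∉ E) :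
    (Measure.pi fun _ => μ).real E ≤ (Measure.pi fun _ => μ).real A * c := by
  rw [measureReal_eq_integral_piecewise μ T hE, ← smul_eq_mul, ← integral_indicator_const c hA]
  refine integral_mono_of_nonneg (ae_of_all _ fun _ => measureReal_nonneg)
    ((integrable_const _).indicator hA) (ae_of_all _ fun x => ?_)
  by_cases hx : x ∈ A
  · rw [Set.indicator_of_mem hx]
    exact h x hx
  · rw [Set.indicator_of_notMem hx]
    have : {ω | T.piecewise x ω ∈ E} = ∅ := Set.eq_empty_of_forall_notMem fun ω => h0 x hx ω
    simp [this]

theorem measureReal_pi_forall_mem (μ : Measure Ω) [IsProbabilityMeasure μ] (B : Finset ι)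
    (S : Set Ω) :
    (Measure.pi fun _ : ι => μ).real {ω | ∀ j ∈ B, ω j ∈ S} = μ.real S ^ B.card := by
  classical
  have e : {ω : ι → Ω | ∀ j ∈ B, ω j ∈ S} =
      Set.univ.pi fun j => if j ∈ B then S else Set.univ := by
    ext ω
    simp only [Set.mem_ofPred_eq, Set.mem_pi, Set.mem_univ, forall_const]
    refine forall_congr' fun j => ?_
    by_cases hj : j ∈ B <;> simp [hj]
  rw [e, measureReal_def, Measure.pi_pi, ENNReal.toReal_prod,
    ← Finset.prod_subset (Finset.subset_univ B) fun i _ hi => by simp [hi]]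
  rw [← Finset.prod_const]
  exact Finset.prod_congr rfl fun i hi => by simp [hi, measureReal_def]

/-- The points `a` and `b` lie in the same of the first `L` cells `C c`. -/
def SameCell (C : ℕ → Set Ω) (L : ℕ) (a b : Ω) : Prop := ∃ c < L, a ∈ C c ∧ b ∈ C c

theorem measurableSet_sameCell {ι : Type*} {C : ℕ → Set Ω} (hC : ∀ c, MeasurableSet (C c)) (L : ℕ)
    (i j : ι) :
    MeasurableSet {ω : ι → Ω | SameCell C L (ω i) (ω j)} := by
  have : {ω : ι → Ω | SameCell C L (ω i) (ω j)} =
      ⋃ c, ⋃ (_ : c < L), {ω | ω i ∈ C c} ∩ {ω | ω j ∈ C c} := by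
    ext ω
    simp only [SameCell, Set.mem_ofPred_eq, Set.mem_iUnion, Set.mem_inter_iff, exists_prop]
  rw [this]
  exact MeasurableSet.iUnion fun c => MeasurableSet.iUnion fun _ =>
    (measurable_pi_apply i (hC c)).inter (measurable_pi_apply j (hC c))

/-- The birthday problem: if the product of the sizes of `A` and `B` is large compared with
`1 / (L q ^ 2)`, then two of the coordinates in `A ∪ B` fall in the same of `L` cells of
probability at least `q`. The coordinates in `A` occupy many cells, and those in `B` hit one. -/
theorem measureReal_no_coincidence_le [DecidableEq ι] (μ : Measure Ω) [IsProbabilityMeasure μ]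
    {A B : Finset ι} (hAB : Disjoint A B) {C : ℕ → Set Ω} (hC : ∀ c, MeasurableSet (C c))
    (hCd : Pairwise (Function.onFun Disjoint C)) {L : ℕ} {q : ℝ} (hq0 : 0 ≤ q)
    (hq : ∀ c < L, q ≤ μ.real (C c)) :
    (Measure.pi fun _ : ι => μ).real
      {ω | ∀ i ∈ A ∪ B, ∀ j ∈ A ∪ B, i ≠ j → ¬ SameCell C L (ω i) (ω j)} ≤
      Real.exp (-(A.card * (L * q) / 4)) +
        Real.exp (-(B.card * (A.card * (L * q) / 4 * q))) := by
  classical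
  set S : Set Ω := ⋃ c ∈ Finset.range L, C c with hS
  have hSm : MeasurableSet S := Finset.measurableSet_biUnion _ fun c _ => hC c
  have hmeasO : ∀ O : Finset ℕ, O ⊆ Finset.range L →
      O.card * q ≤ μ.real (⋃ c ∈ O, C c) := by
    intro O hO
    rw [measureReal_biUnion_finset (fun a _ b _ hab => hCd hab) fun c _ => hC c]
    rw [← nsmul_eq_mul]
    exact Finset.card_nsmul_le_sum _ _ _ fun c hc => hq c (Finset.mem_range.1 (hO hc))
  have hSq : L * q ≤ μ.real S := by
    simpa only [Finset.card_range] using hmeasO (Finset.range L) subset_rfl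
  set m : ℝ := A.card * (L * q) / 4 with hm
  set few : Set (ι → Ω) := {ω | ((A.filter fun i => ω i ∈ S).card : ℝ) ≤ m} with hfew
  have hfew_le := measureReal_card_le μ A hSm hSq
  set E : Set (ι → Ω) :=
    {ω | ∀ i ∈ A ∪ B, ∀ j ∈ A ∪ B, i ≠ j → ¬ SameCell C L (ω i) (ω j)} with hE
  have hEm : MeasurableSet E := by
    have : E = ⋂ i ∈ A ∪ B, ⋂ j ∈ A ∪ B, ⋂ (_ : i ≠ j),
        {ω : ι → Ω | SameCell C L (ω i) (ω j)}ᶜ := by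
      ext ω
      simp [hE]
    rw [this]
    exact Finset.measurableSet_biInter _ fun i _ => Finset.measurableSet_biInter _ fun j _ =>
      MeasurableSet.iInter fun _ => (measurableSet_sameCell hC L i j).compl
  have hfm : MeasurableSet few := by
    have h1 : Measurable fun ω : ι → Ω => ∑ i ∈ A, S.indicator (fun _ => (1 : ℝ)) (ω i) :=
      Finset.measurable_sum _ fun i _ =>
        (measurable_const.indicator hSm).comp (measurable_pi_apply i)
    have h2 : few = {ω | ∑ i ∈ A, S.indicator (fun _ => (1 : ℝ)) (ω i) ≤ m} := by
      ext ω
      simp [hfew, Set.indicator_apply]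
    rw [h2]
    exact measurableSet_le h1 measurable_const
  have hmany : (Measure.pi fun _ : ι => μ).real (E \ few) ≤ Real.exp (-(B.card * (m * q))) := by
    refine measureReal_le_of_piecewise μ A (hEm.diff hfm) fun x => ?_
    set O := (Finset.range L).filter fun c => ∃ i ∈ A, x i ∈ C c with hO
    by_cases hx : (m < (A.filter fun i => x i ∈ S).card) ∧
        ∀ i ∈ A, ∀ j ∈ A, i ≠ j → ¬ SameCell C L (x i) (x j)
    · have hcard : (A.filter fun i => x i ∈ S).card ≤ O.card := by
        have h1 : (A.filter fun i => x i ∈ S) ⊆ O.biUnion fun c => A.filter fun i => x i ∈ C c := by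
          intro i hi
          rw [Finset.mem_filter] at hi
          obtain ⟨hiA, hiS⟩ := hi
          simp only [hS, Set.mem_iUnion, Finset.mem_range, exists_prop] at hiS
          obtain ⟨c, hc, hic⟩ := hiS
          simp only [hO, Finset.mem_biUnion, Finset.mem_filter, Finset.mem_range]
          exact ⟨c, ⟨hc, i, hiA, hic⟩, hiA, hic⟩
        refine (Finset.card_le_card h1).trans (Finset.card_biUnion_le.trans ?_)
        refine (Finset.sum_le_card_nsmul _ _ 1 fun c hc => ?_).trans (by simp)
        rw [Finset.card_le_one]
        intro i hi j hj
        rw [Finset.mem_filter] at hi hj hc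
        by_contra hij
        exact hx.2 i hi.1 j hj.1 hij ⟨c, Finset.mem_range.1 hc.1, hi.2, hj.2⟩
      have hOq : m * q ≤ μ.real (⋃ c ∈ O, C c) := by
        refine le_trans ?_ (hmeasO O (Finset.filter_subset _ _))
        have : (((A.filter fun i => x i ∈ S).card : ℕ) : ℝ) ≤ O.card := by exact_mod_cast hcard
        exact mul_le_mul_of_nonneg_right (hx.1.le.trans this) hq0
      have hsub : {ω | A.piecewise x ω ∈ E \ few} ⊆ {ω | ∀ j ∈ B, ω j ∈ (⋃ c ∈ O, C c)ᶜ} := by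
        rintro ω ⟨hω, -⟩ j hj hmem
        simp only [Set.mem_iUnion, exists_prop] at hmem
        obtain ⟨c, hc, hjc⟩ := hmem
        simp only [hO, Finset.mem_filter, Finset.mem_range] at hc
        obtain ⟨hcL, i, hiA, hic⟩ := hc
        have hjA : j ∉ A := Finset.disjoint_right.1 hAB hj
        refine hω i (Finset.mem_union_left _ hiA) j (Finset.mem_union_right _ hj)
          (fun h => hjA (h ▸ hiA)) ⟨c, hcL, ?_, ?_⟩
        · simpa [hiA] using hic
        · simpa [hjA] using hjc
      refine (measureReal_mono hsub (measure_ne_top _ _)).trans ?_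
      rw [measureReal_pi_forall_mem, probReal_compl_eq_one_sub
        (Finset.measurableSet_biUnion _ fun c _ => hC c)]
      have h2 : 1 - μ.real (⋃ c ∈ O, C c) ≤ Real.exp (-(m * q)) := by
        have := Real.add_one_le_exp (-(m * q))
        linarith
      calc _ ≤ Real.exp (-(m * q)) ^ B.card :=
            pow_le_pow_left₀ (sub_nonneg.2 measureReal_le_one) h2 _
        _ = _ := by rw [← Real.exp_nat_mul]; congr 1; ring
    · have : {ω | A.piecewise x ω ∈ E \ few} = ∅ := by
        refine Set.eq_empty_of_forall_notMem fun ω hω => hx ⟨?_, fun i hi j hj hij hs => ?_⟩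
        · have h1 := hω.2
          simp only [hfew, Set.mem_ofPred_eq, not_le] at h1
          refine h1.trans_eq ?_
          congr 2
          refine Finset.filter_congr fun i hi => ?_
          simp [hi]
        · refine hω.1 i (Finset.mem_union_left _ hi) j (Finset.mem_union_left _ hj) hij ?_
          simpa [hi, hj] using hs
      rw [this, measureReal_empty]
      exact (Real.exp_pos _).le
  calc _ ≤ (Measure.pi fun _ : ι => μ).real (few ∪ E \ few) :=
        measureReal_mono (fun ω hω => by
          by_cases h : ω ∈ few
          · exact Or.inl h
          · exact Or.inr ⟨hω, h⟩) (measure_ne_top _ _)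
    _ ≤ _ := (measureReal_union_le _ _).trans (add_le_add hfew_le hmany)

/-- Markov's inequality for a sum of the same function of independent coordinates. -/
theorem measureReal_sum_ge_le (μ : Measure Ω) [IsProbabilityMeasure μ] (J : Finset ι) {g : Ω → ℝ}
    (hgi : Integrable g μ) (hg : ∀ᵐ x ∂μ, 0 ≤ g x) {t : ℝ} (ht : 0 < t) :
    (Measure.pi fun _ : ι => μ).real {ω | t ≤ ∑ z ∈ J, g (ω z)} ≤
      J.card * (∫ x, g x ∂μ) / t := by
  have hi : ∀ z, Integrable (fun ω : ι → Ω => g (ω z)) (Measure.pi fun _ : ι => μ) := fun z =>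
    (measurePreserving_eval (fun _ : ι => μ) z).integrable_comp_of_integrable hgi
  have hv : ∀ z, ∫ ω : ι → Ω, g (ω z) ∂(Measure.pi fun _ : ι => μ) = ∫ x, g x ∂μ := fun z =>
    integral_comp_eval (i := z) hgi.aestronglyMeasurable
  have h0 : ∀ᵐ ω ∂(Measure.pi fun _ : ι => μ), 0 ≤ ∑ z ∈ J, g (ω z) := by
    have : ∀ z, ∀ᵐ ω ∂(Measure.pi fun _ : ι => μ), 0 ≤ g (ω z) := fun z =>
      (measurePreserving_eval (fun _ : ι => μ) z).quasiMeasurePreserving.ae hg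
    filter_upwards [ae_all_iff.2 this] with ω hω
    exact Finset.sum_nonneg fun z _ => hω z
  have := mul_meas_ge_le_integral_of_nonneg h0 (integrable_finsetSum J fun z _ => hi z) t
  rw [integral_finsetSum J fun z _ => hi z] at this
  simp only [hv, Finset.sum_const, nsmul_eq_mul] at this
  rw [le_div_iff₀ ht, mul_comm]
  exact this

/-- Two coordinates fall in `C` while a sum over the other coordinates is large. -/
theorem measureReal_pair_and_sum_ge_le [DecidableEq ι] (μ : Measure Ω) [IsProbabilityMeasure μ]
    {i j : ι} (hij : i ≠ j) {C : Set Ω} (hC : MeasurableSet C) {g : Ω → ℝ} (hgm : Measurable g)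
    (hgi : Integrable g μ) (hg : ∀ᵐ x ∂μ, 0 ≤ g x) {t : ℝ} (ht : 0 < t) :
    (Measure.pi fun _ : ι => μ).real
      {ω | ω i ∈ C ∧ ω j ∈ C ∧ t ≤ ∑ z ∈ Finset.univ \ {i, j}, g (ω z)} ≤
      μ.real C * μ.real C * (Fintype.card ι * (∫ x, g x ∂μ) / t) := by
  set E : Set (ι → Ω) :=
    {ω | ω i ∈ C ∧ ω j ∈ C ∧ t ≤ ∑ z ∈ Finset.univ \ {i, j}, g (ω z)} with hE
  have hA : MeasurableSet {ω : ι → Ω | ω i ∈ C ∧ (ω i, ω j) ∈ {p : Ω × Ω | p.2 ∈ C}} :=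
    (measurable_pi_apply i hC).inter (measurable_pi_apply j hC)
  have hEm : MeasurableSet E := by
    refine (measurable_pi_apply i hC).inter ((measurable_pi_apply j hC).inter ?_)
    exact measurableSet_le measurable_const
      (Finset.measurable_sum _ fun z _ => hgm.comp (measurable_pi_apply z))
  have hP := measureReal_pi_pair_le μ hij hC (E := {p : Ω × Ω | p.2 ∈ C}) (measurable_snd hC)
    (c := μ.real C) fun x _ => le_rfl
  have hg0 : 0 ≤ ∫ x, g x ∂μ := integral_nonneg_of_ae hg
  refine (measureReal_le_mul_of_piecewise μ {i, j} hEm hA (c := Fintype.card ι * (∫ x, g x ∂μ) / t)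
    (fun x _ => ?_) fun x hx ω hω => hx ?_).trans
    (mul_le_mul_of_nonneg_right hP (by positivity))
  · have hsub : {ω | ({i, j} : Finset ι).piecewise x ω ∈ E} ⊆
        {ω | t ≤ ∑ z ∈ Finset.univ \ {i, j}, g (ω z)} := by
      intro ω hω
      refine hω.2.2.trans (le_of_eq (Finset.sum_congr rfl fun z hz => ?_))
      rw [Finset.mem_sdiff] at hz
      rw [Finset.piecewise_eq_of_notMem _ _ _ hz.2]
    refine (measureReal_mono hsub (measure_ne_top _ _)).trans
      ((measureReal_sum_ge_le μ _ hgi hg ht).trans ?_)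
    have : ((Finset.univ \ {i, j} : Finset ι).card : ℝ) ≤ Fintype.card ι := by
      exact_mod_cast Finset.card_le_univ _
    gcongr
  · have h1 := hω.1
    have h2 := hω.2.1
    simp at h1 h2
    exact ⟨h1, h2⟩

end Coincidences

/-! ### Good radii -/

open Classical in
/-- The typical behaviour of the radii, given which the angles are analysed. At least `m` nodes are
close to the boundary, and `W` controls the expected degrees. At least `k` nodes have radii less
than `s₁`, and the radius of any node farther out exceeds that of such a node by `η` or more. The
window `[s₂, s₂ + 1)` holds nodes of ranks in `[N, V]`, among them `K` disjoint pairs with so close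
radii that the expected degrees within a pair differ by at most `T`. -/
structure GoodRadii {n : ℕ} (R s₁ η k m W s₂ N V T : ℝ) (K : ℕ) (r : Fin n → ℝ) : Prop where
  inside : ∀ i, 6 ≤ r i ∧ r i < R
  boundary : m ≤ (Finset.univ.filter fun z => R - 1 ≤ r z).card
  moment : ∑ z, Real.exp ((R - r z) / 2) ≤ W
  lowRank : k ≤ (Finset.univ.filter fun z => r z < s₁).card
  gap : ∀ a b, a ≠ b → r a < s₁ → r a ≤ r b → r a + η ≤ r b
  rankLower : N ≤ (Finset.univ.filter fun z => r z < s₂).card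
  rankUpper : ((Finset.univ.filter fun z => r z < s₂ + 1).card : ℝ) ≤ V
  pairs : ∃ x y : ℕ → Fin n,
    (∀ l < K, s₂ ≤ r (x l) ∧ r (x l) < r (y l) ∧ r (y l) < s₂ + 1 ∧
      ∑ z ∈ Finset.univ \ {x l, y l}, (arc R (r (x l)) (r z) - arc R (r (y l)) (r z)) ≤ T) ∧
    (∀ l < K, ∀ m < K, x l ≠ y m) ∧ (∀ l < K, ∀ m < K, l ≠ m → x l ≠ x m) ∧
    (∀ l < K, ∀ m < K, l ≠ m → y l ≠ y m)

section Good

variable {n : ℕ} {R s₁ η k m W s₂ N V T : ℝ} {K : ℕ} {r : Fin n → ℝ}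

theorem card_sdiff_ge (S U : Finset (Fin n)) :
    (S.card : ℝ) - U.card ≤ (S \ U).card := by
  have := Finset.le_card_sdiff U S
  have : S.card ≤ (S \ U).card + U.card := by omega
  have : (S.card : ℝ) ≤ (S \ U).card + U.card := by exact_mod_cast this
  linarith

/-- Given good radii, a node of radius less than `s₁` has a larger degree than any given node
farther from the centre, up to a small probability. -/
theorem GoodRadii.measureReal_polarDeg_le (h : GoodRadii R s₁ η k m W s₂ N V T K r)
    (hη0 : 0 ≤ η) (hη1 : η ≤ 1) (hm : 2 ≤ m) (hW : m ≤ W) {a b : Fin n} (hab : a ≠ b)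
    (ha : r a < s₁) (hrab : r a ≤ r b) :
    (Measure.pi fun _ : Fin n => angularLaw).real
      {θ | polarDeg R r θ a ≤ polarDeg R r θ b} ≤
      Real.exp (-(Real.exp (-s₁ / 2) * (η * (m - 2)) ^ 2 / (480 ^ 2 * 24 * W))) := by
  classical
  have hr0 : ∀ i, 0 < r i := fun i => by linarith [(h.inside i).1]
  have hrR : ∀ i, r i ≤ R := fun i => (h.inside i).2.le
  have hW0 : 0 < W := by linarith
  -- This value of `t` maximizes the exponent of the Chernoff bound.
  set t := η * (m - 2) / (480 * 12 * W) with ht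
  have ht0 : 0 ≤ t := by
    have : 0 ≤ m - 2 := by linarith
    positivity
  have ht1 : t ≤ 1 := by
    rw [ht, div_le_one (by positivity)]
    nlinarith
  refine (RHG.measureReal_polarDeg_le hr0 hrR hab hrab ht0 ht1).trans (Real.exp_le_exp.2 ?_)
  set Z : Finset (Fin n) := Finset.univ \ {a, b} with hZ
  set e := Real.exp (-(r a) / 2) with he
  have he0 : 0 < e := Real.exp_pos _
  set J := (Finset.univ.filter fun z => R - 1 ≤ r z) \ {a, b} with hJ
  have hJZ : J ⊆ Z := Finset.sdiff_subset_sdiff (Finset.subset_univ _) subset_rfl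
  have hJcard : m - 2 ≤ (J.card : ℝ) := by
    have h1 := card_sdiff_ge (Finset.univ.filter fun z => R - 1 ≤ r z) {a, b}
    have h2 : ((({a, b} : Finset (Fin n)).card : ℕ) : ℝ) ≤ 2 := by
      exact_mod_cast Finset.card_le_two
    have h3 := h.boundary
    linarith
  have hδ : (m - 2) * (η * e / 480) ≤
      ∑ z ∈ Z, (arc R (r a) (r z) - arc R (r b) (r z)) := by
    calc (m - 2) * (η * e / 480) ≤ J.card * (η * e / 480) := by gcongr
      _ ≤ ∑ z ∈ J, (arc R (r a) (r z) - arc R (r b) (r z)) := by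
          rw [← nsmul_eq_mul]
          refine Finset.card_nsmul_le_sum _ _ _ fun z hz => ?_
          have hz1 : R - 1 ≤ r z := by
            rw [hJ, Finset.mem_sdiff, Finset.mem_filter] at hz
            exact hz.1.2
          have h1 := sub_arc_ge (h.inside a).1 (hrR a) hη0 hη1 (hrR z) hz1
          have h2 := arc_anti (R := R) (r := r a + η) (r' := r b) (by linarith [hr0 a])
            (h.gap a b hab ha hrab) (hr0 z) (hrR z)
          linarith
      _ ≤ _ := by
          refine Finset.sum_le_sum_of_subset_of_nonneg hJZ fun z _ _ => ?_
          have := arc_anti (hr0 a) hrab (hr0 z) (hrR z)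
          linarith
  have harc : ∑ z ∈ Z, arc R (r a) (r z) ≤ 3 * e * W := by
    calc _ ≤ ∑ z ∈ Z, 3 * e * Real.exp ((R - r z) / 2) := by
          refine Finset.sum_le_sum fun z _ => ?_
          refine (arc_le (by linarith [(h.inside a).1]) (by linarith [(h.inside z).1])
            ((hr0 a).le.trans (hrR a))).trans (le_of_eq ?_)
          rw [he, mul_assoc, ← Real.exp_add]
          congr 2
          ring
      _ ≤ ∑ z, 3 * e * Real.exp ((R - r z) / 2) :=
          Finset.sum_le_sum_of_subset_of_nonneg (Finset.subset_univ _) fun z _ _ => by positivity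
      _ ≤ _ := by
          rw [← Finset.mul_sum]
          exact mul_le_mul_of_nonneg_left h.moment (by positivity)
  rw [Finset.sum_add_distrib, ← Finset.mul_sum, ← Finset.mul_sum]
  have h1 : t * ((m - 2) * (η * e / 480)) ≤
      t * ∑ z ∈ Z, (arc R (r a) (r z) - arc R (r b) (r z)) := mul_le_mul_of_nonneg_left hδ ht0
  have h2 : 2 * t ^ 2 * ∑ z ∈ Z, arc R (r a) (r z) ≤ 2 * t ^ 2 * (3 * e * W) :=
    mul_le_mul_of_nonneg_left harc (by positivity)
  have h3 : t * ((m - 2) * (η * e / 480)) - 2 * t ^ 2 * (3 * e * W) =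
      e * (η * (m - 2)) ^ 2 / (480 ^ 2 * 24 * W) := by
    rw [ht]; field_simp; ring
  have h4 : Real.exp (-s₁ / 2) * (η * (m - 2)) ^ 2 / (480 ^ 2 * 24 * W) ≤
      e * (η * (m - 2)) ^ 2 / (480 ^ 2 * 24 * W) := by
    have : Real.exp (-s₁ / 2) ≤ e := Real.exp_le_exp.2 (by linarith)
    gcongr
  linarith

/-- Given good radii, some pair of nodes in the window is inverted, up to a small probability. -/
theorem GoodRadii.measureReal_no_inversion_le (h : GoodRadii R s₁ η k m W s₂ N V T K r)
    (hK : 2 * K < m) (hδ : 5 * Real.exp (-s₂ / 2) ≤ 1 / 4) {τ : ℕ} (hτ : 0 < τ) :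
    (Measure.pi fun _ : Fin n => angularLaw).real
      {θ | ¬ ∃ a b, s₂ ≤ r a ∧ r a < r b ∧ r b < s₂ + 1 ∧
        polarDeg R r θ a < polarDeg R r θ b} ≤
      (1 / 2) ^ K + K * (2 * (5 * Real.exp (-s₂ / 2)) + (2 * (2 * K + τ) + 1) /
        √((m - 2 * K) * (Real.exp (-(s₂ + 1) / 2) / 480) / 2) + 2 * (T / τ)) := by
  classical
  obtain ⟨x, y, hpair, hxy, hxx, hyy⟩ := h.pairs
  have hr0 : ∀ i, 0 < r i := fun i => by linarith [(h.inside i).1]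
  have hrR : ∀ i, r i ≤ R := fun i => (h.inside i).2.le
  set U := (Finset.range K).image x ∪ (Finset.range K).image y with hU
  set Z := Finset.univ \ U with hZ
  have hUcard : (U.card : ℝ) ≤ 2 * K := by
    have h1 := Finset.card_image_le (s := Finset.range K) (f := x)
    have h2 := Finset.card_image_le (s := Finset.range K) (f := y)
    rw [Finset.card_range] at h1 h2
    have : U.card ≤ 2 * K := (Finset.card_union_le _ _).trans (by omega)
    exact_mod_cast this
  have hsub : {θ : Fin n → ℝ | ¬ ∃ a b, s₂ ≤ r a ∧ r a < r b ∧ r b < s₂ + 1 ∧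
      polarDeg R r θ a < polarDeg R r θ b} ⊆
      {θ | ∀ l < K, polarDeg R r θ (y l) ≤ polarDeg R r θ (x l)} := by
    intro θ hθ l hl
    by_contra hlt
    obtain ⟨h1, h2, h3, -⟩ := hpair l hl
    exact hθ ⟨x l, y l, h1, h2, h3, not_le.1 hlt⟩
  refine (measureReal_mono hsub (measure_ne_top _ _)).trans ?_
  refine RHG.measureReal_no_inversion_le hr0 hrR (fun l hl => (hpair l hl).2.1.le) hxy hxx hyy
    (Z := Z) hZ fun l hl => ?_
  obtain ⟨h1, h2, h3, h4⟩ := hpair l hl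
  have hxU : x l ∈ U :=
    Finset.mem_union_left _ (Finset.mem_image_of_mem _ (Finset.mem_range.2 hl))
  have hyU : y l ∈ U :=
    Finset.mem_union_right _ (Finset.mem_image_of_mem _ (Finset.mem_range.2 hl))
  set J := (Finset.univ.filter fun z => R - 1 ≤ r z) \ U with hJ
  have hJ1 : ∀ z ∈ J, R - 1 ≤ r z := fun z hz => by
    rw [hJ, Finset.mem_sdiff, Finset.mem_filter] at hz
    exact hz.1.2
  have hJcard : m - 2 * K ≤ (J.card : ℝ) := by
    have h5 := card_sdiff_ge (Finset.univ.filter fun z => R - 1 ≤ r z) U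
    have h6 := h.boundary
    linarith
  refine measureReal_not_separated_le hr0 hrR (hr0 _) h2.le (hxy l hl l hl) (J := J)
    (Finset.sdiff_subset_sdiff (Finset.subset_univ _) subset_rfl) (by simp [hxU])
    (by simp [hyU]) ?_ hδ (A := (m - 2 * K) * (Real.exp (-(s₂ + 1) / 2) / 480)) ?_ ?_
    ?_ K hτ
  · intro z hz
    have hz1 := hJ1 z hz
    refine (arc_le (by linarith [(h.inside (y l)).1]) (by linarith [(h.inside z).1])
      ((hr0 z).le.trans (hrR z))).trans ?_
    have e1 : Real.exp ((R - r (y l) - r z) / 2) ≤ Real.exp (1 / 2 + -s₂ / 2) :=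
      Real.exp_le_exp.2 (by linarith)
    have e2 : Real.exp (1 / 2 : ℝ) ≤ 5 / 3 := by
      have e3 : Real.exp (1 / 2 : ℝ) ^ 2 = Real.exp 1 := by
        rw [← Real.exp_nat_mul]; norm_num
      have := Real.exp_one_lt_d9
      refine (pow_le_pow_iff_left₀ (Real.exp_pos _).le (by norm_num) two_ne_zero).1 ?_
      rw [e3]
      norm_num
      linarith
    rw [Real.exp_add] at e1
    nlinarith [Real.exp_pos (-s₂ / 2)]
  · have : 0 < m - 2 * K := by linarith
    positivity
  · calc _ ≤ J.card * (Real.exp (-(s₂ + 1) / 2) / 480) := by gcongr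
      _ ≤ _ := by
          rw [← nsmul_eq_mul]
          refine Finset.card_nsmul_le_sum _ _ _ fun z hz => ?_
          -- The adjacency probability is bounded from below by its drop over a unit of radius.
          have e1 := sub_arc_ge (h.inside (y l)).1 (hrR (y l)) zero_le_one le_rfl (hrR z)
            (hJ1 z hz)
          have e2 : Real.exp (-(s₂ + 1) / 2) ≤ Real.exp (-r (y l) / 2) :=
            Real.exp_le_exp.2 (by linarith)
          have e3 := arc_nonneg R (r (y l) + 1) (r z)
          linarith
  · refine le_trans (Finset.sum_le_sum_of_subset_of_nonneg ?_ fun z _ _ => ?_) h4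
    · refine Finset.sdiff_subset_sdiff subset_rfl fun z hz => ?_
      rw [Finset.mem_insert, Finset.mem_singleton] at hz
      rcases hz with rfl | rfl <;> assumption
    · have := arc_anti (hr0 (x l)) h2.le (hr0 z) (hrR z)
      linarith

end Good

section Order

variable {n : ℕ} {r : Fin n → ℝ} {σ : Equiv.Perm (Fin n)}

open Classical in
theorem card_radius_lt_le (hσ : Monotone fun i => r (σ i)) {s : ℝ} {i : Fin n}
    (hi : s ≤ r (σ i)) : (Finset.univ.filter fun z => r z < s).card ≤ (i : ℕ) := by
  have hsub : (Finset.univ.filter fun z => r z < s) ⊆ (Finset.Iio i).image σ := by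
    intro z hz
    rw [Finset.mem_filter] at hz
    refine Finset.mem_image.2 ⟨σ.symm z, ?_, by simp⟩
    rw [Finset.mem_Iio]
    by_contra hle
    have := hσ (not_lt.1 hle)
    simp only [Equiv.apply_symm_apply] at this
    linarith [hz.2]
  have h1 := (Finset.card_le_card hsub).trans Finset.card_image_le
  rwa [Fin.card_Iio] at h1

open Classical in
/-- The index `i` stands for the rank `i + 1`. -/
theorem radius_lt_of_rank_le (hσ : Monotone fun i => r (σ i)) {s k : ℝ}
    (hk : k ≤ (Finset.univ.filter fun z => r z < s).card) {i : Fin n}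
    (hi : ((i : ℕ) + 1 : ℝ) ≤ k) : r (σ i) < s := by
  by_contra hge
  have h2 : ((Finset.univ.filter fun z => r z < s).card : ℝ) ≤ (i : ℕ) := by
    exact_mod_cast card_radius_lt_le hσ (not_lt.1 hge)
  linarith

open Classical in
/-- An inversion between two nodes of the window forces one between nodes of consecutive ranks. -/
theorem exists_consecutive_inversion (hσ : Monotone fun i => r (σ i)) (d : Fin n → ℕ)
    {s s' N V : ℝ} (hN : N ≤ (Finset.univ.filter fun z => r z < s).card)
    (hV : ((Finset.univ.filter fun z => r z < s').card : ℝ) ≤ V) {a b : Fin n} (ha : s ≤ r a)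
    (hab : r a < r b) (hb : r b < s') (hd : d a < d b) :
    ∃ i j : Fin n, (j : ℕ) = i + 1 ∧ ((i : ℕ) + 1 : ℝ) ∈ Set.Icc N V ∧ d (σ i) < d (σ j) := by
  set i₀ := σ.symm a with hi₀
  set j₀ := σ.symm b with hj₀
  have hij : i₀ < j₀ := by
    by_contra hle
    have := hσ (not_lt.1 hle)
    simp only [hi₀, hj₀, Equiv.apply_symm_apply] at this
    linarith
  have hlow : N ≤ (i₀ : ℕ) := by
    refine hN.trans ?_
    exact_mod_cast card_radius_lt_le hσ (i := i₀) (by simpa [hi₀] using ha)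
  have hupp : ((j₀ : ℕ) + 1 : ℝ) ≤ V := by
    refine le_trans ?_ hV
    have hsub : (Finset.Iic j₀).image σ ⊆ Finset.univ.filter fun z => r z < s' := by
      intro z hz
      obtain ⟨i, hi, rfl⟩ := Finset.mem_image.1 hz
      rw [Finset.mem_Iic] at hi
      have := hσ hi
      simp only [hj₀, Equiv.apply_symm_apply] at this
      simp only [Finset.mem_filter, Finset.mem_univ, true_and]
      linarith
    have h1 := Finset.card_le_card hsub
    rw [Finset.card_image_of_injective _ σ.injective, Fin.card_Iic] at h1
    exact_mod_cast h1
  by_contra hno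
  push Not at hno
  -- Without consecutive inversions the degrees do not increase from `a` to `b`.
  have key : ∀ t : ℕ, ∀ ht : (i₀ : ℕ) + t < n, (i₀ : ℕ) + t ≤ j₀ → d (σ ⟨i₀ + t, ht⟩) ≤ d a := by
    intro t
    induction t with
    | zero => intro ht _; simp [hi₀]
    | succ t ih =>
      intro ht hle
      have h1 := ih (by omega) (by omega)
      refine (hno ⟨i₀ + t, by omega⟩ ⟨i₀ + (t + 1), ht⟩ (by simp; omega) ⟨?_, ?_⟩).trans h1
      · push_cast
        have : (0 : ℝ) ≤ (t : ℝ) := by positivity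
        linarith
      · have : ((i₀ : ℕ) : ℝ) + (t + 1) ≤ (j₀ : ℕ) := by exact_mod_cast hle
        push_cast
        linarith
  have hlt : (i₀ : ℕ) < j₀ := hij
  have h2 := key (j₀ - i₀) (by have := j₀.2; omega) (by omega)
  have h3 : (⟨(i₀ : ℕ) + (j₀ - i₀), by have := j₀.2; omega⟩ : Fin n) = j₀ := by
    ext; simp; omega
  rw [h3, hj₀, Equiv.apply_symm_apply] at h2
  omega

end Order

/-! ### From polar coordinates to the graph -/

theorem hypDist_nonneg (z w : Complex.UnitDisc) : 0 ≤ hypDist z w := by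
  unfold hypDist
  have : 0 ≤ Real.arsinh (‖(z : ℂ) - (w : ℂ)‖ /
      √((1 - ‖(z : ℂ)‖ ^ 2) * (1 - ‖(w : ℂ)‖ ^ 2))) :=
    Real.arsinh_nonneg_iff.2 (by positivity)
  linarith

theorem hypDist_ofPolar_le_iff {R : ℝ} (hR : 0 ≤ R) (r θ s φ : ℝ) :
    hypDist (ofPolar (r, θ)) (ofPolar (s, φ)) ≤ R ↔ Near R r θ s φ := by
  rw [Near, ← cosh_hypDist_ofPolar, Real.cosh_le_cosh, abs_of_nonneg (hypDist_nonneg _ _),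
    abs_of_nonneg hR]

theorem radius_ofPolar {r : ℝ} (hr : 0 ≤ r) (θ : ℝ) : radius (ofPolar (r, θ)) = r := by
  have h0 : ofPolar (0, 0) = 0 := by
    apply Complex.UnitDisc.coe_injective
    simp [ofPolar]
  have h1 := cosh_hypDist_ofPolar r θ 0 0
  rw [h0] at h1
  simp only [Real.cosh_zero, Real.sinh_zero, mul_one, mul_zero, zero_mul, sub_zero] at h1
  have h2 := hypDist_nonneg (ofPolar (r, θ)) 0
  have h3 : |hypDist (ofPolar (r, θ)) 0| = |r| :=
    le_antisymm (Real.cosh_le_cosh.1 h1.le) (Real.cosh_le_cosh.1 h1.ge)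
  rwa [abs_of_nonneg h2, abs_of_nonneg hr] at h3

theorem deg_ofPolar {ν : ℝ} {n : ℕ} (hR : 0 ≤ discRadius ν n) (r θ : Fin n → ℝ) (i : Fin n) :
    (deg ν (fun j => ofPolar (r j, θ j)) i : ℤ) = polarDeg (discRadius ν n) r θ i := by
  classical
  unfold deg polarDeg nearCount adj
  rw [← SimpleGraph.card_neighborFinset_eq_degree, Finset.sum_ite, Finset.sum_const_zero, add_zero,
    Finset.sum_const, nsmul_eq_mul, mul_one]
  congr 2
  ext j
  simp only [SimpleGraph.mem_neighborFinset, Finset.mem_filter, Finset.mem_erase, Finset.mem_univ,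
    and_true]
  change (i ≠ j ∧ hypDist _ _ ≤ _) ↔ _
  rw [hypDist_ofPolar_le_iff hR, ne_comm]

theorem measurable_coe_unitDisc : Measurable fun z : Complex.UnitDisc => (z : ℂ) :=
  Complex.UnitDisc.isEmbedding_coe.continuous.measurable

theorem measurable_hypDist {X : Type*} [MeasurableSpace X] {f g : X → Complex.UnitDisc}
    (hf : Measurable f) (hg : Measurable g) : Measurable fun x => hypDist (f x) (g x) := by
  have hf' := measurable_coe_unitDisc.comp hf
  have hg' := measurable_coe_unitDisc.comp hg
  refine Measurable.const_mul (Real.continuous_arsinh.measurable.comp (Measurable.div ?_ ?_)) 2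
  · exact (hf'.sub hg').norm
  · exact Real.continuous_sqrt.measurable.comp
      (((hf'.norm.pow_const 2).const_sub 1).mul ((hg'.norm.pow_const 2).const_sub 1))

theorem measurable_deg (ν : ℝ) {n : ℕ} (i : Fin n) :
    Measurable fun x : Fin n → Complex.UnitDisc => deg ν x i := by
  classical
  have e : (fun x : Fin n → Complex.UnitDisc => deg ν x i) = fun x =>
      ∑ j, if i ≠ j ∧ hypDist (x i) (x j) ≤ discRadius ν n then 1 else 0 := by
    funext x
    unfold deg
    rw [← SimpleGraph.card_neighborFinset_eq_degree, Finset.sum_ite, Finset.sum_const_zero,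
      add_zero, Finset.sum_const, smul_eq_mul, mul_one]
    congr 1
    ext j
    simp only [SimpleGraph.mem_neighborFinset, Finset.mem_filter, Finset.mem_univ, true_and]
    rfl
  rw [e]
  refine Finset.measurable_sum _ fun j _ => Measurable.ite ?_ measurable_const measurable_const
  exact (MeasurableSet.const _).inter
    (measurableSet_le (measurable_hypDist (measurable_pi_apply i) (measurable_pi_apply j))
      measurable_const)

theorem measurableSet_goodEvent (ν : ℝ) (n : ℕ) (a k b : ℝ) :
    MeasurableSet {x : Fin n → Complex.UnitDisc | ∀ σ : Equiv.Perm (Fin n), IsRadialOrder x σ →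
      DegreesOrderedUpTo ν x σ k ∧ HasInversionIn ν x σ a b} := by
  have hrad : ∀ i : Fin n, Measurable fun x : Fin n → Complex.UnitDisc => radius (x i) := fun i =>
    measurable_hypDist (measurable_pi_apply i) measurable_const
  simp only [IsRadialOrder, DegreesOrderedUpTo, HasInversionIn, Monotone]
  have hlt : ∀ i j : Fin n, Measurable fun x : Fin n → Complex.UnitDisc => deg ν x i < deg ν x j :=
    fun i j => measurableSet_setOfPred.1
      (measurableSet_lt (measurable_deg ν i) (measurable_deg ν j))
  have hle : ∀ i j : Fin n,
      Measurable fun x : Fin n → Complex.UnitDisc => radius (x i) ≤ radius (x j) :=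
    fun i j => measurableSet_setOfPred.1 (measurableSet_le (hrad i) (hrad j))
  refine measurableSet_setOfPred.2 (Measurable.forall fun σ =>
    Measurable.imp ?_ (Measurable.and ?_ ?_))
  · exact Measurable.forall fun i => Measurable.forall fun j =>
      Measurable.imp measurable_const (hle _ _)
  · exact Measurable.forall fun i => Measurable.forall fun j =>
      Measurable.imp measurable_const (Measurable.imp measurable_const (hlt _ _))
  · exact Measurable.exists fun i => Measurable.exists fun j =>
      Measurable.and measurable_const (Measurable.and measurable_const (hlt _ _))

/-- The law of the nodes is that of points with independent radii and angles: all radii first, then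
all angles. -/
theorem nodesLaw_real_eq {α ν : ℝ} {n : ℕ} (hα : 1 / 2 < α) (hR : 2 ≤ discRadius ν n)
    {S : Set (Fin n → Complex.UnitDisc)} (hS : MeasurableSet S) :
    (nodesLaw α ν n).real S =
      ((Measure.pi fun _ : Fin n => radialLaw α ν n).prod
        (Measure.pi fun _ : Fin n => angularLaw)).real
        {p | (fun i => ofPolar (p.1 i, p.2 i)) ∈ S} := by
  have := isProbabilityMeasure_radialLaw hα hR
  have hprob : IsProbabilityMeasure (((radialLaw α ν n).prod angularLaw).map ofPolar) :=
    Measure.isProbabilityMeasure_map measurable_ofPolar.aemeasurable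
  have h1 := Measure.pi_map_pi (ι := Fin n) (μ := fun _ => (radialLaw α ν n).prod angularLaw)
    (f := fun _ => ofPolar) (hμ := fun _ => inferInstance)
    fun _ => measurable_ofPolar.aemeasurable
  have h2 := measurePreserving_arrowProdEquivProdArrow ℝ ℝ (Fin n)
    (fun _ => radialLaw α ν n) fun _ => angularLaw
  have hm1 : Measurable fun (p : Fin n → ℝ × ℝ) i => ofPolar (p i) :=
    measurable_pi_lambda _ fun i => measurable_ofPolar.comp (measurable_pi_apply i)
  have hm2 : Measurable fun (p : (Fin n → ℝ) × (Fin n → ℝ)) i => ofPolar (p.1 i, p.2 i) :=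
    measurable_pi_lambda _ fun i => measurable_ofPolar.comp
      (((measurable_pi_apply i).comp measurable_fst).prodMk
        ((measurable_pi_apply i).comp measurable_snd))
  unfold nodesLaw nodeLaw
  rw [← h1, map_measureReal_apply hm1 hS]
  exact h2.measureReal_preimage (s := {p : (Fin n → ℝ) × (Fin n → ℝ) |
    (fun i => ofPolar (p.1 i, p.2 i)) ∈ S}) (hm2 hS).nullMeasurableSet

/-- A bound for the probability of an event, given that the radii are typical. -/
theorem measureReal_prod_le_add {X Y : Type*} [MeasurableSpace X] [MeasurableSpace Y]
    (μ : Measure X) (κ : Measure Y) [IsProbabilityMeasure μ] [IsProbabilityMeasure κ]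
    {E : Set (X × Y)} (hE : MeasurableSet E) {G : X → Prop} {c : ℝ} (hc : 0 ≤ c)
    (h : ∀ x, G x → κ.real {y | (x, y) ∈ E} ≤ c) :
    (μ.prod κ).real E ≤ μ.real {x | ¬ G x} + c := by
  rw [measureReal_prod_eq_integral μ κ hE]
  -- The event `¬ G` need not be measurable.
  set B := toMeasurable μ {x | ¬ G x} with hB
  have hBm : MeasurableSet B := measurableSet_toMeasurable _ _
  have hBr : μ.real B = μ.real {x | ¬ G x} := by
    rw [measureReal_def, measureReal_def, hB, measure_toMeasurable]
  calc _ ≤ ∫ x, (B.indicator (fun _ => (1 : ℝ)) x + c) ∂μ := by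
        refine integral_mono_of_nonneg (ae_of_all _ fun _ => measureReal_nonneg)
          (((integrable_const _).indicator hBm).add (integrable_const _)) (ae_of_all _ fun x => ?_)
        by_cases hx : G x
        · have h1 : 0 ≤ B.indicator (fun _ => (1 : ℝ)) x :=
            Set.indicator_nonneg (fun _ _ => zero_le_one) x
          have h2 := h x hx
          change κ.real {y | (x, y) ∈ E} ≤ _
          linarith
        · have hxB : x ∈ B := subset_toMeasurable μ {x | ¬ G x} hx
          simp only [Set.indicator_of_mem hxB]
          have : κ.real (Prod.mk x ⁻¹' E) ≤ 1 := measureReal_le_one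
          linarith
    _ = _ := by
        rw [integral_add ((integrable_const _).indicator hBm) (integrable_const _),
          integral_indicator_const _ hBm, hBr]
        simp

/-- For good radii the event of the theorem has a large conditional probability. -/
theorem GoodRadii.measureReal_notMem_le {ν : ℝ} {n : ℕ} {s₁ η k m W s₂ N V T : ℝ} {K : ℕ}
    {r : Fin n → ℝ} (h : GoodRadii (discRadius ν n) s₁ η k m W s₂ N V T K r)
    (hR : 0 ≤ discRadius ν n) (hη0 : 0 ≤ η) (hη1 : η ≤ 1) (hm : 2 ≤ m) (hW : m ≤ W)
    (hK : 2 * K < m) (hδ : 5 * Real.exp (-s₂ / 2) ≤ 1 / 4) {τ : ℕ} (hτ : 0 < τ) :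
    (Measure.pi fun _ : Fin n => angularLaw).real
      {θ | (fun i => ofPolar (r i, θ i)) ∉ {x : Fin n → Complex.UnitDisc |
        ∀ σ : Equiv.Perm (Fin n), IsRadialOrder x σ →
          DegreesOrderedUpTo ν x σ k ∧ HasInversionIn ν x σ N V}} ≤
      n ^ 2 * Real.exp (-(Real.exp (-s₁ / 2) * (η * (m - 2)) ^ 2 / (480 ^ 2 * 24 * W))) +
        ((1 / 2) ^ K + K * (2 * (5 * Real.exp (-s₂ / 2)) + (2 * (2 * K + τ) + 1) /
          √((m - 2 * K) * (Real.exp (-(s₂ + 1) / 2) / 480) / 2) + 2 * (T / τ))) := by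
  classical
  set R := discRadius ν n with hRdef
  set P := Measure.pi fun _ : Fin n => angularLaw with hP
  set c₁ := Real.exp (-(Real.exp (-s₁ / 2) * (η * (m - 2)) ^ 2 / (480 ^ 2 * 24 * W))) with hc₁
  set D : Fin n × Fin n → Set (Fin n → ℝ) := fun p =>
    if p.1 ≠ p.2 ∧ r p.1 < s₁ ∧ r p.1 ≤ r p.2 then
      {θ | polarDeg R r θ p.1 ≤ polarDeg R r θ p.2} else ∅ with hD
  set I : Set (Fin n → ℝ) := {θ | ¬ ∃ a b, s₂ ≤ r a ∧ r a < r b ∧ r b < s₂ + 1 ∧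
        polarDeg R r θ a < polarDeg R r θ b} with hI
  have hDle : P.real (⋃ p ∈ (Finset.univ : Finset (Fin n × Fin n)), D p) ≤ n ^ 2 * c₁ := by
    refine (measureReal_biUnion_finset_le _ _).trans ?_
    refine (Finset.sum_le_card_nsmul _ _ c₁ fun p _ => ?_).trans (le_of_eq ?_)
    · simp only [hD]
      split_ifs with hp
      · exact h.measureReal_polarDeg_le hη0 hη1 hm hW hp.1 hp.2.1 hp.2.2
      · rw [measureReal_empty]
        exact (Real.exp_pos _).le
    · simp [sq]
  have hIle := h.measureReal_no_inversion_le hK hδ hτ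
  refine (measureReal_mono (s₂ := (⋃ p ∈ (Finset.univ : Finset (Fin n × Fin n)), D p) ∪ I) ?_
    (measure_ne_top _ _)).trans ((measureReal_union_le _ _).trans (add_le_add hDle hIle))
  intro θ hθ
  by_contra hnot
  simp only [Set.mem_union, not_or] at hnot
  obtain ⟨hn1, hn2⟩ := hnot
  refine hθ fun σ hσ => ?_
  have hr0 : ∀ i, 0 ≤ r i := fun i => by linarith [(h.inside i).1]
  have hσ' : Monotone fun i => r (σ i) := by
    intro i j hij
    have := hσ hij
    simpa only [radius_ofPolar (hr0 _)] using this
  have hdeg : ∀ i j, deg ν (fun i => ofPolar (r i, θ i)) i < deg ν (fun i => ofPolar (r i, θ i)) j ↔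
      polarDeg R r θ i < polarDeg R r θ j := fun i j => by
    rw [← deg_ofPolar hR, ← deg_ofPolar hR, Nat.cast_lt]
  constructor
  · intro i j hi hij
    rw [hdeg]
    by_contra hge
    refine hn1 (Set.mem_biUnion (Finset.mem_univ (σ i, σ j)) ?_)
    simp only [hD]
    rw [if_pos ⟨fun he => hij.ne (σ.injective he), radius_lt_of_rank_le hσ' h.lowRank hi,
      hσ' hij.le⟩]
    exact not_lt.1 hge
  · simp only [hI, Set.mem_ofPred_eq, not_not] at hn2
    obtain ⟨a, b, ha, hab, hb, hd⟩ := hn2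
    exact exists_consecutive_inversion hσ' (deg ν (fun i => ofPolar (r i, θ i)))
      h.rankLower h.rankUpper ha hab hb ((hdeg a b).2 hd)

/-! ### Typical behaviour of the radii -/

section RadialEvents

variable {α ν : ℝ} {n : ℕ}

/-- The probability that some coordinate falls outside `B`. -/
theorem measureReal_exists_notMem_le {ι Ω : Type*} [Fintype ι] [MeasurableSpace Ω] (μ : Measure Ω)
    [IsProbabilityMeasure μ] {B : Set Ω} (hB : MeasurableSet B) :
    (Measure.pi fun _ : ι => μ).real {ω | ∃ i, ω i ∉ B} ≤ Fintype.card ι * μ.real Bᶜ := by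
  have e : {ω : ι → Ω | ∃ i, ω i ∉ B} = ⋃ i ∈ (Finset.univ : Finset ι), {ω | ω i ∈ Bᶜ} := by
    ext ω
    simp
  rw [e]
  refine (measureReal_biUnion_finset_le _ _).trans ?_
  refine (Finset.sum_le_card_nsmul _ _ (μ.real Bᶜ) fun i _ =>
    (measureReal_pi_eval μ i hB.compl).le).trans ?_
  simp

/-- The union bound over pairs of coordinates. -/
theorem measureReal_exists_pair_le {ι Ω : Type*} [Fintype ι] [MeasurableSpace Ω] (μ : Measure Ω)
    [IsProbabilityMeasure μ] {B : Set Ω} (hB : MeasurableSet B) {E : Set (Ω × Ω)}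
    (hE : MeasurableSet E) {c : ℝ} (hc0 : 0 ≤ c) (hc : ∀ x ∈ B, μ.real {y | (x, y) ∈ E} ≤ c) :
    (Measure.pi fun _ : ι => μ).real {ω | ∃ i j, i ≠ j ∧ ω i ∈ B ∧ (ω i, ω j) ∈ E} ≤
      Fintype.card ι ^ 2 * (μ.real B * c) := by
  classical
  set D : ι × ι → Set (ι → Ω) := fun p =>
    if p.1 ≠ p.2 then {ω | ω p.1 ∈ B ∧ (ω p.1, ω p.2) ∈ E} else ∅ with hD
  have hsub : {ω : ι → Ω | ∃ i j, i ≠ j ∧ ω i ∈ B ∧ (ω i, ω j) ∈ E} ⊆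
      ⋃ p ∈ (Finset.univ : Finset (ι × ι)), D p := by
    rintro ω ⟨i, j, hij, hω⟩
    refine Set.mem_biUnion (Finset.mem_univ (i, j)) ?_
    simp only [hD]
    rw [if_pos hij]
    exact hω
  refine (measureReal_mono hsub (measure_ne_top _ _)).trans
    ((measureReal_biUnion_finset_le _ _).trans ?_)
  refine (Finset.sum_le_card_nsmul _ _ (μ.real B * c) fun p _ => ?_).trans (le_of_eq ?_)
  · simp only [hD]
    split_ifs with hp
    · exact measureReal_pi_pair_le μ hp hB hE hc
    · rw [measureReal_empty]
      positivity
  · simp [sq]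

theorem measureReal_not_inside_le (hα : 1 / 2 < α) (hR : 6 ≤ discRadius ν n) :
    (Measure.pi fun _ : Fin n => radialLaw α ν n).real
      {r | ∃ i, r i ∉ Set.Ico 6 (discRadius ν n)} ≤
      n * (8 * Real.exp (-α * (discRadius ν n - 6))) := by
  have hR2 : 2 ≤ discRadius ν n := by linarith
  have := isProbabilityMeasure_radialLaw hα hR2
  refine (measureReal_exists_notMem_le _ measurableSet_Ico).trans ?_
  rw [Fintype.card_fin]
  refine mul_le_mul_of_nonneg_left ?_ (by positivity)
  have hsub : (Set.Ico 6 (discRadius ν n))ᶜ ⊆ Set.Iio 6 ∪ (Set.Ico 0 (discRadius ν n))ᶜ := by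
    intro x hx
    by_cases h : x < 6
    · exact Or.inl h
    · refine Or.inr fun h2 => hx ⟨not_lt.1 h, h2.2⟩
  refine (measureReal_mono hsub (measure_ne_top _ _)).trans ((measureReal_union_le _ _).trans ?_)
  have h0 : (radialLaw α ν n).real (Set.Ico 0 (discRadius ν n))ᶜ = 0 := by
    simp [measureReal_def, radialLaw_compl]
  rw [h0, add_zero]
  exact radialLaw_real_Iio_le hα hR2 (by norm_num) hR

theorem measureReal_moment_ge_le (hα : 1 / 2 < α) (hR : 2 ≤ discRadius ν n) {W : ℝ} (hW : 0 < W) :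
    (Measure.pi fun _ : Fin n => radialLaw α ν n).real
      {r | W ≤ ∑ z, Real.exp ((discRadius ν n - r z) / 2)} ≤
      n * (4 * α / (α - 1 / 2)) / W := by
  have := isProbabilityMeasure_radialLaw hα hR
  refine (measureReal_sum_ge_le (radialLaw α ν n) Finset.univ (integrable_exp_radialLaw hα hR)
    (ae_of_all _ fun x => (Real.exp_pos _).le) hW).trans ?_
  rw [Finset.card_univ, Fintype.card_fin]
  have := integral_exp_radialLaw_le hα hR
  gcongr

theorem measureReal_gap_le (hα : 1 / 2 < α) (hR : 2 ≤ discRadius ν n) {s η : ℝ} (hs : 0 ≤ s)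
    (hsR : s ≤ discRadius ν n) (hη0 : 0 ≤ η) (hη1 : η ≤ 1) :
    (Measure.pi fun _ : Fin n => radialLaw α ν n).real
      {r | ∃ i j, i ≠ j ∧ r i < s ∧ r i ≤ r j ∧ r j < r i + η} ≤
      n ^ 2 * (8 * Real.exp (-α * (discRadius ν n - s)) *
        (4 * α * Real.exp (-α * (discRadius ν n - (s + 1))) * η)) := by
  have := isProbabilityMeasure_radialLaw hα hR
  have hα0 : 0 < α := by linarith
  set E : Set (ℝ × ℝ) := {p | p.1 ≤ p.2 ∧ p.2 < p.1 + η} with hE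
  have hEm : MeasurableSet E := (measurableSet_le measurable_fst measurable_snd).inter
    (measurableSet_lt measurable_snd (measurable_fst.add_const η))
  have h := measureReal_exists_pair_le (ι := Fin n) (radialLaw α ν n) (B := Set.Iio s)
    measurableSet_Iio hEm
    (c := 4 * α * Real.exp (-α * (discRadius ν n - (s + 1))) * η) (by positivity) fun x hx => by
      refine radialLaw_real_Ico_le hα hR hη0 ?_
      have : x < s := hx
      linarith
  rw [Fintype.card_fin] at h
  refine h.trans ?_
  have := radialLaw_real_Iio_le hα hR hs hsR
  gcongr

theorem measureReal_not_injective (hα : 1 / 2 < α) (hR : 2 ≤ discRadius ν n) :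
    (Measure.pi fun _ : Fin n => radialLaw α ν n).real {r | ∃ i j, i ≠ j ∧ r i = r j} ≤ 0 := by
  have := isProbabilityMeasure_radialLaw hα hR
  have h := measureReal_exists_pair_le (ι := Fin n) (radialLaw α ν n) (B := Set.univ)
    MeasurableSet.univ (E := {p | p.1 = p.2}) (measurableSet_eq_fun measurable_fst measurable_snd)
    (c := 0) le_rfl fun x _ => by
      have : {y | (x, y) ∈ {p : ℝ × ℝ | p.1 = p.2}} = {x} := by
        ext y
        simp [eq_comm]
      rw [this, radialLaw_real_singleton]
  simpa using h

open Classical in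
theorem measureReal_card_Iio_lt (hα : 1 / 2 < α) (hR : 2 ≤ discRadius ν n) {s k : ℝ} (hs : 2 ≤ s)
    (hsR : s ≤ discRadius ν n) (hk : k ≤ n * (Real.exp (-α * (discRadius ν n - s)) / 8) / 4) :
    (Measure.pi fun _ : Fin n => radialLaw α ν n).real
      {r | ((Finset.univ.filter fun z => r z < s).card : ℝ) < k} ≤
      Real.exp (-(n * (Real.exp (-α * (discRadius ν n - s)) / 8) / 4)) := by
  have := isProbabilityMeasure_radialLaw hα hR
  have h := measureReal_card_le (radialLaw α ν n) (Finset.univ : Finset (Fin n))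
    (B := Set.Iio s) measurableSet_Iio (radialLaw_real_Iio_ge hα hR hs hsR)
  rw [Finset.card_univ, Fintype.card_fin] at h
  refine (measureReal_mono (fun r hr => ?_) (measure_ne_top _ _)).trans h
  exact (le_of_lt hr).trans hk

open Classical in
theorem measureReal_card_Iio_gt (hα : 1 / 2 < α) (hR : 2 ≤ discRadius ν n) {s V : ℝ} (hs : 0 ≤ s)
    (hsR : s ≤ discRadius ν n) (hV : 0 < V) :
    (Measure.pi fun _ : Fin n => radialLaw α ν n).real
      {r | V < ((Finset.univ.filter fun z => r z < s).card : ℝ)} ≤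
      n * (8 * Real.exp (-α * (discRadius ν n - s))) / V := by
  have := isProbabilityMeasure_radialLaw hα hR
  have h := measureReal_sum_ge_le (radialLaw α ν n) (Finset.univ : Finset (Fin n))
    (g := (Set.Iio s).indicator fun _ => (1 : ℝ))
    ((integrable_const _).indicator measurableSet_Iio)
    (ae_of_all _ fun x => Set.indicator_nonneg (fun _ _ => zero_le_one) x) hV
  rw [Finset.card_univ, Fintype.card_fin, integral_indicator_const _ measurableSet_Iio, smul_eq_mul,
    mul_one] at h
  refine (measureReal_mono (fun r hr => ?_) (measure_ne_top _ _)).trans (h.trans ?_)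
  · have e : ∑ z, (Set.Iio s).indicator (fun _ => (1 : ℝ)) (r z) =
        ((Finset.univ.filter fun z => r z < s).card : ℝ) := by
      simp [Set.indicator_apply]
    change V ≤ _
    rw [e]
    exact le_of_lt hr
  · have := radialLaw_real_Iio_le hα hR hs hsR
    gcongr

open Classical in
theorem measureReal_card_boundary_lt (hα : 1 / 2 < α) (hR : 2 ≤ discRadius ν n) :
    (Measure.pi fun _ : Fin n => radialLaw α ν n).real
      {r | ((Finset.univ.filter fun z => discRadius ν n - 1 ≤ r z).card : ℝ) <
        n * (1 - 1 / Real.cosh α) / 4} ≤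
      Real.exp (-(n * (1 - 1 / Real.cosh α) / 4)) := by
  have := isProbabilityMeasure_radialLaw hα hR
  have h := measureReal_card_le (radialLaw α ν n) (Finset.univ : Finset (Fin n))
    measurableSet_Ico (radialLaw_real_boundary_ge hα hR)
  rw [Finset.card_univ, Fintype.card_fin] at h
  refine (measureReal_mono (fun r hr => ?_) (measure_ne_top _ _)).trans h
  rw [Set.mem_ofPred_eq] at hr
  refine le_trans ?_ hr.le
  refine Nat.cast_le.2 (Finset.card_le_card fun z hz => ?_)
  rw [Finset.mem_filter] at hz ⊢
  exact ⟨hz.1, hz.2.1⟩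

/-- The cells of width `h` from `s` on, which cut the window `[s, s + 1)` into pieces. -/
def cell (s h : ℝ) (c : ℕ) : Set ℝ := Set.Ico (s + c * h) (s + c * h + h)

theorem measurableSet_cell (s h : ℝ) (c : ℕ) : MeasurableSet (cell s h c) := measurableSet_Ico

theorem pairwise_disjoint_cell (s : ℝ) {h : ℝ} (hh : 0 ≤ h) :
    Pairwise (Function.onFun Disjoint (cell s h)) := by
  have key : ∀ c d : ℕ, c < d → Disjoint (cell s h c) (cell s h d) := by
    intro c d hcd
    rw [Set.disjoint_left]
    rintro x ⟨-, hx⟩ ⟨hx', -⟩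
    have h1 : (c : ℝ) + 1 ≤ d := by exact_mod_cast hcd
    nlinarith
  intro c d hcd
  rcases lt_or_gt_of_ne hcd with hlt | hlt
  · exact key c d hlt
  · exact (key d c hlt).symm

theorem cell_bounds {s h : ℝ} (hh : 0 ≤ h) {L c : ℕ} (hL : L * h ≤ 1) (hc : c < L) :
    s ≤ s + c * h ∧ s + c * h + h ≤ s + 1 := by
  have h1 : (c : ℝ) + 1 ≤ L := by exact_mod_cast hc
  have h2 : 0 ≤ (c : ℝ) * h := by positivity
  constructor
  · linarith
  · nlinarith

/-- Two nodes rarely lie in a cell at whose ends the expected degrees, given the other radii, differ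
by `T` or more. Over the cells, the mean differences telescope. -/
theorem measureReal_wide_pair_le (hα : 1 / 2 < α) (hR : 2 ≤ discRadius ν n) {s h T : ℝ} {L : ℕ}
    (hs : 2 ≤ s) (hsR : s + 1 ≤ discRadius ν n) (hh : 0 ≤ h) (hL : L * h ≤ 1) (hT : 0 < T) :
    (Measure.pi fun _ : Fin n => radialLaw α ν n).real
      {r | ∃ i j, i ≠ j ∧ ∃ c < L, r i ∈ cell s h c ∧ r j ∈ cell s h c ∧
        T ≤ ∑ z ∈ Finset.univ \ {i, j},
          (arc (discRadius ν n) (s + c * h) (r z) - arc (discRadius ν n) (s + c * h + h) (r z))} ≤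
      n ^ 3 * (4 * α * Real.exp (-α * (discRadius ν n - (s + 1))) * h) ^ 2 *
        (3 * Real.exp (-s / 2) * (4 * α / (α - 1 / 2))) / T := by
  classical
  have hα0 : 0 < α := by linarith
  have := isProbabilityMeasure_radialLaw hα hR
  set R := discRadius ν n with hRdef
  set lam := radialLaw α ν n with hlam
  set q := 4 * α * Real.exp (-α * (R - (s + 1))) * h with hq
  have hq0 : 0 ≤ q := by positivity
  set g : ℕ → ℝ → ℝ := fun c z => arc R (s + c * h) z - arc R (s + c * h + h) z with hg
  have hgm : ∀ c, Measurable (g c) := fun c => (measurable_arc _ _).sub (measurable_arc _ _)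
  have harci : ∀ ρ, Integrable (arc R ρ) lam := fun ρ =>
    Integrable.of_bound (measurable_arc R ρ).aestronglyMeasurable 1 (ae_of_all _ fun z => by
      rw [Real.norm_eq_abs, abs_of_nonneg (arc_nonneg _ _ _)]
      exact arc_le_one _ _ _)
  have hgi : ∀ c, Integrable (g c) lam := fun c => (harci _).sub (harci _)
  have hg0 : ∀ c, ∀ᵐ z ∂lam, 0 ≤ g c z := fun c => by
    have h0 : ∀ᵐ z ∂lam, z ≠ 0 := by
      rw [ae_iff]
      have h1 := radialLaw_real_singleton α ν n 0
      simpa [measureReal_def, ENNReal.toReal_eq_zero_iff, measure_ne_top] using h1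
    filter_upwards [h0, radialLaw_ae α ν n] with z hz hz'
    have hc : 0 ≤ (c : ℝ) * h := by positivity
    have := arc_anti (R := R) (r := s + c * h) (r' := s + c * h + h) (z := z) (by linarith)
      (by linarith) (lt_of_le_of_ne hz'.1 (Ne.symm hz)) hz'.2.le
    simp only [hg]
    linarith
  set D : Fin n × Fin n → ℕ → Set (Fin n → ℝ) := fun p c =>
    if p.1 ≠ p.2 then {r | r p.1 ∈ cell s h c ∧ r p.2 ∈ cell s h c ∧
      T ≤ ∑ z ∈ Finset.univ \ {p.1, p.2}, g c (r z)} else ∅ with hD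
  have hDle : ∀ p, ∀ c ∈ Finset.range L, (Measure.pi fun _ : Fin n => lam).real (D p c) ≤
      q ^ 2 * n / T * ∫ z, g c z ∂lam := by
    intro p c hc
    have hI : 0 ≤ ∫ z, g c z ∂lam := integral_nonneg_of_ae (hg0 c)
    simp only [hD]
    split_ifs with hp
    · refine (measureReal_pair_and_sum_ge_le lam hp (measurableSet_cell s h c) (hgm c) (hgi c)
        (hg0 c) hT).trans ?_
      have hcq : lam.real (cell s h c) ≤ q :=
        radialLaw_real_Ico_le hα hR hh (cell_bounds hh hL (Finset.mem_range.1 hc)).2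
      rw [Fintype.card_fin]
      calc _ ≤ q * q * (n * (∫ z, g c z ∂lam) / T) := by gcongr
        _ = _ := by ring
    · rw [measureReal_empty]
      positivity
  have htel : ∑ c ∈ Finset.range L, ∫ z, g c z ∂lam ≤
      3 * Real.exp (-s / 2) * (4 * α / (α - 1 / 2)) := by
    rw [← integral_finsetSum _ fun c _ => hgi c]
    have e : ∀ z, ∑ c ∈ Finset.range L, g c z = arc R s z - arc R (s + L * h) z := fun z => by
      have h1 := Finset.sum_range_sub' (fun c : ℕ => arc R (s + c * h) z) L
      simp only [Nat.cast_zero, zero_mul, add_zero] at h1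
      rw [← h1]
      refine Finset.sum_congr rfl fun c _ => ?_
      simp only [hg]
      congr 2
      push_cast
      ring
    refine le_trans (integral_mono (integrable_finsetSum _ fun c _ => hgi c) (harci s) fun z => ?_)
      (integral_arc_le hα hR (by linarith) (by linarith))
    simp only [e]
    linarith [arc_nonneg R (s + L * h) z]
  have hsub : {r : Fin n → ℝ | ∃ i j, i ≠ j ∧ ∃ c < L, r i ∈ cell s h c ∧ r j ∈ cell s h c ∧
        T ≤ ∑ z ∈ Finset.univ \ {i, j}, (arc R (s + c * h) (r z) - arc R (s + c * h + h) (r z))} ⊆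
      ⋃ p ∈ (Finset.univ : Finset (Fin n × Fin n)), ⋃ c ∈ Finset.range L, D p c := by
    rintro r ⟨i, j, hij, c, hc, hr⟩
    refine Set.mem_biUnion (Finset.mem_univ (i, j))
      (Set.mem_biUnion (Finset.mem_range.2 hc) ?_)
    simp only [hD]
    rw [if_pos hij]
    exact hr
  refine (measureReal_mono hsub (measure_ne_top _ _)).trans
    ((measureReal_biUnion_finset_le _ _).trans ?_)
  refine (Finset.sum_le_card_nsmul _ _
    (q ^ 2 * n / T * (3 * Real.exp (-s / 2) * (4 * α / (α - 1 / 2)))) fun p _ => ?_).trans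
    (le_of_eq ?_)
  · refine (measureReal_biUnion_finset_le _ _).trans ((Finset.sum_le_sum (hDle p)).trans ?_)
    rw [← Finset.mul_sum]
    gcongr
  · rw [Finset.card_univ, Fintype.card_prod, Fintype.card_fin, nsmul_eq_mul]
    push_cast
    ring

/-- A block of consecutive labels of nodes. Pairs found in disjoint blocks are disjoint. -/
def labelBlock (n a b : ℕ) : Finset (Fin n) :=
  Finset.univ.filter fun i => a ≤ (i : ℕ) ∧ (i : ℕ) < b

theorem card_labelBlock {n a b : ℕ} (hb : b ≤ n) : (labelBlock n a b).card = b - a := by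
  rw [← Nat.card_Ico, ← Finset.card_map Fin.valEmbedding]
  congr 1
  ext k
  simp only [labelBlock, Finset.mem_map, Finset.mem_filter, Finset.mem_univ, true_and,
    Fin.valEmbedding_apply, Finset.mem_Ico]
  constructor
  · rintro ⟨i, hi, rfl⟩
    exact hi
  · intro hk
    exact ⟨⟨k, by omega⟩, hk, rfl⟩

/-- Among `2 M` nodes, two fall in the same cell, up to a small probability. -/
theorem measureReal_block_no_coincidence_le (hα : 1 / 2 < α) (hR : 2 ≤ discRadius ν n) {s h q : ℝ}
    {L M a : ℕ} (hs : 2 ≤ s) (hsR : s + 1 ≤ discRadius ν n) (hh : 0 ≤ h) (hL : L * h ≤ 1)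
    (ha : a + 2 * M ≤ n) (hq : q = α / 4 * Real.exp (-α * (discRadius ν n - s)) * h) :
    (Measure.pi fun _ : Fin n => radialLaw α ν n).real
      {r | ∀ i ∈ labelBlock n a (a + 2 * M), ∀ j ∈ labelBlock n a (a + 2 * M), i ≠ j →
        ¬ SameCell (cell s h) L (r i) (r j)} ≤
      Real.exp (-(M * (L * q) / 4)) + Real.exp (-(M * (M * (L * q) / 4 * q))) := by
  have := isProbabilityMeasure_radialLaw hα hR
  have hα0 : 0 < α := by linarith
  have hd : Disjoint (labelBlock n a (a + M)) (labelBlock n (a + M) (a + 2 * M)) := by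
    rw [Finset.disjoint_left]
    intro i h1 h2
    simp only [labelBlock, Finset.mem_filter] at h1 h2
    omega
  have hmain := measureReal_no_coincidence_le (radialLaw α ν n) hd (measurableSet_cell s h)
    (pairwise_disjoint_cell s hh) (L := L) (q := q) (by rw [hq]; positivity) fun c hc => by
      obtain ⟨h1, h2⟩ := cell_bounds (s := s) hh hL hc
      refine le_trans ?_ (radialLaw_real_Ico_ge hα hR (hs.trans h1) hh (h2.trans hsR))
      rw [hq]
      have : -α * (discRadius ν n - s) ≤ -α * (discRadius ν n - (s + c * h)) := by nlinarith
      gcongr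
  rw [card_labelBlock (by omega), card_labelBlock (by omega), Nat.add_sub_cancel_left,
    show a + 2 * M - (a + M) = M by omega] at hmain
  refine (measureReal_mono (fun r hr => ?_) (measure_ne_top _ _)).trans hmain
  rw [Set.mem_ofPred_eq] at hr ⊢
  intro i hi j hj
  refine hr i ?_ j ?_
  all_goals
    simp only [labelBlock, Finset.mem_union, Finset.mem_filter, Finset.mem_univ,
      true_and] at hi hj ⊢
    omega

end RadialEvents

theorem measureReal_le_add_of_subset {X : Type*} [MeasurableSpace X] {P : Measure X}
    [IsFiniteMeasure P] {A B C : Set X} {b c : ℝ} (h : A ⊆ B ∪ C) (hB : P.real B ≤ b)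
    (hC : P.real C ≤ c) : P.real A ≤ b + c :=
  (measureReal_mono h (measure_ne_top _ _)).trans
    ((measureReal_union_le _ _).trans (add_le_add hB hC))

/-- The radii are good with high probability. -/
theorem measureReal_not_goodRadii_le {α ν : ℝ} {n : ℕ} (hα : 1 / 2 < α)
    (hR : 6 ≤ discRadius ν n) (hn : 0 < n) {s₁ s₂ η k W N V h q T : ℝ} {K L M : ℕ} (hs₁ : 2 ≤ s₁)
    (hs₁R : s₁ ≤ discRadius ν n) (hs₂ : 2 ≤ s₂) (hs₂R : s₂ + 1 ≤ discRadius ν n) (hη0 : 0 ≤ η)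
    (hη1 : η ≤ 1) (hW : 0 < W)
    (hk : k ≤ n * (Real.exp (-α * (discRadius ν n - s₁)) / 8) / 4)
    (hN : N ≤ n * (Real.exp (-α * (discRadius ν n - s₂)) / 8) / 4) (hV : 0 < V) (hh : 0 ≤ h)
    (hL : L * h ≤ 1) (hT : 0 < T) (hM : 2 * M * K ≤ n)
    (hq : q = α / 4 * Real.exp (-α * (discRadius ν n - s₂)) * h) :
    (Measure.pi fun _ : Fin n => radialLaw α ν n).real
      {r | ¬ GoodRadii (discRadius ν n) s₁ η k (n * (1 - 1 / Real.cosh α) / 4) W s₂ N V T K r} ≤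
      n * (8 * Real.exp (-α * (discRadius ν n - 6))) +
      (Real.exp (-(n * (1 - 1 / Real.cosh α) / 4)) +
      (n * (4 * α / (α - 1 / 2)) / W +
      (Real.exp (-(n * (Real.exp (-α * (discRadius ν n - s₁)) / 8) / 4)) +
      (n ^ 2 * (8 * Real.exp (-α * (discRadius ν n - s₁)) *
        (4 * α * Real.exp (-α * (discRadius ν n - (s₁ + 1))) * η)) +
      (Real.exp (-(n * (Real.exp (-α * (discRadius ν n - s₂)) / 8) / 4)) +
      (n * (8 * Real.exp (-α * (discRadius ν n - (s₂ + 1)))) / V +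
      (n ^ 3 * (4 * α * Real.exp (-α * (discRadius ν n - (s₂ + 1))) * h) ^ 2 *
        (3 * Real.exp (-s₂ / 2) * (4 * α / (α - 1 / 2))) / T +
      K * (Real.exp (-(M * (L * q) / 4)) + Real.exp (-(M * (M * (L * q) / 4 * q))))))))))) := by
  classical
  have hR2 : 2 ≤ discRadius ν n := by linarith
  have := isProbabilityMeasure_radialLaw hα hR2
  set R := discRadius ν n with hRdef
  have hblocks : (Measure.pi fun _ : Fin n => radialLaw α ν n).real
      (⋃ l ∈ Finset.range K, {r : Fin n → ℝ |
        ∀ i ∈ labelBlock n (2 * M * l) (2 * M * l + 2 * M),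
        ∀ j ∈ labelBlock n (2 * M * l) (2 * M * l + 2 * M), i ≠ j →
        ¬ SameCell (cell s₂ h) L (r i) (r j)}) ≤
      K * (Real.exp (-(M * (L * q) / 4)) + Real.exp (-(M * (M * (L * q) / 4 * q)))) := by
    refine (measureReal_biUnion_finset_le _ _).trans ?_
    refine (Finset.sum_le_card_nsmul _ _ _ fun l hl => measureReal_block_no_coincidence_le hα hR2
      hs₂ hs₂R hh hL ?_ hq).trans (by rw [Finset.card_range, nsmul_eq_mul])
    have hl' : l + 1 ≤ K := Finset.mem_range.1 hl
    calc 2 * M * l + 2 * M = 2 * M * (l + 1) := by ring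
      _ ≤ 2 * M * K := Nat.mul_le_mul_left _ hl'
      _ ≤ n := hM
  have hpairs := measureReal_le_add_of_subset subset_rfl (measureReal_not_injective hα hR2)
    (measureReal_le_add_of_subset subset_rfl
      (measureReal_wide_pair_le hα hR2 hs₂ hs₂R hh hL hT) hblocks)
  rw [zero_add] at hpairs
  refine measureReal_le_add_of_subset ?_ (measureReal_not_inside_le hα hR)
    (measureReal_le_add_of_subset subset_rfl (measureReal_card_boundary_lt hα hR2)
    (measureReal_le_add_of_subset subset_rfl (measureReal_moment_ge_le hα hR2 hW)
    (measureReal_le_add_of_subset subset_rfl (measureReal_card_Iio_lt hα hR2 hs₁ hs₁R hk)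
    (measureReal_le_add_of_subset subset_rfl
      (measureReal_gap_le hα hR2 (by linarith) hs₁R hη0 hη1)
    (measureReal_le_add_of_subset subset_rfl
      (measureReal_card_Iio_lt hα hR2 hs₂ (by linarith) hN)
    (measureReal_le_add_of_subset subset_rfl
      (measureReal_card_Iio_gt hα hR2 (by linarith) hs₂R hV)
    hpairs))))))
  intro r hr
  by_contra hnot
  simp only [Set.mem_union, Set.mem_ofPred_eq, not_or, Set.mem_iUnion, not_exists, not_lt, not_le,
    not_and, not_forall, not_not, exists_prop] at hnot
  obtain ⟨h0, h1, h2, h3, h4, h5, h6, h7, h8, h9⟩ := hnot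
  refine hr ⟨h0, h1, h2.le, h3, fun a b hab ha hle => h4 a b hab ha hle, h5, h6, ?_⟩
  have hpair : ∀ l, l < K → ∃ x y : Fin n,
      x ∈ labelBlock n (2 * M * l) (2 * M * l + 2 * M) ∧
      y ∈ labelBlock n (2 * M * l) (2 * M * l + 2 * M) ∧ r x < r y ∧
      SameCell (cell s₂ h) L (r x) (r y) := by
    intro l hl
    obtain ⟨i, hi, j, hj, hij, c, hc, hci, hcj⟩ := h9 l (Finset.mem_range.2 hl)
    rcases lt_or_gt_of_ne (h7 i j hij) with hlt | hlt
    · exact ⟨i, j, hi, hj, hlt, c, hc, hci, hcj⟩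
    · exact ⟨j, i, hj, hi, hlt, c, hc, hcj, hci⟩
  have : Nonempty (Fin n) := ⟨⟨0, hn⟩⟩
  choose! x y hx hy hxy hcell using hpair
  have hblock : ∀ l m : ℕ, ∀ i : Fin n, i ∈ labelBlock n (2 * M * l) (2 * M * l + 2 * M) →
      i ∈ labelBlock n (2 * M * m) (2 * M * m + 2 * M) → l = m := by
    intro l m i h1 h2
    simp only [labelBlock, Finset.mem_filter, Finset.mem_univ, true_and] at h1 h2
    have key : ∀ l m : ℕ, 2 * M * l ≤ (i : ℕ) → (i : ℕ) < 2 * M * m + 2 * M → l ≤ m := by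
      intro l m ha hb
      by_contra hlt
      have h3 : m + 1 ≤ l := by omega
      have := Nat.mul_le_mul_left (2 * M) h3
      rw [mul_add, mul_one] at this
      omega
    exact le_antisymm (key l m h1.1 h2.2) (key m l h2.1 h1.2)
  refine ⟨x, y, fun l hl => ?_, fun l hl m hm he => ?_, fun l hl m hm hlm he => ?_,
    fun l hl m hm hlm he => ?_⟩
  · obtain ⟨c, hc, hcx, hcy⟩ := hcell l hl
    obtain ⟨hb1, hb2⟩ := cell_bounds (s := s₂) hh hL hc
    refine ⟨hb1.trans hcx.1, hxy l hl, hcy.2.trans_le hb2, ?_⟩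
    have hne : x l ≠ y l := fun he => (hxy l hl).ne (by rw [he])
    refine le_trans (Finset.sum_le_sum fun z _ => ?_) (h8 (x l) (y l) hne c hc hcx hcy).le
    have hz0 : 0 < r z := by linarith [(h0 z).1]
    have hzR : r z ≤ R := (h0 z).2.le
    have a1 := arc_anti (R := R) (by linarith) hcx.1 hz0 hzR
    have a2 := arc_anti (R := R) (r := r (y l)) (by linarith [(h0 (y l)).1]) hcy.2.le hz0 hzR
    linarith
  · by_cases hlm : l = m
    · subst hlm
      exact (hxy l hl).ne (by rw [he])
    · exact hlm (hblock l m (x l) (hx l hl) (he ▸ hy m hm))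
  · exact hlm (hblock l m (x l) (hx l hl) (he ▸ hx m hm))
  · exact hlm (hblock l m (y l) (hy l hl) (he ▸ hy m hm))

/-! ### The scales of the theorem -/

/-- The radius below which a number of nodes of order `A` is expected. -/
noncomputable def radiusOfRank (α ν : ℝ) (n : ℕ) (A : ℝ) : ℝ :=
  discRadius ν n - Real.log (n / A) / α

theorem exp_radiusOfRank {α ν A : ℝ} {n : ℕ} (hα : 0 < α) (hn : 0 < n) (hA : 0 < A) :
    Real.exp (-α * (discRadius ν n - radiusOfRank α ν n A)) = A / n := by
  have hn' : (0 : ℝ) < n := by exact_mod_cast hn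
  have h : -α * (discRadius ν n - radiusOfRank α ν n A) = -Real.log (n / A) := by
    unfold radiusOfRank
    field_simp
    ring
  rw [h, Real.exp_neg, Real.exp_log (by positivity), inv_div]

theorem exp_radiusOfRank_add_one {α ν A : ℝ} {n : ℕ} (hα : 0 < α) (hn : 0 < n) (hA : 0 < A) :
    Real.exp (-α * (discRadius ν n - (radiusOfRank α ν n A + 1))) = Real.exp α * (A / n) := by
  rw [← exp_radiusOfRank (ν := ν) hα hn hA, ← Real.exp_add]
  congr 1
  ring

/-- With `n = N ^ (1 + 8 α)`, a node of rank `N a` has expected degree of order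
`N ^ 4 a ^ (-1 / (2 α))`. -/
theorem exp_radiusOfRank_div_two {α ν N a : ℝ} {n : ℕ} (hα : 0 < α) (hν : 0 < ν) (hN : 0 < N)
    (ha : 0 < a) (hn : (n : ℝ) = N ^ (1 + 8 * α)) :
    Real.exp (-radiusOfRank α ν n (N * a) / 2) = ν * N ^ 4 / n * a ^ (-(1 / (2 * α))) := by
  have hn' : (0 : ℝ) < n := hn ▸ Real.rpow_pos_of_pos hN _
  have h1 : (n : ℝ) / (N * a) = N ^ (8 * α) / a := by
    rw [hn, Real.rpow_add hN, Real.rpow_one]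
    field_simp
  have h2 : -radiusOfRank α ν n (N * a) / 2 =
      -Real.log (n / ν) + 4 * Real.log N + -(1 / (2 * α)) * Real.log a := by
    unfold radiusOfRank discRadius
    rw [h1, Real.log_div (Real.rpow_pos_of_pos hN _).ne' ha.ne', Real.log_rpow hN]
    field_simp
    ring
  rw [h2, Real.exp_add, Real.exp_add, Real.exp_neg, Real.exp_log (by positivity), inv_div,
    Real.rpow_def_of_pos ha, mul_comm (Real.log a)]
  have h3 : Real.exp (4 * Real.log N) = N ^ 4 := by
    rw [← Real.exp_log hN, ← Real.exp_nat_mul, Real.exp_log hN]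
    norm_num
  rw [h3]
  ring

theorem exp_radiusOfRank_bounds_of_one_le {α ν N a : ℝ} {n : ℕ} (hα : 1 / 2 < α) (hν : 0 < ν)
    (hN : 0 < N) (ha : 1 ≤ a) (hn : (n : ℝ) = N ^ (1 + 8 * α)) :
    ν * N ^ 4 / n * a⁻¹ ≤ Real.exp (-radiusOfRank α ν n (N * a) / 2) ∧
      Real.exp (-radiusOfRank α ν n (N * a) / 2) ≤ ν * N ^ 4 / n := by
  have hα' : 0 < α := by linarith
  have h1 : 1 / (2 * α) ≤ 1 := by rw [div_le_one (by linarith)]; linarith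
  have h0 : 0 ≤ 1 / (2 * α) := by positivity
  rw [exp_radiusOfRank_div_two hα' hν hN (by linarith) hn]
  constructor
  · rw [← Real.rpow_neg_one a]
    gcongr
  · refine mul_le_of_le_one_right (by positivity) ?_
    exact Real.rpow_le_one_of_one_le_of_nonpos ha (by linarith)

theorem exp_radiusOfRank_bounds_of_le_one {α ν N a : ℝ} {n : ℕ} (hα : 1 / 2 < α) (hν : 0 < ν)
    (hN : 0 < N) (ha0 : 0 < a) (ha : a ≤ 1) (hn : (n : ℝ) = N ^ (1 + 8 * α)) :
    ν * N ^ 4 / n ≤ Real.exp (-radiusOfRank α ν n (N * a) / 2) ∧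
      Real.exp (-radiusOfRank α ν n (N * a) / 2) ≤ ν * N ^ 4 / n * a⁻¹ := by
  have hα' : 0 < α := by linarith
  have h1 : 1 / (2 * α) ≤ 1 := by rw [div_le_one (by linarith)]; linarith
  have h0 : 0 ≤ 1 / (2 * α) := by positivity
  rw [exp_radiusOfRank_div_two hα' hν hN ha0 hn]
  constructor
  · refine le_mul_of_one_le_right (by positivity) ?_
    exact Real.one_le_rpow_of_pos_of_le_one_of_nonpos ha0 ha (by linarith)
  · rw [← Real.rpow_neg_one a]
    refine mul_le_mul_of_nonneg_left ?_ (by positivity)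
    exact Real.rpow_le_rpow_of_exponent_ge ha0 ha (by linarith)

/-- The bound of `measureReal_not_goodRadii_le` for the scales of the theorem: the prefix has
`N / ℓ` nodes, the window has rank of order `N w ^ 4`. -/
theorem measureReal_not_goodRadii_rank_le {α ν : ℝ} {n : ℕ} (hα : 1 / 2 < α) (hν : 0 < ν)
    {N ℓ w v k : ℝ} {K : ℕ} (hnN : (n : ℝ) = N ^ (1 + 8 * α)) (hN : 1 ≤ N) (hw : 32 ≤ w)
    (hwℓ : w ^ 5 ≤ ℓ) (hwv : w ^ 5 ≤ v) (hK : 0 < K) (hKn : 4 * K ≤ n)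
    (hR : 6 ≤ discRadius ν n) (hs₁ : 2 ≤ radiusOfRank α ν n (N * ℓ⁻¹))
    (hs₁R : radiusOfRank α ν n (N * ℓ⁻¹) ≤ discRadius ν n)
    (hs₂ : 2 ≤ radiusOfRank α ν n (N * w ^ 4))
    (hs₂R : radiusOfRank α ν n (N * w ^ 4) + 1 ≤ discRadius ν n)
    (hη : ℓ * w / N ^ 2 ≤ 1) (hk : k ≤ N * ℓ⁻¹ / 32) :
    (Measure.pi fun _ : Fin n => radialLaw α ν n).real
      {r | ¬ GoodRadii (discRadius ν n) (radiusOfRank α ν n (N * ℓ⁻¹)) (ℓ * w / N ^ 2) k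
        (n * (1 - 1 / Real.cosh α) / 4) (n * ℓ) (radiusOfRank α ν n (N * w ^ 4)) N (N * v)
        (N ^ 2 / w ^ 4) K r} ≤
      n * (8 * Real.exp (-α * (discRadius ν n - 6))) +
      (Real.exp (-(n * (1 - 1 / Real.cosh α) / 4)) +
      (4 * α / (α - 1 / 2) / ℓ +
      (Real.exp (-(N * ℓ⁻¹ / 32)) +
      (32 * α * Real.exp α / w ^ 4 +
      (Real.exp (-(N * w ^ 4 / 32)) +
      (8 * Real.exp α / w +
      ((4 * α * Real.exp α) ^ 2 * (3 * ν * (4 * α / (α - 1 / 2))) / w ^ 2 +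
      K * (Real.exp (-(α / (128 * K) * (N * w ^ 4))) +
        Real.exp (-(α ^ 2 / (2048 * K ^ 2) * w)))))))))) := by
  have hα' : 0 < α := by linarith
  have hw0 : 0 < w := by linarith
  have hw1 : 1 ≤ w := by linarith
  have hN0 : 0 < N := by linarith
  have hℓ1 : 1 ≤ ℓ := le_trans (one_le_pow₀ hw1) hwℓ
  have hℓ0 : 0 < ℓ := by linarith
  have hv1 : 1 ≤ v := le_trans (one_le_pow₀ hw1) hwv
  have hv0 : 0 < v := by linarith
  have hn0 : 0 < n := by omega
  have hn' : (0 : ℝ) < n := by exact_mod_cast hn0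
  have hK' : (1 : ℝ) ≤ K := by exact_mod_cast hK
  have hKn' : (4 : ℝ) * K ≤ n := by exact_mod_cast hKn
  have hA₁ : 0 < N * ℓ⁻¹ := by positivity
  have hA₂ : 0 < N * w ^ 4 := by positivity
  -- Width of the cells: the expected number of pairs in a common cell is of order
  -- `(N w ^ 4) ^ 2 h = w`, while the expected degrees within a pair hardly differ, compared with
  -- the fluctuations of the degrees.
  set h : ℝ := 1 / (N ^ 2 * w ^ 7) with hh
  have hh0 : 0 < h := by positivity
  have hh1 : h ≤ 1 := by
    rw [hh, div_le_one (by positivity)]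
    exact one_le_mul_of_one_le_of_one_le (one_le_pow₀ hN) (one_le_pow₀ hw1)
  set L : ℕ := ⌊1 / h⌋₊ with hL
  have hL1 : (L : ℝ) * h ≤ 1 := by
    have := Nat.floor_le (show 0 ≤ 1 / h by positivity)
    calc (L : ℝ) * h ≤ 1 / h * h := by gcongr
      _ = 1 := by field_simp
  have hL2 : 1 / 2 ≤ (L : ℝ) * h := by
    have h1 : 1 ≤ 1 / h := by rwa [le_div_iff₀ hh0, one_mul]
    have h2 : 1 / h < L + 1 := Nat.lt_floor_add_one _
    have h3 : (1 : ℝ) ≤ L := by exact_mod_cast Nat.floor_pos.2 h1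
    rw [div_lt_iff₀ hh0] at h2
    nlinarith
  set M : ℕ := n / (2 * K) with hM
  have hM1 : 2 * M * K ≤ n := by
    calc 2 * M * K = n / (2 * K) * (2 * K) := by rw [hM]; ring
      _ ≤ n := Nat.div_mul_le_self _ _
  have hM2 : n / (4 * K) ≤ (M : ℝ) := by
    have h1 : n < (M + 1) * (2 * K) :=
      (Nat.div_lt_iff_lt_mul (by positivity)).1 (Nat.lt_succ_self _)
    have h2 : (n : ℝ) < (M + 1) * (2 * K) := by exact_mod_cast h1
    have h3 : 2 ≤ (n : ℝ) / (2 * K) := by rw [le_div_iff₀ (by positivity)]; linarith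
    have h4 : (n : ℝ) / (2 * K) < M + 1 := by rwa [div_lt_iff₀ (by positivity)]
    have h5 : (n : ℝ) / (4 * K) = n / (2 * K) / 2 := by field_simp; norm_num
    linarith
  have e₁ := exp_radiusOfRank (ν := ν) hα' hn0 hA₁
  have e₁' := exp_radiusOfRank_add_one (ν := ν) hα' hn0 hA₁
  have e₂ := exp_radiusOfRank (ν := ν) hα' hn0 hA₂
  have e₂' := exp_radiusOfRank_add_one (ν := ν) hα' hn0 hA₂
  have hN1 : n * (N * ℓ⁻¹ / n / 8) / 4 = N * ℓ⁻¹ / 32 := by field_simp; norm_num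
  have hN2 : n * (N * w ^ 4 / n / 8) / 4 = N * w ^ 4 / 32 := by field_simp; norm_num
  set q : ℝ := α / 4 * (N * w ^ 4 / n) * h with hq
  have hq0 : 0 < q := by positivity
  have hbound := measureReal_not_goodRadii_le (α := α) (ν := ν) (n := n) hα hR hn0
    (s₁ := radiusOfRank α ν n (N * ℓ⁻¹)) (s₂ := radiusOfRank α ν n (N * w ^ 4))
    (η := ℓ * w / N ^ 2) (k := k) (W := n * ℓ) (N := N) (V := N * v) (h := h) (q := q)
    (T := N ^ 2 / w ^ 4) (K := K) (L := L) (M := M) hs₁ hs₁R hs₂ hs₂R (by positivity) hη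
    (by positivity) (by rw [e₁, hN1]; exact hk)
    (by
      rw [e₂, hN2, le_div_iff₀ (by norm_num)]
      refine mul_le_mul_of_nonneg_left (hw.trans ?_) hN0.le
      exact le_self_pow₀ hw1 (by norm_num))
    (by positivity) hh0.le hL1 (by positivity) hM1 (by rw [e₂])
  rw [e₁, e₁', e₂, e₂', hN1, hN2] at hbound
  have t3 : n * (4 * α / (α - 1 / 2)) / (n * ℓ) = 4 * α / (α - 1 / 2) / ℓ := by
    rw [mul_div_mul_left _ _ hn'.ne']
  have t5 : (n : ℝ) ^ 2 * (8 * (N * ℓ⁻¹ / n) * (4 * α * (Real.exp α * (N * ℓ⁻¹ / n)) *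
      (ℓ * w / N ^ 2))) ≤ 32 * α * Real.exp α / w ^ 4 := by
    have : (n : ℝ) ^ 2 * (8 * (N * ℓ⁻¹ / n) * (4 * α * (Real.exp α * (N * ℓ⁻¹ / n)) *
      (ℓ * w / N ^ 2))) = 32 * α * Real.exp α * (w / ℓ) := by field_simp; ring
    rw [this, div_eq_mul_one_div _ (w ^ 4)]
    refine mul_le_mul_of_nonneg_left ?_ (by positivity)
    rw [div_le_div_iff₀ hℓ0 (by positivity)]
    linarith [show w * w ^ 4 = w ^ 5 by ring]
  have t7 : n * (8 * (Real.exp α * (N * w ^ 4 / n))) / (N * v) ≤ 8 * Real.exp α / w := by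
    have : n * (8 * (Real.exp α * (N * w ^ 4 / n))) / (N * v) =
      8 * Real.exp α * (w ^ 4 / v) := by field_simp
    rw [this, div_eq_mul_one_div _ w]
    refine mul_le_mul_of_nonneg_left ?_ (by positivity)
    rw [div_le_div_iff₀ hv0 hw0]
    linarith [show w ^ 4 * w = w ^ 5 by ring]
  have hβ : 0 < α - 1 / 2 := by linarith
  have t9 : (n : ℝ) ^ 3 * (4 * α * (Real.exp α * (N * w ^ 4 / n)) * h) ^ 2 *
      (3 * Real.exp (-radiusOfRank α ν n (N * w ^ 4) / 2) * (4 * α / (α - 1 / 2))) /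
        (N ^ 2 / w ^ 4) ≤
      (4 * α * Real.exp α) ^ 2 * (3 * ν * (4 * α / (α - 1 / 2))) / w ^ 2 := by
    have hb := (exp_radiusOfRank_bounds_of_one_le hα hν hN0 (one_le_pow₀ hw1 (n := 4)) hnN).2
    calc _ ≤ (n : ℝ) ^ 3 * (4 * α * (Real.exp α * (N * w ^ 4 / n)) * h) ^ 2 *
      (3 * (ν * N ^ 4 / n) * (4 * α / (α - 1 / 2))) / (N ^ 2 / w ^ 4) := by gcongr
      _ = _ := by
        rw [hh]
        generalize α - 1 / 2 = b at hβ ⊢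
        field_simp
  have hMLq : α / (32 * K) * (N * w ^ 4) ≤ M * (L * q) := by
    calc α / (32 * K) * (N * w ^ 4) = n / (4 * K) * (1 / 2 * (α / 4 * (N * w ^ 4 / n))) := by
          field_simp; norm_num
      _ ≤ M * (L * h * (α / 4 * (N * w ^ 4 / n))) := by gcongr
      _ = M * (L * q) := by rw [hq]; ring
  have t10 : α / (128 * K) * (N * w ^ 4) ≤ M * (L * q) / 4 := by
    have : α / (128 * K) * (N * w ^ 4) = α / (32 * K) * (N * w ^ 4) / 4 := by field_simp; norm_num
    linarith
  have t11 : α ^ 2 / (2048 * K ^ 2) * w ≤ M * (M * (L * q) / 4 * q) := by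
    calc α ^ 2 / (2048 * K ^ 2) * w = n / (4 * K) * (α / (128 * K) * (N * w ^ 4) * q) := by
          rw [hq, hh]; field_simp; norm_num
      _ ≤ _ := by gcongr
  refine hbound.trans ?_
  rw [t3]
  gcongr

/-- The bound of `GoodRadii.measureReal_notMem_le` for the scales of the theorem. -/
theorem GoodRadii.measureReal_notMem_rank_le {α ν : ℝ} {n : ℕ} (hα : 1 / 2 < α) (hν : 0 < ν)
    {N ℓ w v k c : ℝ} {K : ℕ} {r : Fin n → ℝ}
    (hc : c = (1 - 1 / Real.cosh α) / 4)
    (h : GoodRadii (discRadius ν n) (radiusOfRank α ν n (N * ℓ⁻¹)) (ℓ * w / N ^ 2) k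
        (n * (1 - 1 / Real.cosh α) / 4) (n * ℓ) (radiusOfRank α ν n (N * w ^ 4)) N (N * v)
        (N ^ 2 / w ^ 4) K r) (hn : 0 < n)
    (hnN : (n : ℝ) = N ^ (1 + 8 * α)) (hℓ : ℓ = Real.log n) (hN : 1 ≤ N) (hw : 32 ≤ w)
    (hwℓ : w ^ 5 ≤ ℓ) (hR : 0 ≤ discRadius ν n)
    (hη : ℓ * w / N ^ 2 ≤ 1) (hKn : 4 * (K + 1) ≤ c * n) (hδ : ν / N ≤ 1 / 20)
    (hcw : 3 ≤ ν * (c / 2) ^ 2 / (480 ^ 2 * 24) * w ^ 2) :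
    (Measure.pi fun _ : Fin n => angularLaw).real
      {θ | (fun i => ofPolar (r i, θ i)) ∉ {x : Fin n → Complex.UnitDisc |
        ∀ σ : Equiv.Perm (Fin n), IsRadialOrder x σ →
          DegreesOrderedUpTo ν x σ k ∧ HasInversionIn ν x σ N (N * v)}} ≤
      Real.exp (-ℓ) + ((1 / 2) ^ K + K * (10 * (ν / N) +
        (4 * K + 5) / √(c / 2 * (Real.exp (-1 / 2) * ν / 480) / 2) / w + 2 / w)) := by
  have hw0 : 0 < w := by linarith
  have hw1 : 1 ≤ w := by linarith
  have hN0 : 0 < N := by linarith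
  have hℓ1 : 1 ≤ ℓ := le_trans (one_le_pow₀ hw1) hwℓ
  have hℓ0 : 0 < ℓ := by linarith
  have hn' : (0 : ℝ) < n := by exact_mod_cast hn
  have hcosh : 1 < Real.cosh α := Real.one_lt_cosh.2 (by linarith)
  have hc0 : 0 < c := by
    have : 1 / Real.cosh α < 1 := by rw [div_lt_one (by linarith)]; exact hcosh
    linarith
  have hc1 : c ≤ 1 := by
    have : 0 < 1 / Real.cosh α := by positivity
    linarith
  have hm : n * (1 - 1 / Real.cosh α) / 4 = c * n := by rw [hc]; ring
  have hN4 : N ^ 4 * N ≤ n := by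
    calc N ^ 4 * N = N ^ (5 : ℝ) := by norm_cast
      _ ≤ N ^ (1 + 8 * α) := Real.rpow_le_rpow_of_exponent_le hN (by linarith)
      _ = n := hnN.symm
  have hs₁ := (exp_radiusOfRank_bounds_of_le_one hα hν hN0 (inv_pos.2 hℓ0)
    (inv_le_one_of_one_le₀ hℓ1) hnN).1
  obtain ⟨hs₂, hs₂'⟩ := exp_radiusOfRank_bounds_of_one_le hα hν hN0
    (one_le_pow₀ hw1 (n := 4)) hnN
  have hs₂'' : Real.exp (-radiusOfRank α ν n (N * w ^ 4) / 2) ≤ ν / N := by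
    refine hs₂'.trans ?_
    rw [div_le_div_iff₀ hn' hN0, mul_assoc]
    exact mul_le_mul_of_nonneg_left hN4 hν.le
  have hK0 : (0 : ℝ) ≤ K := Nat.cast_nonneg _
  -- This lies between `T = N ^ 2 / w ^ 4` and the standard deviation of the degrees in the window,
  -- which is at least of order `N ^ 2 / w ^ 2`.
  set τ : ℕ := ⌈N ^ 2 / w ^ 3⌉₊ with hτ
  have hτ0 : 0 < τ := Nat.ceil_pos.2 (by positivity)
  have hτ1 : N ^ 2 / w ^ 3 ≤ τ := Nat.le_ceil _
  have hτ2 : (τ : ℝ) ≤ N ^ 2 / w ^ 3 + 1 := (Nat.ceil_lt_add_one (by positivity)).le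
  have hb := h.measureReal_notMem_le hR (by positivity) hη (by rw [hm]; linarith)
    (by
      rw [hm, mul_comm]
      exact mul_le_mul_of_nonneg_left (hc1.trans hℓ1) hn'.le) (by rw [hm]; linarith)
    (by linarith) hτ0
  rw [hm] at hb
  refine hb.trans ?_
  refine add_le_add ?_ ?_
  · -- The factor `n ^ 2 = exp (2 ℓ)` of the union bound is absorbed.
    have h1 : (n : ℝ) ^ 2 = Real.exp (2 * ℓ) := by
      rw [hℓ, ← Real.exp_log hn', ← Real.exp_nat_mul, Real.exp_log hn']
      norm_num
    rw [h1, ← Real.exp_add, Real.exp_le_exp]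
    have h2 : c / 2 * n ≤ c * n - 2 := by linarith
    have h3 : ν * (c / 2) ^ 2 / (480 ^ 2 * 24) * w ^ 2 * ℓ ≤
        Real.exp (-radiusOfRank α ν n (N * ℓ⁻¹) / 2) * (ℓ * w / N ^ 2 * (c * n - 2)) ^ 2 /
          (480 ^ 2 * 24 * (n * ℓ)) := by
      calc ν * (c / 2) ^ 2 / (480 ^ 2 * 24) * w ^ 2 * ℓ
          = ν * N ^ 4 / n * (ℓ * w / N ^ 2 * (c / 2 * n)) ^ 2 / (480 ^ 2 * 24 * (n * ℓ)) := by
            field_simp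
        _ ≤ _ := by gcongr
    have h4 := mul_le_mul_of_nonneg_right hcw hℓ0.le
    linarith
  · have h1 : c / 2 * (Real.exp (-1 / 2) * ν / 480) / 2 * (N ^ 2 / w ^ 2) ^ 2 ≤
        (c * n - 2 * K) * (Real.exp (-(radiusOfRank α ν n (N * w ^ 4) + 1) / 2) / 480) / 2 := by
      have e1 : Real.exp (-(radiusOfRank α ν n (N * w ^ 4) + 1) / 2) =
          Real.exp (-1 / 2) * Real.exp (-radiusOfRank α ν n (N * w ^ 4) / 2) := by
        rw [← Real.exp_add]; congr 1; ring
      rw [e1]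
      have h2 : c / 2 * n ≤ c * n - 2 * K := by linarith
      calc c / 2 * (Real.exp (-1 / 2) * ν / 480) / 2 * (N ^ 2 / w ^ 2) ^ 2
          = c / 2 * n * (Real.exp (-1 / 2) * (ν * N ^ 4 / n * (w ^ 4)⁻¹) / 480) / 2 := by
            field_simp
        _ ≤ _ := by
            have h3 : 0 ≤ c * n - 2 * K := le_trans (by positivity) h2
            gcongr
    set c₁ := c / 2 * (Real.exp (-1 / 2) * ν / 480) / 2 with hc₁
    have hc₁0 : 0 < c₁ := by positivity
    have h2 : √c₁ * (N ^ 2 / w ^ 2) ≤ √((c * n - 2 * K) *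
        (Real.exp (-(radiusOfRank α ν n (N * w ^ 4) + 1) / 2) / 480) / 2) := by
      rw [← Real.sqrt_sq (show 0 ≤ N ^ 2 / w ^ 2 by positivity), ← Real.sqrt_mul hc₁0.le]
      exact Real.sqrt_le_sqrt h1
    have hsq : 0 < √c₁ := Real.sqrt_pos.2 hc₁0
    have hw3 : 1 ≤ N ^ 2 / w ^ 3 := by
      rw [div_le_one (by positivity)] at hη
      rw [le_div_iff₀ (by positivity), one_mul]
      have h3 : w ^ 5 * w ≤ N ^ 2 := (mul_le_mul_of_nonneg_right hwℓ hw0.le).trans hη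
      refine (pow_le_pow_right₀ hw1 (show 3 ≤ 6 by norm_num)).trans ?_
      rwa [← pow_succ] at h3
    have h3 : (2 * (2 * K + τ) + 1) / √((c * n - 2 * K) *
        (Real.exp (-(radiusOfRank α ν n (N * w ^ 4) + 1) / 2) / 480) / 2) ≤
        (4 * K + 5) / √c₁ / w := by
      calc _ ≤ (4 * K + 5) * (N ^ 2 / w ^ 3) / (√c₁ * (N ^ 2 / w ^ 2)) := by
            refine div_le_div₀ (by positivity) ?_ (by positivity) h2
            have h4 := mul_le_mul_of_nonneg_left hw3 hK0
            linarith
        _ = _ := by field_simp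
    have h4 : 2 * (N ^ 2 / w ^ 4 / τ) ≤ 2 / w := by
      calc 2 * (N ^ 2 / w ^ 4 / τ) ≤ 2 * (N ^ 2 / w ^ 4 / (N ^ 2 / w ^ 3)) := by gcongr
        _ = 2 / w := by field_simp
    have h5 : 2 * (5 * Real.exp (-radiusOfRank α ν n (N * w ^ 4) / 2)) ≤ 10 * (ν / N) := by
      linarith
    gcongr

/-! ### Convergence -/

open Filter Topology in
theorem tendsto_discRadius {ν : ℝ} (hν : 0 < ν) :
    Tendsto (fun n : ℕ => discRadius ν n) atTop atTop :=
  (Real.tendsto_log_atTop.comp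
    (tendsto_natCast_atTop_atTop.atTop_div_const hν)).const_mul_atTop two_pos

open Filter Topology in
/-- Nodes within a bounded distance of the centre do not exist for large `n`. -/
theorem tendsto_card_center {α ν : ℝ} (hα : 1 / 2 < α) (hν : 0 < ν) :
    Tendsto (fun n : ℕ => n * (8 * Real.exp (-α * (discRadius ν n - 6)))) atTop (𝓝 0) := by
  have h1 : Tendsto (fun n : ℕ => 8 * ν * Real.exp (6 * α) *
      Real.exp (-((α - 1 / 2) * discRadius ν n))) atTop (𝓝 0) := by
    rw [← mul_zero (8 * ν * Real.exp (6 * α))]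
    exact (Real.tendsto_exp_neg_atTop_nhds_zero.comp
      ((tendsto_discRadius hν).const_mul_atTop (by linarith))).const_mul _
  refine h1.congr' ?_
  filter_upwards [eventually_gt_atTop 0] with n hn
  have hn' : (0 : ℝ) < n := by exact_mod_cast hn
  have h2 : (n : ℝ) = ν * Real.exp (discRadius ν n / 2) := by
    rw [discRadius, mul_div_cancel_left₀ _ two_ne_zero, Real.exp_log (by positivity)]
    field_simp
  have h3 : Real.exp (6 * α) * Real.exp (-((α - 1 / 2) * discRadius ν n)) =
      Real.exp (discRadius ν n / 2) * Real.exp (-α * (discRadius ν n - 6)) := by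
    rw [← Real.exp_add, ← Real.exp_add]
    congr 1
    ring
  linear_combination 8 * ν * h3 - 8 * Real.exp (-α * (discRadius ν n - 6)) * h2

open Filter Topology in
/-- The error terms vanish, up to the probability `2 ^ (-K)` that none of the `K` pairs of nodes
is inverted. -/
theorem tendsto_error_terms {α ν c : ℝ} (hα : 1 / 2 < α) (hν : 0 < ν)
    (hc : c = (1 - 1 / Real.cosh α) / 4) (hc0 : 0 < c) {N ℓ w : ℕ → ℝ} {K : ℕ} (hK : 0 < K)
    (hNt : Tendsto N atTop atTop) (hℓt : Tendsto ℓ atTop atTop) (hwt : Tendsto w atTop atTop)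
    (hNℓ : Tendsto (fun n => N n * (ℓ n)⁻¹) atTop atTop) :
    Tendsto (fun n : ℕ =>
      n * (8 * Real.exp (-α * (discRadius ν n - 6))) +
      (Real.exp (-(n * (1 - 1 / Real.cosh α) / 4)) +
      (4 * α / (α - 1 / 2) / ℓ n +
      (Real.exp (-(N n * (ℓ n)⁻¹ / 32)) +
      (32 * α * Real.exp α / w n ^ 4 +
      (Real.exp (-(N n * w n ^ 4 / 32)) +
      (8 * Real.exp α / w n +
      ((4 * α * Real.exp α) ^ 2 * (3 * ν * (4 * α / (α - 1 / 2))) / w n ^ 2 +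
      K * (Real.exp (-(α / (128 * K) * (N n * w n ^ 4))) +
        Real.exp (-(α ^ 2 / (2048 * K ^ 2) * w n)))))))))) +
      (Real.exp (-ℓ n) + ((1 / 2) ^ K + K * (10 * (ν / N n) +
        (4 * K + 5) / √(c / 2 * (Real.exp (-1 / 2) * ν / 480) / 2) / w n + 2 / w n))))
      atTop (𝓝 ((1 / 2) ^ K)) := by
  have hα' : 0 < α := by linarith
  have hn : Tendsto (fun n : ℕ => (n : ℝ)) atTop atTop := tendsto_natCast_atTop_atTop
  have hνN : Tendsto (fun n => ν / N n) atTop (𝓝 0) := hNt.const_div_atTop _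
  have hNw : Tendsto (fun n => N n * w n ^ 4) atTop atTop :=
    hNt.atTop_mul_atTop₀ ((tendsto_pow_atTop (by norm_num)).comp hwt)
  have hexp : ∀ {f : ℕ → ℝ}, Tendsto f atTop atTop →
      Tendsto (fun n => Real.exp (-f n)) atTop (𝓝 0) := fun h =>
    Real.tendsto_exp_neg_atTop_nhds_zero.comp h
  have hlim : ((1 / 2 : ℝ) ^ K) = ((0 : ℝ) + (0 + (0 + (0 + (0 + (0 + (0 + (0 +
      (K : ℝ) * (0 + 0))))))))) + (0 + ((1 / 2) ^ K + (K : ℝ) * (10 * 0 + 0 + 0))) := by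
    ring
  rw [congrArg 𝓝 hlim]
  have hK' : (0 : ℝ) < K := by exact_mod_cast hK
  have hp : ∀ p : ℕ, p ≠ 0 → Tendsto (fun n => w n ^ p) atTop atTop := fun p hp =>
    (tendsto_pow_atTop hp).comp hwt
  refine Tendsto.add ((tendsto_card_center hα hν).add (Tendsto.add ?_ (Tendsto.add ?_
    (Tendsto.add ?_ (Tendsto.add ?_ (Tendsto.add ?_ (Tendsto.add ?_ (Tendsto.add ?_
    ((Tendsto.add ?_ ?_).const_mul _))))))))) ((hexp hℓt).add
    (tendsto_const_nhds.add (((hνN.const_mul _).add ?_).add ?_ |>.const_mul _)))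
  · refine (hexp (hn.atTop_mul_const hc0)).congr fun n => ?_
    rw [hc]
    congr 2
    ring
  · exact hℓt.const_div_atTop _
  · exact hexp (hNℓ.atTop_div_const (by norm_num))
  · exact (hp 4 (by norm_num)).const_div_atTop _
  · exact hexp (hNw.atTop_div_const (by norm_num))
  · exact hwt.const_div_atTop _
  · exact (hp 2 (by norm_num)).const_div_atTop _
  · exact hexp (hNw.const_mul_atTop (by positivity))
  · exact hexp (hwt.const_mul_atTop (by positivity))
  · exact hwt.const_div_atTop _
  · exact hwt.const_div_atTop _

/-- The theorem for a given number of nodes, with `K` pairs of nodes, the prefix of length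
`N / ℓ` and the window at rank `N w ^ 4`. -/
theorem nodesLaw_real_compl_goodEvent_le {α ν : ℝ} {n : ℕ} (hα : 1 / 2 < α) (hν : 0 < ν)
    {N ℓ w v k c : ℝ} {K : ℕ} (hc : c = (1 - 1 / Real.cosh α) / 4) (hc0 : 0 < c) (hK : 0 < K)
    (hn0 : 0 < n) (hnN : (n : ℝ) = N ^ (1 + 8 * α)) (hℓ : ℓ = Real.log n) (hN1 : 1 ≤ N)
    (hw1 : 32 ≤ w) (hℓ1 : 1 ≤ ℓ) (hwℓ : w ^ 5 ≤ ℓ) (hwv : w ^ 5 ≤ v)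
    (hR : 6 ≤ discRadius ν n) (hKn : 4 * K ≤ n) (hKc : 4 * (K + 1) ≤ c * n)
    (hδ : ν / N ≤ 1 / 20) (hνe : ν / N ≤ Real.exp (-1)) (hℓN1 : ℓ / N ≤ 1)
    (hνℓ : ν * (ℓ / N) ≤ Real.exp (-1)) (hαℓ : Real.exp α * (ℓ / N) ≤ 1)
    (hk : k ≤ N * ℓ⁻¹ / 32) (hcw : 3 ≤ ν * (c / 2) ^ 2 / (480 ^ 2 * 24) * w ^ 2) :
    (nodesLaw α ν n).real
      {x | ∀ σ : Equiv.Perm (Fin n), IsRadialOrder x σ →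
          DegreesOrderedUpTo ν x σ k ∧ HasInversionIn ν x σ N (N * v)}ᶜ ≤
      n * (8 * Real.exp (-α * (discRadius ν n - 6))) +
      (Real.exp (-(n * (1 - 1 / Real.cosh α) / 4)) +
      (4 * α / (α - 1 / 2) / ℓ +
      (Real.exp (-(N * ℓ⁻¹ / 32)) +
      (32 * α * Real.exp α / w ^ 4 +
      (Real.exp (-(N * w ^ 4 / 32)) +
      (8 * Real.exp α / w +
      ((4 * α * Real.exp α) ^ 2 * (3 * ν * (4 * α / (α - 1 / 2))) / w ^ 2 +
      K * (Real.exp (-(α / (128 * K) * (N * w ^ 4))) +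
        Real.exp (-(α ^ 2 / (2048 * K ^ 2) * w)))))))))) +
      (Real.exp (-ℓ) + ((1 / 2) ^ K + K * (10 * (ν / N) +
        (4 * K + 5) / √(c / 2 * (Real.exp (-1 / 2) * ν / 480) / 2) / w + 2 / w))) := by
  have hα' : 0 < α := by linarith
  have hn' : (0 : ℝ) < n := by exact_mod_cast hn0
  have hN0 : 0 < N := by linarith
  have hℓ0 : 0 < ℓ := by linarith
  have hw0 : 0 < w := by linarith
  have hw4 : w ^ 4 ≤ ℓ :=
    (pow_le_pow_right₀ (by linarith) (show 4 ≤ 5 by norm_num)).trans hwℓ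
  have hw11 : w ≤ ℓ := (le_self_pow₀ (by linarith) (by norm_num)).trans hwℓ
  have hN5 : N ^ 4 * N ≤ n := by
    calc N ^ 4 * N = N ^ (5 : ℝ) := by norm_cast
      _ ≤ N ^ (1 + 8 * α) := Real.rpow_le_rpow_of_exponent_le hN1 (by linarith)
      _ = n := hnN.symm
  have hN2 : N * N ≤ n :=
    (mul_le_mul_of_nonneg_right (le_self_pow₀ hN1 (by norm_num)) hN0.le).trans hN5
  have hD : ν * N ^ 4 / n ≤ ν / N := by
    rw [div_le_div_iff₀ hn' hN0, mul_assoc]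
    exact mul_le_mul_of_nonneg_left hN5 hν.le
  have hs₁ := (exp_radiusOfRank_bounds_of_le_one hα hν hN0 (inv_pos.2 hℓ0)
    (inv_le_one_of_one_le₀ hℓ1) hnN).2
  have hs₂ := (exp_radiusOfRank_bounds_of_one_le hα hν hN0
    (one_le_pow₀ (show 1 ≤ w by linarith) (n := 4)) hnN).2
  have hs₁2 : 2 ≤ radiusOfRank α ν n (N * ℓ⁻¹) := by
    have h1 : Real.exp (-radiusOfRank α ν n (N * ℓ⁻¹) / 2) ≤ Real.exp (-1) := by
      refine hs₁.trans (le_trans ?_ hνℓ)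
      rw [inv_inv]
      refine (mul_le_mul_of_nonneg_right hD hℓ0.le).trans (le_of_eq ?_)
      ring
    have := Real.exp_le_exp.1 h1
    linarith
  have hs₂2 : 2 ≤ radiusOfRank α ν n (N * w ^ 4) := by
    have := Real.exp_le_exp.1 (hs₂.trans (hD.trans hνe))
    linarith
  have hs₁R : radiusOfRank α ν n (N * ℓ⁻¹) ≤ discRadius ν n := by
    have h1 := exp_radiusOfRank (ν := ν) hα' hn0 (show 0 < N * ℓ⁻¹ by positivity)
    have h2 : N * ℓ⁻¹ / n ≤ 1 := by
      rw [div_le_one hn', ← div_eq_mul_inv]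
      refine (div_le_self hN0.le hℓ1).trans ?_
      nlinarith
    rw [← h1, Real.exp_le_one_iff] at h2
    nlinarith
  have hs₂R : radiusOfRank α ν n (N * w ^ 4) + 1 ≤ discRadius ν n := by
    have h1 := exp_radiusOfRank_add_one (ν := ν) hα' hn0 (show 0 < N * w ^ 4 by positivity)
    have h2 : Real.exp α * (N * w ^ 4 / n) ≤ 1 := by
      refine le_trans ?_ hαℓ
      refine mul_le_mul_of_nonneg_left ?_ (Real.exp_pos _).le
      rw [div_le_div_iff₀ hn' hN0]
      calc N * w ^ 4 * N = w ^ 4 * (N * N) := by ring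
        _ ≤ ℓ * n := by gcongr
    rw [← h1, Real.exp_le_one_iff] at h2
    nlinarith
  have hη : ℓ * w / N ^ 2 ≤ 1 := by
    rw [div_le_one hN0] at hℓN1
    rw [div_le_one (by positivity), sq]
    exact mul_le_mul hℓN1 (hw11.trans hℓN1) hw0.le hN0.le
  have hR2 : 2 ≤ discRadius ν n := by linarith
  have := isProbabilityMeasure_radialLaw hα hR2
  have hmeas := (measurableSet_goodEvent ν n (N) k (N * v)).compl
  have hφ : Measurable fun (p : (Fin n → ℝ) × (Fin n → ℝ)) i => ofPolar (p.1 i, p.2 i) :=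
    measurable_pi_lambda _ fun i => measurable_ofPolar.comp
      (((measurable_pi_apply i).comp measurable_fst).prodMk
        ((measurable_pi_apply i).comp measurable_snd))
  rw [nodesLaw_real_eq hα hR2 hmeas]
  refine (measureReal_prod_le_add _ _ (hφ hmeas) (by positivity) fun r hr =>
    GoodRadii.measureReal_notMem_rank_le hα hν hc hr hn0 hnN hℓ hN1 hw1 hwℓ (by linarith) hη
      hKc hδ hcw).trans ?_
  gcongr
  exact measureReal_not_goodRadii_rank_le hα hν hnN hN1 hw1 hwℓ hwv hK hKn hR hs₁2 hs₁R hs₂2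
    hs₂R hη hk

open Filter Topology in
theorem eventually_nodesLaw_real_compl_goodEvent_lt {α ν : ℝ} (hα : 1 / 2 < α) (hν : 0 < ν)
    {v : ℕ → ℝ} (hv : Tendsto v atTop atTop) {ε : ℝ} (hε : 0 < ε) :
    ∀ᶠ n : ℕ in atTop, (nodesLaw α ν n).real
      {x | ∀ σ : Equiv.Perm (Fin n), IsRadialOrder x σ →
          DegreesOrderedUpTo ν x σ (rankBound α n) ∧
          HasInversionIn ν x σ ((n : ℝ) ^ beta α) ((n : ℝ) ^ beta α * v n)}ᶜ < ε := by
  obtain ⟨K, hK, hKε⟩ : ∃ K : ℕ, 0 < K ∧ (1 / 2 : ℝ) ^ K < ε := by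
    obtain ⟨K, hK⟩ := exists_pow_lt_of_lt_one hε (show (1 / 2 : ℝ) < 1 by norm_num)
    exact ⟨K + 1, Nat.succ_pos _,
      (pow_le_pow_of_le_one (by norm_num) (by norm_num) (Nat.le_succ K)).trans_lt hK⟩
  have hα' : 0 < α := by linarith
  have hβ : 0 < beta α := by unfold beta; positivity
  set c : ℝ := (1 - 1 / Real.cosh α) / 4 with hc
  have hc0 : 0 < c := by
    have : 1 / Real.cosh α < 1 := by
      rw [div_lt_one (Real.cosh_pos _)]; exact Real.one_lt_cosh.2 hα'.ne'
    linarith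
  set ℓ : ℕ → ℝ := fun n => Real.log n with hℓ
  set N : ℕ → ℝ := fun n => (n : ℝ) ^ beta α with hN
  -- The slowly growing sequence `w` satisfies `w ^ 5 ≤ v` and `w ^ 5 ≤ log n`.
  set w : ℕ → ℝ := fun n => (min (v n) (ℓ n)) ^ (1 / 5 : ℝ) with hw
  have hn : Tendsto (fun n : ℕ => (n : ℝ)) atTop atTop := tendsto_natCast_atTop_atTop
  have hℓt : Tendsto ℓ atTop atTop := Real.tendsto_log_atTop.comp hn
  have hNt : Tendsto N atTop atTop := (tendsto_rpow_atTop hβ).comp hn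
  have hmin : Tendsto (fun n => min (v n) (ℓ n)) atTop atTop := by
    refine tendsto_atTop.2 fun b => ?_
    filter_upwards [hv.eventually_ge_atTop b, hℓt.eventually_ge_atTop b] with n h1 h2
    exact le_min h1 h2
  have hwt : Tendsto w atTop atTop :=
    (tendsto_rpow_atTop (by norm_num)).comp hmin
  have hℓN : Tendsto (fun n => ℓ n / N n) atTop (𝓝 0) :=
    ((isLittleO_log_rpow_atTop hβ).tendsto_div_nhds_zero).comp hn
  have hνN : Tendsto (fun n => ν / N n) atTop (𝓝 0) := hNt.const_div_atTop _
  have hNℓ : Tendsto (fun n => N n * (ℓ n)⁻¹) atTop atTop := by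
    have h1 : Tendsto (fun n => ℓ n / N n) atTop (𝓝[>] 0) := by
      refine tendsto_nhdsWithin_iff.2 ⟨hℓN, ?_⟩
      filter_upwards [hℓt.eventually_gt_atTop 0, hNt.eventually_gt_atTop 0] with n h1 h2
      exact div_pos h1 h2
    refine h1.inv_tendsto_nhdsGT_zero.congr fun n => ?_
    rw [Pi.inv_apply, inv_div, div_eq_mul_inv]
  have hrank : Tendsto (fun n => ℓ n ^ (-(2 * α - 1))) atTop (𝓝 0) :=
    (tendsto_rpow_neg_atTop (by linarith)).comp hℓt
  have hsum := (tendsto_error_terms hα hν hc hc0 hK hNt hℓt hwt hNℓ).eventually_lt_const hKε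
  filter_upwards [hsum, (tendsto_discRadius hν).eventually_ge_atTop 6,
    hNt.eventually_ge_atTop 1, hwt.eventually_ge_atTop 32, hℓt.eventually_ge_atTop 1,
    hv.eventually_ge_atTop 0, eventually_ge_atTop (4 * K), eventually_gt_atTop 0,
    (hn.const_mul_atTop hc0).eventually_ge_atTop (4 * (K + 1)),
    hνN.eventually_le_const (show (0 : ℝ) < 1 / 20 by norm_num),
    hℓN.eventually_le_const (show (0 : ℝ) < 1 by norm_num),
    (hℓN.const_mul ν).eventually_le_const (u := Real.exp (-1))
      (by rw [mul_zero]; exact Real.exp_pos _),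
    (hℓN.const_mul (Real.exp α)).eventually_le_const (u := 1) (by rw [mul_zero]; norm_num),
    hνN.eventually_le_const (Real.exp_pos (-1)),
    hrank.eventually_le_const (show (0 : ℝ) < 1 / 32 by norm_num),
    (((tendsto_pow_atTop two_ne_zero).comp hwt).const_mul_atTop
      (show 0 < ν * (c / 2) ^ 2 / (480 ^ 2 * 24) by positivity)).eventually_ge_atTop 3]
    with n hsum hR hN1 hw1 hℓ1 hv0 hKn hn0 hKc hδ hℓN1 hνℓ hαℓ hνe hrk hcw
  refine lt_of_le_of_lt ?_ hsum
  have hn' : (0 : ℝ) < n := by exact_mod_cast hn0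
  have hN0 : 0 < N n := by linarith
  have hℓ0 : 0 < ℓ n := by linarith
  have hw0 : 0 < w n := by linarith
  have hnN : (n : ℝ) = N n ^ (1 + 8 * α) := by
    rw [hN]
    simp only
    rw [← Real.rpow_mul hn'.le, beta, one_div_mul_cancel (by positivity), Real.rpow_one]
  have hw5 : w n ^ 5 = min (v n) (ℓ n) := by
    rw [hw]
    simp only
    rw [← Real.rpow_natCast, ← Real.rpow_mul (le_min hv0 hℓ0.le)]
    norm_num
  have hwℓ : w n ^ 5 ≤ ℓ n := hw5.trans_le (min_le_right _ _)
  have hwv : w n ^ 5 ≤ v n := hw5.trans_le (min_le_left _ _)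
  have hk : rankBound α n ≤ N n * (ℓ n)⁻¹ / 32 := by
    have h1 : ℓ n ^ (-2 * α) = ℓ n ^ (-(2 * α - 1)) * (ℓ n)⁻¹ := by
      rw [← Real.rpow_neg_one (ℓ n), ← Real.rpow_add hℓ0]
      congr 1
      ring
    change N n * ℓ n ^ (-2 * α) ≤ _
    rw [h1, mul_div_assoc]
    refine mul_le_mul_of_nonneg_left ?_ hN0.le
    rw [div_eq_mul_one_div, mul_comm]
    exact mul_le_mul_of_nonneg_left hrk (by positivity)
  exact nodesLaw_real_compl_goodEvent_le hα hν hc hc0 hK hn0 hnN rfl hN1 hw1 hℓ1 hwℓ hwv hR hKn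
    hKc hδ hνe hℓN1 hνℓ hαℓ hk hcw

end RHG

open MeasureTheory in
/-- With probability tending to one, every ordering of the nodes by increasing radius (such an
ordering exists, and is almost surely unique) is strictly decreasing in degree up to rank `k_n`,
these degrees exceed all remaining ones, and some `i ∈ [n ^ β, n ^ β v_n]` has
`deg X_(i) < deg X_(i+1)`. -/
theorem theorem3p2 (α ν : ℝ) (hα : 1 / 2 < α) (hν : 0 < ν) (v : ℕ → ℝ)
    (hv : Filter.Tendsto v Filter.atTop Filter.atTop) :
    Filter.Tendsto
      (fun n : ℕ => RHG.nodesLaw α ν n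
        {x | ∀ σ : Equiv.Perm (Fin n), RHG.IsRadialOrder x σ →
          RHG.DegreesOrderedUpTo ν x σ (RHG.rankBound α n) ∧
          RHG.HasInversionIn ν x σ ((n : ℝ) ^ RHG.beta α) ((n : ℝ) ^ RHG.beta α * v n)})
      Filter.atTop (nhds 1) := by
  have hprob : ∀ᶠ n : ℕ in Filter.atTop, IsProbabilityMeasure (RHG.nodesLaw α ν n) := by
    filter_upwards [(RHG.tendsto_discRadius hν).eventually_ge_atTop 2] with n hR
    have := RHG.isProbabilityMeasure_radialLaw hα hR
    have : IsProbabilityMeasure (RHG.nodeLaw α ν n) :=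
      Measure.isProbabilityMeasure_map RHG.measurable_ofPolar.aemeasurable
    unfold RHG.nodesLaw
    infer_instance
  rw [← ENNReal.ofReal_one]
  have hreal : Filter.Tendsto (fun n : ℕ => (RHG.nodesLaw α ν n).real
        {x | ∀ σ : Equiv.Perm (Fin n), RHG.IsRadialOrder x σ →
          RHG.DegreesOrderedUpTo ν x σ (RHG.rankBound α n) ∧
          RHG.HasInversionIn ν x σ ((n : ℝ) ^ RHG.beta α) ((n : ℝ) ^ RHG.beta α * v n)})
      Filter.atTop (nhds 1) := by
    refine Metric.tendsto_nhds.2 fun ε hε => ?_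
    filter_upwards [hprob, RHG.eventually_nodesLaw_real_compl_goodEvent_lt hα hν hv hε] with n hn h
    have h1 := probReal_add_probReal_compl (μ := RHG.nodesLaw α ν n)
      (RHG.measurableSet_goodEvent ν n ((n : ℝ) ^ RHG.beta α) (RHG.rankBound α n)
        ((n : ℝ) ^ RHG.beta α * v n))
    rw [dist_comm, Real.dist_eq, ← h1, add_sub_cancel_left, abs_of_nonneg measureReal_nonneg]
    exact h
  refine (ENNReal.tendsto_ofReal hreal).congr' ?_
  filter_upwards [hprob] with n hn
  exact ofReal_measureReal
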